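/- Let $A:\mathbb R\to M_n(\mathbb R)$, $B:\mathbb R\to M_{n,m}(\mathbb R)$ be smooth and bounded, with $B(t)$ injective for every $t$, such that * (Kalman condition) for every $t$, $\mathrm{span}\{B_i(t)v : v\in\mathbb R^m,\ i\in\mathbb N\}=\mathbb R^n$, where $B_0=B$, $B_{i+1}=\dot B_i-AB_i$; * (uniform controllability) there are $s,\beta>0$ with $\int_t^{t+s}\Phi_A(t,\tau)B(\tau)B(\tau)^\top\Phi_A(t,\tau)^\top d\tau\succ\beta I$ for every $t$, where $\Phi_F(t,\tau)$ denotes the transition matrix of $\dot x=F(t)x$. Let $Q:\mathbb R\to\mathrm{Sym}(n)$, $S:\mathbb R\to M_{n,m}(\mathbb R)$, $R:\mathbb R\to\mathrm{Sym}(m)$ be smooth and bounded, with $R(t)\succ\alpha I$ for all $t$ and some $\alpha>0$, and $Q-SR^{-1}S^\top\succeq0$ at every $t$. The *optimal synthesis* of a cost $c(t,x,u)$ is the set of all trajectories $x:[t_0,t_1]\to\mathbb R^n$ of $\dot x=Ax+Bu$, for all $t_0<t_1$ and controls $u\in L^2([t_0,t_1],\mathbb R^m)$, that minimize $\int_{t_0}^{t_1}c(t,x,u)\,dt$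 among the trajectories on $[t_0,t_1]$ with the same end-points. Let $\Gamma$ be the optimal synthesis of $c=x^\top Qx+2x^\top Su+u^\top Ru$. *Product form.* $F:\mathbb R\to M_n(\mathbb R)$ is exponentially stable (resp. anti-stable) if for some $\alpha,\beta>0$ one has $\|\Phi_F(t,t_0)\|\le\alpha e^{-\beta(t-t_0)}$ for all $t\ge t_0$ (resp. $\|\Phi_F(t,t_0)\|\le\alpha e^{\beta(t-t_0)}$ for all $t\le t_0$). $\Gamma$ is *characterized by* $(A_+,A_-)$ if $A_\pm=A-BR^{-1}(S^\top+B^\top P_\pm)$, where $P_\pm:\mathbb R\to\mathrm{Sym}(n)$ are solutions on $\mathbb R$ of the Riccati equation $\dot P=-PA-A^\top P+(PB+S)R^{-1}(B^\top P+S^\top)-Q$ such that $A_+$ is exponentially stable and $A_-$ exponentially anti-stable. $\Gamma$ *admits a product form* if it is characterized by a pair $(A_+,A_-)$ for which there are a decomposition $\mathbb R^n=E_1\oplus E_2$ with $E_1,E_2\ne\{0\}$ and a smooth $M:\mathbb R\to GL_n(\mathbb R)$ such that, for every $t$, the matrices $M^{-1}(-\dot M+A_\pm M)(t)$ leave $E_1$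 and $E_2$ invariant. *Product structure.* A *canonical cost* is a cost $(u+Kx)^\top R'(u+Kx)$ with $R':\mathbb R\to\mathrm{Sym}(m)$ smooth, bounded, uniformly positive definite, $\det R'(0)=1$, and $K:\mathbb R\to M_{m,n}(\mathbb R)$ smooth, bounded, with $A-BK$ exponentially stable. The problem $(A,B)$ with this cost *admits a product structure* if there are $N>1$, integers $1\le m_i\le n_i$ ($i=1,\dots,N$) with $\sum n_i=n$, $\sum m_i=m$, and smooth $M:\mathbb R\to GL_n(\mathbb R)$, $U:\mathbb R\to GL_m(\mathbb R)$ such that $$M^{-1}(-\dot M+(A-BK)M)=\mathrm{diag}(A_1,\dots,A_N),\quad M^{-1}BU=\mathrm{diag}(B_1,\dots,B_N),\quad U^\top R'U=\mathrm{diag}(R_1,\dots,R_N)$$ with smooth blocks $A_i(t)\in M_{n_i}(\mathbb R)$, $B_i(t)\in M_{n_i,m_i}(\mathbb R)$, $R_i(t)\in\mathrm{Sym}(m_i)$, each $(A_i,B_i)$ satisfying the Kalman condition and each $R_i$ uniformly positive definite. **Proposition.** $\Gamma$ admits a product form if and only if there is a canonical cost whose optimal synthesis is $\Gamma$ and which,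 together with $(A,B)$, admits a product structure. -/

import Mathlib

open MeasureTheory Matrix
open scoped ContDiff

namespace LQ

/-! ### Matrix-valued mappings of time

Smoothness, boundedness, differentiation and integration of matrix-valued mappings are expressed
entrywise, which agrees with the corresponding notion for any norm on the space of matrices. -/

section Mappings

variable {ι κ : Type*}

/-- `F : ℝ → M_{ι,κ}(ℝ)` is `C^∞`. -/
def SmoothMap (F : ℝ → Matrix ι κ ℝ) : Prop :=
  ∀ i j, ContDiff ℝ ∞ (fun t => F t i j)

/-- `F : ℝ → M_{ι,κ}(ℝ)` is bounded. -/
def BoundedMap (F : ℝ → Matrix ι κ ℝ) : Prop :=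
  ∃ C : ℝ, ∀ t i j, |F t i j| ≤ C

/-- The derivative of a differentiable matrix-valued mapping (only used for smooth mappings). -/
noncomputable def matDeriv (F : ℝ → Matrix ι κ ℝ) (t : ℝ) : Matrix ι κ ℝ :=
  Matrix.of fun i j => deriv (fun s => F s i j) t

/-- `F` is differentiable at `t` with derivative the matrix `F'`. -/
def HasMatDerivAt (F : ℝ → Matrix ι κ ℝ) (F' : Matrix ι κ ℝ) (t : ℝ) : Prop :=
  ∀ i j, HasDerivAt (fun s => F s i j) (F' i j) t

end Mappings

/-! ### Transition matrices, stability, controllability -/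

section Systems

variable {ι κ : Type*} [Fintype ι] [DecidableEq ι] [Fintype κ] [DecidableEq κ]

/-- `Φ t τ` is the transition matrix `Φ_A(t, τ)` of `x' = A x`. -/
def IsTransitionMatrix (A : ℝ → Matrix ι ι ℝ) (Φ : ℝ → ℝ → Matrix ι ι ℝ) : Prop :=
  ∀ τ, Φ τ τ = 1 ∧ ∀ t, HasMatDerivAt (fun s => Φ s τ) (A t * Φ t τ) t

/-- `A` is exponentially stable. -/
def ExpStable (A : ℝ → Matrix ι ι ℝ) : Prop :=
  ∃ Φ, IsTransitionMatrix A Φ ∧ ∃ α > (0 : ℝ), ∃ β > (0 : ℝ), ∀ t₀ t, t₀ ≤ t →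
    ∀ i j, |Φ t t₀ i j| ≤ α * Real.exp (-β * (t - t₀))

/-- `A` is exponentially anti-stable. -/
def ExpAntiStable (A : ℝ → Matrix ι ι ℝ) : Prop :=
  ∃ Φ, IsTransitionMatrix A Φ ∧ ∃ α > (0 : ℝ), ∃ β > (0 : ℝ), ∀ t₀ t, t ≤ t₀ →
    ∀ i j, |Φ t t₀ i j| ≤ α * Real.exp (β * (t - t₀))

/-- The mappings `B₀ = B`, `B_{i+1} = B_i' - A B_i`. -/
noncomputable def kalmanSeq (A : ℝ → Matrix ι ι ℝ) (B : ℝ → Matrix ι κ ℝ) :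
    ℕ → ℝ → Matrix ι κ ℝ
  | 0 => B
  | i + 1 => fun t => matDeriv (kalmanSeq A B i) t - A t * kalmanSeq A B i t

/-- The Kalman sufficient controllability condition at every time. -/
def KalmanCondition (A : ℝ → Matrix ι ι ℝ) (B : ℝ → Matrix ι κ ℝ) : Prop :=
  ∀ t, Submodule.span ℝ {w : ι → ℝ | ∃ (i : ℕ) (v : κ → ℝ), w = kalmanSeq A B i t *ᵥ v} = ⊤

/-- Uniform controllability: the controllability Gramians over `[t, t + s]` are bounded below by
`β I`, uniformly in `t`. -/
def UniformlyControllable (A : ℝ → Matrix ι ι ℝ) (B : ℝ → Matrix ι κ ℝ) : Prop :=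
  ∃ Φ, IsTransitionMatrix A Φ ∧ ∃ s > (0 : ℝ), ∃ β > (0 : ℝ), ∀ t : ℝ,
    ((Matrix.of fun i j =>
        ∫ τ in t..(t + s), (Φ t τ * B τ * (B τ)ᵀ * (Φ t τ)ᵀ) i j) - β • (1 : Matrix ι ι ℝ)).PosDef

/-- `R` is uniformly positive definite. -/
def UniformlyPosDef (R : ℝ → Matrix κ κ ℝ) : Prop :=
  ∃ α > (0 : ℝ), ∀ t, (R t - α • (1 : Matrix κ κ ℝ)).PosDef

/-- The standing assumptions on the dynamics `x' = A x + B u`. -/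
structure DynamicsAssumption (A : ℝ → Matrix ι ι ℝ) (B : ℝ → Matrix ι κ ℝ) : Prop where
  smooth_A : SmoothMap A
  smooth_B : SmoothMap B
  bounded_A : BoundedMap A
  bounded_B : BoundedMap B
  injective_B : ∀ t, Function.Injective (fun v : κ → ℝ => B t *ᵥ v)
  kalman : KalmanCondition A B
  controllable : UniformlyControllable A B

/-- The standing assumptions on the cost `xᵀ Q x + 2 xᵀ S u + uᵀ R u`. -/
structure CostAssumption (Q : ℝ → Matrix ι ι ℝ) (S : ℝ → Matrix ι κ ℝ)
    (R : ℝ → Matrix κ κ ℝ) : Prop where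
  symm_Q : ∀ t, (Q t).IsSymm
  symm_R : ∀ t, (R t).IsSymm
  smooth_Q : SmoothMap Q
  smooth_S : SmoothMap S
  smooth_R : SmoothMap R
  bounded_Q : BoundedMap Q
  bounded_S : BoundedMap S
  bounded_R : BoundedMap R
  posDef_R : UniformlyPosDef R
  nonneg : ∀ t, (Q t - S t * (R t)⁻¹ * (S t)ᵀ).PosSemidef

/-! ### Optimal synthesis -/

/-- The quadratic cost `xᵀ Q(t) x + 2 xᵀ S(t) u + uᵀ R(t) u`. -/
def quadCost (Q : ℝ → Matrix ι ι ℝ) (S : ℝ → Matrix ι κ ℝ) (R : ℝ → Matrix κ κ ℝ)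
    (t : ℝ) (x : ι → ℝ) (u : κ → ℝ) : ℝ :=
  x ⬝ᵥ (Q t *ᵥ x) + 2 * (x ⬝ᵥ (S t *ᵥ u)) + u ⬝ᵥ (R t *ᵥ u)

/-- The cost `(u + K(t) x)ᵀ R(t) (u + K(t) x)`. -/
def feedbackCost (K : ℝ → Matrix κ ι ℝ) (R : ℝ → Matrix κ κ ℝ)
    (t : ℝ) (x : ι → ℝ) (u : κ → ℝ) : ℝ :=
  (u + K t *ᵥ x) ⬝ᵥ (R t *ᵥ (u + K t *ᵥ x))

/-- `x` is the trajectory on `[t₀, t₁]` of `x' = A x + B u` associated with the square integrable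
control `u`: it is absolutely continuous and solves the equation almost everywhere, in integral
form. -/
def IsTrajectory (A : ℝ → Matrix ι ι ℝ) (B : ℝ → Matrix ι κ ℝ) (t₀ t₁ : ℝ)
    (x : ℝ → ι → ℝ) (u : ℝ → κ → ℝ) : Prop :=
  MemLp u 2 (volume.restrict (Set.Icc t₀ t₁)) ∧
  ContinuousOn x (Set.Icc t₀ t₁) ∧
  ∀ t ∈ Set.Icc t₀ t₁, x t = x t₀ + ∫ s in t₀..t, (A s *ᵥ x s + B s *ᵥ u s)

/-- `(x, u)` minimizes `∫ c(t, x, u) dt` over `[t₀, t₁]` among all the trajectories of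
`x' = A x + B u` with the same end-points as `x`. -/
def IsMinimizer (A : ℝ → Matrix ι ι ℝ) (B : ℝ → Matrix ι κ ℝ)
    (c : ℝ → (ι → ℝ) → (κ → ℝ) → ℝ) (t₀ t₁ : ℝ) (x : ℝ → ι → ℝ) (u : ℝ → κ → ℝ) : Prop :=
  IsTrajectory A B t₀ t₁ x u ∧
  ∀ y v, IsTrajectory A B t₀ t₁ y v → y t₀ = x t₀ → y t₁ = x t₁ →
    ∫ t in t₀..t₁, c t (x t) (u t) ≤ ∫ t in t₀..t₁, c t (y t) (v t)

/-- The optimal synthesis: the set of all minimizing trajectories, for all `t₀ < t₁` and all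
end-points. A trajectory on `[t₀, t₁]` is represented by all the functions on `ℝ` that extend it. -/
def optimalSynthesis (A : ℝ → Matrix ι ι ℝ) (B : ℝ → Matrix ι κ ℝ)
    (c : ℝ → (ι → ℝ) → (κ → ℝ) → ℝ) : Set (ℝ × ℝ × (ℝ → ι → ℝ)) :=
  {γ | γ.1 < γ.2.1 ∧ ∃ u, IsMinimizer A B c γ.1 γ.2.1 γ.2.2 u}

/-! ### The mappings `A₊`, `A₋` of an optimal synthesis -/

/-- `P : ℝ → Sym` is a solution, on the whole of `ℝ`, of the Riccati differential equation. -/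
def IsRiccatiSolution (A : ℝ → Matrix ι ι ℝ) (B : ℝ → Matrix ι κ ℝ) (Q : ℝ → Matrix ι ι ℝ)
    (S : ℝ → Matrix ι κ ℝ) (R : ℝ → Matrix κ κ ℝ) (P : ℝ → Matrix ι ι ℝ) : Prop :=
  (∀ t, (P t).IsSymm) ∧
  ∀ t, HasMatDerivAt P
    (-(P t * A t) - (A t)ᵀ * P t
      + (P t * B t + S t) * (R t)⁻¹ * ((B t)ᵀ * P t + (S t)ᵀ) - Q t) t

/-- `A - B R⁻¹ (Sᵀ + Bᵀ P)`. -/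
noncomputable def closedLoop (A : ℝ → Matrix ι ι ℝ) (B : ℝ → Matrix ι κ ℝ)
    (S : ℝ → Matrix ι κ ℝ) (R : ℝ → Matrix κ κ ℝ) (P : ℝ → Matrix ι ι ℝ) (t : ℝ) :
    Matrix ι ι ℝ :=
  A t - B t * (R t)⁻¹ * ((S t)ᵀ + (B t)ᵀ * P t)

/-- `A₊`, `A₋` are the mappings associated with `(A, B, Q, S, R)`: the closed-loop mappings of a
Riccati solution `P₊` (resp. `P₋`) that makes them exponentially stable (resp. anti-stable). -/
def AreSynthesisMappings (A : ℝ → Matrix ι ι ℝ) (B : ℝ → Matrix ι κ ℝ) (Q : ℝ → Matrix ι ι ℝ)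
    (S : ℝ → Matrix ι κ ℝ) (R : ℝ → Matrix κ κ ℝ) (Ap Am : ℝ → Matrix ι ι ℝ) : Prop :=
  (∃ Pp, IsRiccatiSolution A B Q S R Pp ∧ Ap = closedLoop A B S R Pp ∧ ExpStable Ap) ∧
  (∃ Pm, IsRiccatiSolution A B Q S R Pm ∧ Am = closedLoop A B S R Pm ∧ ExpAntiStable Am)

/-- `M⁻¹ (-M' + F M)`: the mapping `F` of `x' = F x` in the coordinates `M(t)⁻¹ x`. -/
noncomputable def changeCoord (M F : ℝ → Matrix ι ι ℝ) (t : ℝ) : Matrix ι ι ℝ :=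
  (M t)⁻¹ * (-(matDeriv M t) + F t * M t)

/-- The synthesis of the problem `(A, B, Q, S, R)` admits a product form. -/
def AdmitsProductForm (A : ℝ → Matrix ι ι ℝ) (B : ℝ → Matrix ι κ ℝ) (Q : ℝ → Matrix ι ι ℝ)
    (S : ℝ → Matrix ι κ ℝ) (R : ℝ → Matrix κ κ ℝ) : Prop :=
  ∃ Ap Am : ℝ → Matrix ι ι ℝ, AreSynthesisMappings A B Q S R Ap Am ∧
  ∃ E₁ E₂ : Submodule ℝ (ι → ℝ), IsCompl E₁ E₂ ∧ E₁ ≠ ⊥ ∧ E₂ ≠ ⊥ ∧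
  ∃ M : ℝ → Matrix ι ι ℝ, SmoothMap M ∧ (∀ t, IsUnit (M t)) ∧
    ∀ t, (∀ v ∈ E₁, changeCoord M Ap t *ᵥ v ∈ E₁ ∧ changeCoord M Am t *ᵥ v ∈ E₁) ∧
         (∀ v ∈ E₂, changeCoord M Ap t *ᵥ v ∈ E₂ ∧ changeCoord M Am t *ᵥ v ∈ E₂)

/-- `(u + K x)ᵀ R (u + K x)` is a canonical cost for the dynamics `(A, B)`. -/
structure IsCanonicalCost (A : ℝ → Matrix ι ι ℝ) (B : ℝ → Matrix ι κ ℝ)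
    (K : ℝ → Matrix κ ι ℝ) (R : ℝ → Matrix κ κ ℝ) : Prop where
  symm_R : ∀ t, (R t).IsSymm
  smooth_R : SmoothMap R
  bounded_R : BoundedMap R
  posDef_R : UniformlyPosDef R
  det_R : (R 0).det = 1
  smooth_K : SmoothMap K
  bounded_K : BoundedMap K
  stable : ExpStable (fun t => A t - B t * K t)

end Systems

/-! ### Product structures -/

/-- The matrix with diagonal blocks `D 0, …, D (N - 1)`, in this order, and zeros elsewhere; the
block `D i` has size `p i × q i`. -/
def blockDiag {N p' q' : ℕ} {p q : Fin N → ℕ} (hp : ∑ i, p i = p') (hq : ∑ i, q i = q')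
    (D : ∀ i, Matrix (Fin (p i)) (Fin (q i)) ℝ) : Matrix (Fin p') (Fin q') ℝ :=
  Matrix.reindex (finSigmaFinEquiv.trans (finCongr hp)) (finSigmaFinEquiv.trans (finCongr hq))
    (Matrix.blockDiagonal' D)

/-- `Ā`, `B̄`, `R̄` are simultaneously block diagonal with `N > 1` blocks: the dynamics and cost
`uᵀ R̄ u` are those of `N` independent problems `x_i' = A_i x_i + B_i u_i`, `u_iᵀ R_i u_i`. -/
def IsProduct {n m : ℕ} (A : ℝ → Matrix (Fin n) (Fin n) ℝ) (B : ℝ → Matrix (Fin n) (Fin m) ℝ)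
    (R : ℝ → Matrix (Fin m) (Fin m) ℝ) : Prop :=
  ∃ N : ℕ, 1 < N ∧
  ∃ (d k : Fin N → ℕ) (hd : ∑ i, d i = n) (hk : ∑ i, k i = m),
    (∀ i, 0 < k i ∧ k i ≤ d i) ∧
    ∃ (A' : ∀ i, ℝ → Matrix (Fin (d i)) (Fin (d i)) ℝ)
      (B' : ∀ i, ℝ → Matrix (Fin (d i)) (Fin (k i)) ℝ)
      (R' : ∀ i, ℝ → Matrix (Fin (k i)) (Fin (k i)) ℝ),
      (∀ i, SmoothMap (A' i) ∧ SmoothMap (B' i) ∧ KalmanCondition (A' i) (B' i) ∧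
        (∀ t, (R' i t).IsSymm) ∧ SmoothMap (R' i) ∧ UniformlyPosDef (R' i)) ∧
      ∀ t, A t = blockDiag hd hd (fun i => A' i t) ∧
           B t = blockDiag hd hk (fun i => B' i t) ∧
           R t = blockDiag hk hk (fun i => R' i t)

/-- The problem with dynamics `(A, B)` and cost `(u + K x)ᵀ R (u + K x)` admits a product
structure. -/
def AdmitsProductStructure {n m : ℕ} (A : ℝ → Matrix (Fin n) (Fin n) ℝ)
    (B : ℝ → Matrix (Fin n) (Fin m) ℝ) (K : ℝ → Matrix (Fin m) (Fin n) ℝ)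
    (R : ℝ → Matrix (Fin m) (Fin m) ℝ) : Prop :=
  ∃ (M : ℝ → Matrix (Fin n) (Fin n) ℝ) (U : ℝ → Matrix (Fin m) (Fin m) ℝ),
    SmoothMap M ∧ (∀ t, IsUnit (M t)) ∧ SmoothMap U ∧ (∀ t, IsUnit (U t)) ∧
    IsProduct (changeCoord M (fun t => A t - B t * K t))
      (fun t => (M t)⁻¹ * B t * U t) (fun t => (U t)ᵀ * R t * U t)

end LQ

namespace LQ

/-! ### Calculus of matrix-valued mappings -/

section Calculus

variable {ι κ ν : Type*}

/-! Write G = B R⁻¹ Bᵀ. A solution P of the Riccati equation turns the cost into a function of the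
end-points plus the square (u + Lx)ᵀR(u + Lx), where L is its gain (`completing_squares`,
`IsRiccatiSolution.integral_quadCost`). So this square has the same synthesis, and every solution of
the closed loop is optimal, at zero cost for the square.

Product structure implies product form. Let F = A - BK and let W(t) be the Gramian ∫ Φ(t,τ) G
Φ(t,τ)ᵀ dτ over τ ≤ t. Stability bounds it, uniform controllability bounds it from below, and -W⁻¹
is a Riccati solution of the canonical cost with anti-stable closed loop F + G W⁻¹
(`exists_gramian`, `isRiccatiSolution_neg_inv`). The solutions of both closed loops are optimal for
the original cost too, since the syntheses agree. The maximum principle then supplies adjoint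
vectors, and adjoint over state is a bounded solution of the Riccati equation of the original cost;
it is symmetric because XᵀY - YᵀX is constant and tends to 0 (`exists_riccati_of_optimalSynthesis`).
Hence both closed loops are the mappings of Γ. The projection onto one block, seen as Z(t) in the
original coordinates, commutes with Φ and satisfies ZG = GZᵀ. Therefore ZW = WZᵀ, Z commutes with G
W⁻¹, and the projection preserves both closed loops.

Product form implies product structure. With D = P₊ - P₋, the product H(t) = Φ₊(0,t) Φ₋(t,0) has
derivative Γ(t) D(0), where Γ(t) = Φ₊(0,t) G(t) Φ₊(0,t)ᵀ. It equals 1 at time 0 and tends to 0 at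
-∞, so D(0) is positive definite (`dot_nonneg_of_tendsto`). The projection Z of the decomposition,
transported to time 0, commutes with every H(t), hence with every Γ(t) D(0). In coordinates where
D(0) is the identity, the symmetric matrices Γ(t) then commute with ZᵀZ, which is neither zero nor
invertible; its kernel and the kernel's orthogonal complement make all the Γ(t) block diagonal
(`exists_block_coordinates`). Following these fixed coordinates along Φ₊ kills the state matrix and
block-diagonalizes G. The block projection preserves the range of B, so it induces a smooth family
of projections of the inputs, diagonalized by parallel transport (`exists_input_frame`). Invariance
of the Kalman condition finishes the proof. -/

theorem HasMatDerivAt.congr_deriv {F : ℝ → Matrix ι κ ℝ} {D E : Matrix ι κ ℝ} {t : ℝ}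
    (h : HasMatDerivAt F D t) (hE : D = E) : HasMatDerivAt F E t := hE ▸ h

theorem HasMatDerivAt.unique {F : ℝ → Matrix ι κ ℝ} {D E : Matrix ι κ ℝ} {t : ℝ}
    (h : HasMatDerivAt F D t) (h' : HasMatDerivAt F E t) : D = E := by
  ext i j
  exact (h i j).unique (h' i j)

theorem HasMatDerivAt.matDeriv_eq {F : ℝ → Matrix ι κ ℝ} {D : Matrix ι κ ℝ} {t : ℝ}
    (h : HasMatDerivAt F D t) : matDeriv F t = D := by
  ext i j
  exact (h i j).deriv

theorem hasMatDerivAt_const (C : Matrix ι κ ℝ) (t : ℝ) : HasMatDerivAt (fun _ => C) 0 t :=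
  fun _ _ => hasDerivAt_const _ _

theorem HasMatDerivAt.add {F G : ℝ → Matrix ι κ ℝ} {D E : Matrix ι κ ℝ} {t : ℝ}
    (hF : HasMatDerivAt F D t) (hG : HasMatDerivAt G E t) :
    HasMatDerivAt (fun s => F s + G s) (D + E) t :=
  fun i j => (hF i j).add (hG i j)

theorem HasMatDerivAt.sub {F G : ℝ → Matrix ι κ ℝ} {D E : Matrix ι κ ℝ} {t : ℝ}
    (hF : HasMatDerivAt F D t) (hG : HasMatDerivAt G E t) :
    HasMatDerivAt (fun s => F s - G s) (D - E) t :=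
  fun i j => (hF i j).sub (hG i j)

theorem HasMatDerivAt.neg {F : ℝ → Matrix ι κ ℝ} {D : Matrix ι κ ℝ} {t : ℝ}
    (hF : HasMatDerivAt F D t) : HasMatDerivAt (fun s => -F s) (-D) t :=
  fun i j => (hF i j).neg

theorem HasMatDerivAt.transpose {F : ℝ → Matrix ι κ ℝ} {D : Matrix ι κ ℝ} {t : ℝ}
    (hF : HasMatDerivAt F D t) : HasMatDerivAt (fun s => (F s)ᵀ) Dᵀ t :=
  fun i j => hF j i

theorem HasMatDerivAt.mul [Fintype κ] {F : ℝ → Matrix ι κ ℝ} {G : ℝ → Matrix κ ν ℝ}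
    {D : Matrix ι κ ℝ} {E : Matrix κ ν ℝ} {t : ℝ}
    (hF : HasMatDerivAt F D t) (hG : HasMatDerivAt G E t) :
    HasMatDerivAt (fun s => F s * G s) (D * G t + F t * E) t := by
  intro i j
  simp only [Matrix.mul_apply, Matrix.add_apply, ← Finset.sum_add_distrib]
  exact HasDerivAt.fun_sum fun k _ => (hF i k).mul (hG k j)

theorem HasMatDerivAt.const_mul [Fintype κ] {G : ℝ → Matrix κ ν ℝ} (C : Matrix ι κ ℝ)
    {E : Matrix κ ν ℝ} {t : ℝ} (hG : HasMatDerivAt G E t) :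
    HasMatDerivAt (fun s => C * G s) (C * E) t :=
  ((hasMatDerivAt_const C t).mul hG).congr_deriv (by simp)

theorem HasMatDerivAt.mul_const [Fintype κ] {F : ℝ → Matrix ι κ ℝ} (C : Matrix κ ν ℝ)
    {D : Matrix ι κ ℝ} {t : ℝ} (hF : HasMatDerivAt F D t) :
    HasMatDerivAt (fun s => F s * C) (D * C) t :=
  (hF.mul (hasMatDerivAt_const C t)).congr_deriv (by simp)

theorem HasMatDerivAt.mulVec [Fintype ι] [Fintype κ] {F : ℝ → Matrix ι κ ℝ} {x : ℝ → κ → ℝ}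
    {D : Matrix ι κ ℝ} {y : κ → ℝ} {t : ℝ}
    (hF : HasMatDerivAt F D t) (hx : HasDerivAt x y t) :
    HasDerivAt (fun s => F s *ᵥ x s) (D *ᵥ x t + F t *ᵥ y) t := by
  rw [hasDerivAt_pi] at hx ⊢
  intro i
  simp only [Matrix.mulVec, dotProduct, Pi.add_apply, ← Finset.sum_add_distrib]
  exact HasDerivAt.fun_sum fun k _ => (hF i k).mul (hx k)

theorem HasMatDerivAt.mulVec_const [Fintype ι] [Fintype κ] {F : ℝ → Matrix ι κ ℝ} (v : κ → ℝ)
    {D : Matrix ι κ ℝ} {t : ℝ} (hF : HasMatDerivAt F D t) :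
    HasDerivAt (fun s => F s *ᵥ v) (D *ᵥ v) t := by
  simpa using hF.mulVec (hasDerivAt_const t v)

theorem hasDerivAt_dotProduct [Fintype κ] {x y : ℝ → κ → ℝ} {x' y' : κ → ℝ} {t : ℝ}
    (hx : HasDerivAt x x' t) (hy : HasDerivAt y y' t) :
    HasDerivAt (fun s => x s ⬝ᵥ y s) (x' ⬝ᵥ y t + x t ⬝ᵥ y') t := by
  rw [hasDerivAt_pi] at hx hy
  simp only [dotProduct, ← Finset.sum_add_distrib]
  exact HasDerivAt.fun_sum fun k _ => (hx k).mul (hy k)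

theorem HasMatDerivAt.congr_fun {F G : ℝ → Matrix ι κ ℝ} {D : Matrix ι κ ℝ} {t : ℝ}
    (hF : HasMatDerivAt F D t) (h : ∀ s, G s = F s) : HasMatDerivAt G D t := by
  rwa [show G = F from funext h]

theorem eq_of_hasMatDerivAt_zero {F : ℝ → Matrix ι κ ℝ} (hF : ∀ t, HasMatDerivAt F 0 t)
    (s t : ℝ) : F s = F t := by
  ext i j
  exact is_const_of_deriv_eq_zero (fun t => (hF t i j).differentiableAt)
    (fun t => (hF t i j).deriv) s t

theorem continuous_of_hasMatDerivAt {F D : ℝ → Matrix ι κ ℝ}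
    (hF : ∀ t, HasMatDerivAt F (D t) t) : Continuous F :=
  continuous_matrix fun i j =>
    continuous_iff_continuousAt.2 fun t => (hF t i j).continuousAt

/-- Cramer's formula gives differentiability; differentiating F F⁻¹ = 1 then gives the value. -/
theorem hasMatDerivAt_inv [Fintype ι] [DecidableEq ι] {F : ℝ → Matrix ι ι ℝ}
    {D : Matrix ι ι ℝ} {t : ℝ} (hu : ∀ s, IsUnit (F s)) (hF : HasMatDerivAt F D t) :
    HasMatDerivAt (fun s => (F s)⁻¹) (-((F t)⁻¹ * D * (F t)⁻¹)) t := by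
  have hdiff : ∀ i j, DifferentiableAt ℝ (fun s => (F s)⁻¹ i j) t := by
    intro i j
    have hdet : ∀ G : ℝ → Matrix ι ι ℝ, (∀ i j, DifferentiableAt ℝ (fun s => G s i j) t) →
        DifferentiableAt ℝ (fun s => (G s).det) t := by
      intro G hG
      simp only [Matrix.det_apply]
      refine DifferentiableAt.fun_sum fun σ _ => ?_
      refine DifferentiableAt.const_smul ?_ _
      exact DifferentiableAt.fun_finsetProd fun k _ => hG _ _
    simp only [Matrix.inv_def, Matrix.smul_apply, Ring.inverse_eq_inv', smul_eq_mul]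
    refine DifferentiableAt.mul (DifferentiableAt.inv
      (hdet _ fun i j => (hF i j).differentiableAt)
      ((Matrix.isUnit_iff_isUnit_det _).1 (hu t)).ne_zero) ?_
    simp only [Matrix.adjugate_apply]
    refine hdet _ fun k l => ?_
    by_cases hk : k = j
    · subst hk
      simp
    · simp only [Matrix.updateRow_ne hk]
      exact (hF k l).differentiableAt
  have h : HasMatDerivAt (fun s => (F s)⁻¹) (matDeriv (fun s => (F s)⁻¹) t) t :=
    fun i j => (hdiff i j).hasDerivAt
  have hdet := (Matrix.isUnit_iff_isUnit_det _).1 (hu t)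
  have h1 := hF.mul h
  have h2 : HasMatDerivAt (fun s => F s * (F s)⁻¹) 0 t :=
    (hasMatDerivAt_const 1 t).congr_fun fun s =>
      Matrix.mul_nonsing_inv _ ((Matrix.isUnit_iff_isUnit_det _).1 (hu s))
  have h3 := h1.unique h2
  refine h.congr_deriv ?_
  have h4 : F t * matDeriv (fun s => (F s)⁻¹) t = -(D * (F t)⁻¹) := by
    rw [eq_neg_iff_add_eq_zero, add_comm]; exact h3
  calc matDeriv (fun s => (F s)⁻¹) t
      = (F t)⁻¹ * (F t * matDeriv (fun s => (F s)⁻¹) t) := by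
        rw [← Matrix.mul_assoc, Matrix.nonsing_inv_mul _ hdet, Matrix.one_mul]
    _ = _ := by rw [h4]; simp [Matrix.mul_assoc]

end Calculus

/-! ### Smooth mappings -/

section Smooth

variable {ι κ ν : Type*}

theorem SmoothMap.hasMatDerivAt {F : ℝ → Matrix ι κ ℝ} (hF : SmoothMap F) (t : ℝ) :
    HasMatDerivAt F (matDeriv F t) t :=
  fun i j => ((hF i j).differentiable (by simp)).differentiableAt.hasDerivAt

theorem SmoothMap.continuous {F : ℝ → Matrix ι κ ℝ} (hF : SmoothMap F) : Continuous F :=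
  continuous_matrix fun i j => (hF i j).continuous

theorem smoothMap_const (C : Matrix ι κ ℝ) : SmoothMap (fun _ => C) :=
  fun _ _ => contDiff_const

theorem SmoothMap.add {F G : ℝ → Matrix ι κ ℝ} (hF : SmoothMap F) (hG : SmoothMap G) :
    SmoothMap (fun t => F t + G t) := fun i j => (hF i j).add (hG i j)

theorem SmoothMap.sub {F G : ℝ → Matrix ι κ ℝ} (hF : SmoothMap F) (hG : SmoothMap G) :
    SmoothMap (fun t => F t - G t) := fun i j => (hF i j).sub (hG i j)

theorem SmoothMap.neg {F : ℝ → Matrix ι κ ℝ} (hF : SmoothMap F) :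
    SmoothMap (fun t => -F t) := fun i j => (hF i j).neg

theorem SmoothMap.transpose {F : ℝ → Matrix ι κ ℝ} (hF : SmoothMap F) :
    SmoothMap (fun t => (F t)ᵀ) := fun i j => hF j i

theorem SmoothMap.smul {f : ℝ → ℝ} {F : ℝ → Matrix ι κ ℝ} (hf : ContDiff ℝ ∞ f)
    (hF : SmoothMap F) : SmoothMap (fun t => f t • F t) := fun i j => hf.mul (hF i j)

theorem SmoothMap.mul [Fintype κ] {F : ℝ → Matrix ι κ ℝ} {G : ℝ → Matrix κ ν ℝ}
    (hF : SmoothMap F) (hG : SmoothMap G) : SmoothMap (fun t => F t * G t) := by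
  intro i j
  simp only [Matrix.mul_apply]
  exact ContDiff.sum fun k _ => (hF i k).mul (hG k j)

theorem SmoothMap.matDeriv {F : ℝ → Matrix ι κ ℝ} (hF : SmoothMap F) :
    SmoothMap (matDeriv F) := fun i j =>
  ((contDiff_infty_iff_deriv.1 (hF i j)).2)

theorem SmoothMap.det [Fintype ι] [DecidableEq ι] {F : ℝ → Matrix ι ι ℝ} (hF : SmoothMap F) :
    ContDiff ℝ ∞ (fun t => (F t).det) := by
  simp only [Matrix.det_apply]
  exact ContDiff.sum fun σ _ => ContDiff.const_smul _ (contDiff_prod fun k _ => hF _ _)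

theorem SmoothMap.inv [Fintype ι] [DecidableEq ι] {F : ℝ → Matrix ι ι ℝ} (hF : SmoothMap F)
    (hu : ∀ s, IsUnit (F s)) : SmoothMap (fun t => (F t)⁻¹) := by
  intro i j
  simp only [Matrix.inv_def, Matrix.smul_apply, Ring.inverse_eq_inv', smul_eq_mul]
  refine ContDiff.mul (hF.det.inv fun t =>
    ((Matrix.isUnit_iff_isUnit_det _).1 (hu t)).ne_zero) ?_
  simp only [Matrix.adjugate_apply]
  refine SmoothMap.det fun k l => ?_
  by_cases hk : k = j
  · subst hk
    simpa using contDiff_const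
  · simp only [Matrix.updateRow_ne hk]
    exact hF k l

/-- A mapping is smooth if its derivative is as regular as itself. -/
theorem smoothMap_of_hasMatDerivAt {F D : ℝ → Matrix ι κ ℝ}
    (hF : ∀ t, HasMatDerivAt F (D t) t)
    (h : ∀ k : ℕ, (∀ i j, ContDiff ℝ k fun t => F t i j) → ∀ i j, ContDiff ℝ k fun t => D t i j) :
    SmoothMap F := by
  have key : ∀ k : ℕ, ∀ i j, ContDiff ℝ k fun t => F t i j := by
    intro k
    induction k with
    | zero =>
      intro i j
      exact contDiff_zero.2 (continuous_iff_continuousAt.2 fun t => (hF t i j).continuousAt)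
    | succ k ih =>
      intro i j
      rw [Nat.cast_succ, contDiff_succ_iff_deriv]
      refine ⟨fun t => (hF t i j).differentiableAt, by simp, ?_⟩
      rw [show deriv (fun t => F t i j) = fun t => D t i j from
        funext fun t => (hF t i j).deriv]
      exact h k ih i j
  exact fun i j => contDiff_infty.2 fun k => key k i j

theorem contDiff_mul_apply [Fintype κ] {k : ℕ} {F : ℝ → Matrix ι κ ℝ} {G : ℝ → Matrix κ ν ℝ}
    (hF : ∀ i j, ContDiff ℝ k fun t => F t i j) (hG : ∀ i j, ContDiff ℝ k fun t => G t i j) :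
    ∀ i j, ContDiff ℝ k fun t => (F t * G t) i j := by
  intro i j
  simp only [Matrix.mul_apply]
  exact ContDiff.sum fun l _ => (hF i l).mul (hG l j)

theorem SmoothMap.contDiff_nat {F : ℝ → Matrix ι κ ℝ} (hF : SmoothMap F) (k : ℕ) (i : ι) (j : κ) :
    ContDiff ℝ k fun t => F t i j :=
  contDiff_infty.1 (hF i j) k

theorem smoothMap_of_linear [Fintype ι] {N : ℝ → Matrix ι ι ℝ} {G : ℝ → Matrix ι κ ℝ}
    (hN : SmoothMap N) (hG : ∀ t, HasMatDerivAt G (N t * G t) t) : SmoothMap G :=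
  smoothMap_of_hasMatDerivAt hG fun k hk => contDiff_mul_apply (hN.contDiff_nat k) hk

theorem SmoothMap.mul_const [Fintype κ] {G : ℝ → Matrix ι κ ℝ} (C : Matrix κ ν ℝ)
    (hG : SmoothMap G) : SmoothMap (fun t => G t * C) := hG.mul (smoothMap_const C)

end Smooth

/-! ### Linear differential equations -/

section LinearODE

variable {ι κ : Type*} [Fintype ι]

theorem norm_mulVec_le_sum (N : Matrix ι ι ℝ) (x : ι → ℝ) :
    ‖N *ᵥ x‖ ≤ (∑ i, ∑ j, |N i j|) * ‖x‖ := by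
  refine (pi_norm_le_iff_of_nonneg (by positivity)).2 fun i => ?_
  calc ‖(N *ᵥ x) i‖ ≤ ∑ j, ‖N i j * x j‖ := norm_sum_le _ _
    _ ≤ ∑ j, |N i j| * ‖x‖ := by
        refine Finset.sum_le_sum fun j _ => ?_
        rw [norm_mul]
        exact mul_le_mul_of_nonneg_left (norm_le_pi_norm x j) (norm_nonneg _)
    _ = (∑ j, |N i j|) * ‖x‖ := by rw [Finset.sum_mul]
    _ ≤ _ := by
        refine mul_le_mul_of_nonneg_right ?_ (norm_nonneg _)
        exact Finset.single_le_sum (f := fun i => ∑ j, |N i j|)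
          (fun i _ => Finset.sum_nonneg fun j _ => abs_nonneg _) (Finset.mem_univ i)

theorem continuous_sum_abs {N : ℝ → Matrix ι ι ℝ} (hN : Continuous N) :
    Continuous fun t => ∑ i, ∑ j, |N t i j| :=
  continuous_finsetSum _ fun i _ => continuous_finsetSum _ fun j _ =>
    (hN.matrix_elem i j).abs

theorem linear_unique {N : ℝ → Matrix ι ι ℝ} (hN : Continuous N) {x y : ℝ → ι → ℝ}
    (hx : ∀ t, HasDerivAt x (N t *ᵥ x t) t) (hy : ∀ t, HasDerivAt y (N t *ᵥ y t) t) (t₀ : ℝ)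
    (h : x t₀ = y t₀) : x = y := by
  ext1 t
  obtain ⟨a, b, ht, ht₀⟩ : ∃ a b, t ∈ Set.Ioo a b ∧ t₀ ∈ Set.Ioo a b :=
    ⟨min t t₀ - 1, max t t₀ + 1, by constructor <;> grind, by constructor <;> grind⟩
  obtain ⟨C, hC⟩ := isCompact_Icc.exists_bound_of_continuousOn (s := Set.Icc a b)
    (continuous_sum_abs hN).continuousOn
  refine ODE_solution_unique_of_mem_Ioo (v := fun t x => N t *ᵥ x) (s := fun _ => Set.univ)
    (K := C.toNNReal) ?_ ht₀ (fun s _ => ⟨hx s, trivial⟩) (fun s _ => ⟨hy s, trivial⟩) h ht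
  intro s hs
  refine (LipschitzWith.of_dist_le_mul fun u v => ?_).lipschitzOnWith
  rw [dist_eq_norm, dist_eq_norm, ← Matrix.mulVec_sub]
  refine (norm_mulVec_le_sum _ _).trans (mul_le_mul_of_nonneg_right ?_ (norm_nonneg _))
  exact ((le_abs_self _).trans (hC s (Set.Ioo_subset_Icc_self hs))).trans (Real.le_coe_toNNReal C)

theorem linear_unique_matrix {N : ℝ → Matrix ι ι ℝ} (hN : Continuous N)
    {X Y : ℝ → Matrix ι κ ℝ} (hX : ∀ t, HasMatDerivAt X (N t * X t) t)
    (hY : ∀ t, HasMatDerivAt Y (N t * Y t) t) (t₀ : ℝ) (h : X t₀ = Y t₀) (t : ℝ) : X t = Y t := by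
  ext i j
  have hc : ∀ {Z : ℝ → Matrix ι κ ℝ}, (∀ t, HasMatDerivAt Z (N t * Z t) t) →
      ∀ t, HasDerivAt (fun t i => Z t i j) (N t *ᵥ fun i => Z t i j) t :=
    fun hZ t => hasDerivAt_pi.2 fun i => hZ t i j
  exact congrFun (congrFun (linear_unique hN (hc hX) (hc hY) t₀ (by rw [h])) t) i

/-- Up to sign, the integrand is half the derivative of the weight exp (2|∫k|). The factor 1/2 is
the contraction constant in `exists_linear_solution`. -/
theorem abs_integral_exp_weight_le {k : ℝ → ℝ} (hk : Continuous k) (hk0 : ∀ t, 0 ≤ k t)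
    (t : ℝ) :
    |∫ s in (0 : ℝ)..t, Real.exp (2 * |∫ r in (0 : ℝ)..s, k r|) * k s| ≤
      Real.exp (2 * |∫ r in (0 : ℝ)..t, k r|) / 2 := by
  set K : ℝ → ℝ := fun t => ∫ r in (0 : ℝ)..t, k r with hK
  have hKd : ∀ t, HasDerivAt K (k t) t := fun t => (hk.integral_hasStrictDerivAt 0 t).hasDerivAt
  have hKc : Continuous K := continuous_iff_continuousAt.2 fun t => (hKd t).continuousAt
  have hprim : ∀ c : ℝ, c ≠ 0 → (∀ s ∈ Set.uIcc 0 t, |K s| = c * K s) →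
      ∫ s in (0 : ℝ)..t, Real.exp (2 * |K s|) * k s = (Real.exp (2 * |K t|) - 1) / (2 * c) := by
    intro c hc hs
    have hd : ∀ s ∈ Set.uIcc 0 t, HasDerivAt (fun s => Real.exp (2 * (c * K s)) / (2 * c))
        (Real.exp (2 * (c * K s)) * k s) s := by
      intro s _
      refine ((((hKd s).const_mul c).const_mul 2).exp.div_const (2 * c)).congr_deriv ?_
      field_simp
    rw [intervalIntegral.integral_congr (g := fun s => Real.exp (2 * (c * K s)) * k s)
      (fun s h => by simp only [hs s h]), intervalIntegral.integral_eq_sub_of_hasDerivAt hd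
      ((by fun_prop : Continuous _).intervalIntegrable _ _), hs t Set.right_mem_uIcc]
    simp [hK]
    ring
  have he : 1 ≤ Real.exp (2 * |K t|) := Real.one_le_exp (by positivity)
  rcases le_total 0 t with ht | ht
  · rw [hprim 1 one_ne_zero fun s hs => ?_]
    · rw [abs_of_nonneg (by linarith)]
      linarith
    · rw [Set.uIcc_of_le ht] at hs
      rw [one_mul, abs_of_nonneg]
      exact intervalIntegral.integral_nonneg hs.1 fun r _ => hk0 r
  · rw [hprim (-1) (by norm_num) fun s hs => ?_]
    · rw [mul_neg_one, div_neg, abs_neg, abs_of_nonneg (by linarith)]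
      linarith
    · rw [Set.uIcc_of_ge ht] at hs
      rw [neg_one_mul, abs_of_nonpos]
      rw [hK]
      simp only [intervalIntegral.integral_symm s 0]
      exact neg_nonpos.2 (intervalIntegral.integral_nonneg hs.2 fun r _ => hk0 r)

/-- Picard iteration on the whole line at once: with the weight w, the integral operator is a
contraction of bounded continuous functions, so no local solutions have to be glued. -/
theorem exists_linear_solution {N : ℝ → Matrix ι ι ℝ} (hN : Continuous N) (x₀ : ι → ℝ) :
    ∃ x : ℝ → ι → ℝ, x 0 = x₀ ∧ ∀ t, HasDerivAt x (N t *ᵥ x t) t := by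
  set k : ℝ → ℝ := fun t => ∑ i, ∑ j, |N t i j| with hkdef
  have hk : Continuous k := continuous_sum_abs hN
  set w : ℝ → ℝ := fun t => Real.exp (2 * |∫ r in (0 : ℝ)..t, k r|) with hwdef
  have hw : Continuous w := by
    have : Continuous fun t => ∫ r in (0 : ℝ)..t, k r :=
      intervalIntegral.continuous_primitive (fun a b => hk.intervalIntegrable a b) 0
    fun_prop
  have hwpos : ∀ t, 0 < w t := fun t => Real.exp_pos _
  have hw1 : ∀ t, 1 ≤ w t := fun t => Real.one_le_exp (by positivity)
  have hNg : ∀ g : BoundedContinuousFunction ℝ (ι → ℝ), Continuous fun s => w s • (N s *ᵥ g s) :=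
    fun g => hw.smul (hN.matrix_mulVec g.continuous)
  have hint : ∀ g : BoundedContinuousFunction ℝ (ι → ℝ), ∀ t,
      ‖∫ s in (0 : ℝ)..t, w s • (N s *ᵥ g s)‖ ≤ w t / 2 * ‖g‖ := by
    intro g t
    have h1 : ‖∫ s in (0 : ℝ)..t, w s • (N s *ᵥ g s)‖ ≤
        |∫ s in (0 : ℝ)..t, w s * k s * ‖g‖| := by
      refine intervalIntegral.norm_integral_le_abs_of_norm_le (Filter.Eventually.of_forall ?_)
        (((hw.mul hk).mul continuous_const).intervalIntegrable _ _)
      intro s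
      rw [norm_smul, Real.norm_of_nonneg (hwpos s).le, mul_assoc]
      refine mul_le_mul_of_nonneg_left ((norm_mulVec_le_sum _ _).trans ?_) (hwpos s).le
      exact mul_le_mul_of_nonneg_left (g.norm_coe_le_norm s) (by positivity)
    rw [intervalIntegral.integral_mul_const, abs_mul, abs_norm] at h1
    exact h1.trans (mul_le_mul_of_nonneg_right (abs_integral_exp_weight_le hk
      (fun t => by positivity) t) (norm_nonneg _))
  -- The unknown is g = x / w, bounded even though x may grow.
  let T : BoundedContinuousFunction ℝ (ι → ℝ) → BoundedContinuousFunction ℝ (ι → ℝ) := fun g =>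
    BoundedContinuousFunction.ofNormedAddCommGroup
      (fun t => (w t)⁻¹ • (x₀ + ∫ s in (0 : ℝ)..t, w s • (N s *ᵥ g s)))
      ((hw.inv₀ fun t => (hwpos t).ne').smul (continuous_const.add
        (intervalIntegral.continuous_primitive (fun a b => (hNg g).intervalIntegrable a b) 0)))
      (‖x₀‖ + 1 / 2 * ‖g‖) (by
        intro t
        rw [norm_smul, norm_inv, Real.norm_of_nonneg (hwpos t).le,
          inv_mul_le_iff₀ (hwpos t)]
        refine (norm_add_le _ _).trans ?_
        have := hint g t
        have := mul_le_mul_of_nonneg_right (hw1 t) (norm_nonneg x₀)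
        linarith)
  have hT : ContractingWith (1 / 2) T := by
    refine ⟨by rw [← NNReal.coe_lt_coe]; norm_num, LipschitzWith.of_dist_le_mul fun g h => ?_⟩
    refine (BoundedContinuousFunction.dist_le (by positivity)).2 fun t => ?_
    have h1 : (T g) t - (T h) t = (w t)⁻¹ • ∫ s in (0 : ℝ)..t, w s • (N s *ᵥ (g - h) s) := by
      simp only [T, BoundedContinuousFunction.coe_ofNormedAddCommGroup, ← smul_sub,
        add_sub_add_left_eq_sub]
      rw [← intervalIntegral.integral_sub ((hNg g).intervalIntegrable _ _)
        ((hNg h).intervalIntegrable _ _)]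
      simp [← smul_sub, Matrix.mulVec_sub]
    rw [dist_eq_norm, h1, norm_smul, norm_inv, Real.norm_of_nonneg (hwpos t).le,
      inv_mul_le_iff₀ (hwpos t), dist_eq_norm]
    refine (hint (g - h) t).trans (le_of_eq ?_)
    push_cast
    ring
  obtain ⟨g, hg⟩ : ∃ g, T g = g := ⟨_, hT.fixedPoint_isFixedPt⟩
  have hx : ∀ t, w t • g t = x₀ + ∫ s in (0 : ℝ)..t, w s • (N s *ᵥ g s) := by
    intro t
    have := congrArg (fun f : BoundedContinuousFunction ℝ (ι → ℝ) => w t • f t) hg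
    simp only [T, BoundedContinuousFunction.coe_ofNormedAddCommGroup, smul_smul,
      mul_inv_cancel₀ (hwpos t).ne', one_smul] at this
    exact this.symm
  refine ⟨fun t => w t • g t, by simp [hx], fun t => ?_⟩
  rw [show (fun t => w t • g t) = fun t => x₀ + ∫ s in (0 : ℝ)..t, w s • (N s *ᵥ g s) from
    funext hx]
  have := ((hNg g).integral_hasStrictDerivAt 0 t).hasDerivAt.const_add x₀
  simpa [Matrix.mulVec_smul, ← hx] using this

theorem exists_linear_solution_matrix {N : ℝ → Matrix ι ι ℝ} (hN : Continuous N)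
    (X₀ : Matrix ι κ ℝ) :
    ∃ X : ℝ → Matrix ι κ ℝ, X 0 = X₀ ∧ ∀ t, HasMatDerivAt X (N t * X t) t := by
  choose x hx0 hx using fun j : κ => exists_linear_solution hN (fun i => X₀ i j)
  refine ⟨fun t => Matrix.of fun i j => x j t i, ?_, fun t i j => ?_⟩
  · ext i j
    simp [hx0]
  · exact (hasDerivAt_pi.1 (hx j t)) i

end LinearODE

/-! ### Transition matrices -/

section Transition

variable {ι : Type*} [Fintype ι] [DecidableEq ι]

namespace IsTransitionMatrix

variable {F : ℝ → Matrix ι ι ℝ} {Φ : ℝ → ℝ → Matrix ι ι ℝ}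

theorem self (h : IsTransitionMatrix F Φ) (τ : ℝ) : Φ τ τ = 1 := (h τ).1

theorem hasMatDerivAt (h : IsTransitionMatrix F Φ) (t τ : ℝ) :
    HasMatDerivAt (fun s => Φ s τ) (F t * Φ t τ) t := (h τ).2 t

theorem mul (h : IsTransitionMatrix F Φ) (hF : Continuous F) (t τ σ : ℝ) :
    Φ t τ * Φ τ σ = Φ t σ :=
  linear_unique_matrix hF (X := fun t => Φ t τ * Φ τ σ) (Y := fun t => Φ t σ)
    (fun t => ((h.hasMatDerivAt t τ).mul_const _).congr_deriv (Matrix.mul_assoc _ _ _))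
    (fun t => h.hasMatDerivAt t σ) τ (by simp [h.self]) t

theorem mul_self (h : IsTransitionMatrix F Φ) (hF : Continuous F) (t τ : ℝ) :
    Φ t τ * Φ τ t = 1 := by rw [h.mul hF, h.self]

theorem isUnit (h : IsTransitionMatrix F Φ) (hF : Continuous F) (t τ : ℝ) : IsUnit (Φ t τ) :=
  (Matrix.isUnit_iff_isUnit_det _).2 (Matrix.isUnit_det_of_right_inverse (h.mul_self hF t τ))

theorem inv_eq (h : IsTransitionMatrix F Φ) (hF : Continuous F) (t τ : ℝ) :
    (Φ t τ)⁻¹ = Φ τ t := Matrix.inv_eq_right_inv (h.mul_self hF t τ)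

theorem hasMatDerivAt_right (h : IsTransitionMatrix F Φ) (hF : Continuous F) (t τ : ℝ) :
    HasMatDerivAt (fun s => Φ τ s) (-(Φ τ t * F t)) t := by
  have h1 := hasMatDerivAt_inv (fun s => h.isUnit hF s τ) (h.hasMatDerivAt t τ)
  refine (h1.congr_fun fun s => (h.inv_eq hF s τ).symm).congr_deriv ?_
  rw [h.inv_eq hF, Matrix.mul_assoc, Matrix.mul_assoc, h.mul_self hF, Matrix.mul_one]

theorem continuous_left (h : IsTransitionMatrix F Φ) (τ : ℝ) : Continuous fun s => Φ s τ :=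
  continuous_of_hasMatDerivAt fun t => h.hasMatDerivAt t τ

theorem continuous_right (h : IsTransitionMatrix F Φ) (hF : Continuous F) (τ : ℝ) :
    Continuous fun s => Φ τ s :=
  continuous_of_hasMatDerivAt fun t => h.hasMatDerivAt_right hF t τ

theorem hasDerivAt_mulVec (h : IsTransitionMatrix F Φ) (v : ι → ℝ) (t τ : ℝ) :
    HasDerivAt (fun s => Φ s τ *ᵥ v) (F t *ᵥ (Φ t τ *ᵥ v)) t := by
  simpa [Matrix.mulVec_mulVec] using (h.hasMatDerivAt t τ).mulVec_const v

theorem hasDerivAt_transpose_mulVec (h : IsTransitionMatrix F Φ) (hF : Continuous F)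
    (v : ι → ℝ) (t τ : ℝ) :
    HasDerivAt (fun s => (Φ τ s)ᵀ *ᵥ v) (-(F t)ᵀ *ᵥ ((Φ τ t)ᵀ *ᵥ v)) t := by
  simpa [Matrix.mulVec_mulVec] using (h.hasMatDerivAt_right hF t τ).transpose.mulVec_const v

end IsTransitionMatrix

end Transition

/-! ### Bounded mappings -/

section Bounded

variable {ι κ ν : Type*}

theorem BoundedMap.transpose {F : ℝ → Matrix ι κ ℝ} (hF : BoundedMap F) :
    BoundedMap (fun t => (F t)ᵀ) := by
  obtain ⟨C, hC⟩ := hF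
  exact ⟨C, fun t i j => hC t j i⟩

theorem BoundedMap.neg {F : ℝ → Matrix ι κ ℝ} (hF : BoundedMap F) :
    BoundedMap (fun t => -F t) := by
  obtain ⟨C, hC⟩ := hF
  exact ⟨C, fun t i j => by simpa using hC t i j⟩

theorem BoundedMap.add {F G : ℝ → Matrix ι κ ℝ} (hF : BoundedMap F) (hG : BoundedMap G) :
    BoundedMap (fun t => F t + G t) := by
  obtain ⟨C, hC⟩ := hF
  obtain ⟨D, hD⟩ := hG
  exact ⟨C + D, fun t i j => (abs_add_le _ _).trans (add_le_add (hC t i j) (hD t i j))⟩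

theorem BoundedMap.sub {F G : ℝ → Matrix ι κ ℝ} (hF : BoundedMap F) (hG : BoundedMap G) :
    BoundedMap (fun t => F t - G t) := by
  simpa only [sub_eq_add_neg] using hF.add hG.neg

theorem BoundedMap.mul [Fintype κ] {F : ℝ → Matrix ι κ ℝ} {G : ℝ → Matrix κ ν ℝ}
    (hF : BoundedMap F) (hG : BoundedMap G) : BoundedMap (fun t => F t * G t) := by
  obtain ⟨C, hC⟩ := hF
  obtain ⟨D, hD⟩ := hG
  refine ⟨∑ _k : κ, C * D, fun t i j => ?_⟩
  simp only [Matrix.mul_apply]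
  refine (Finset.abs_sum_le_sum_abs _ _).trans (Finset.sum_le_sum fun k _ => ?_)
  rw [abs_mul]
  exact mul_le_mul (hC t i k) (hD t k j) (abs_nonneg _) ((abs_nonneg _).trans (hC t i k))

end Bounded

/-! ### Quadratic estimates -/

section Estimates

variable {ι κ : Type*} [Fintype ι] [Fintype κ]

theorem dot_self_nonneg (x : ι → ℝ) : 0 ≤ x ⬝ᵥ x :=
  Finset.sum_nonneg fun i _ => mul_self_nonneg (x i)

theorem dot_sq_le (x y : ι → ℝ) : (x ⬝ᵥ y) ^ 2 ≤ (x ⬝ᵥ x) * (y ⬝ᵥ y) := by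
  simpa [dotProduct, sq] using Finset.sum_mul_sq_le_sq_mul_sq Finset.univ x y

theorem two_dot_le (x y : ι → ℝ) : 2 * (x ⬝ᵥ y) ≤ x ⬝ᵥ x + y ⬝ᵥ y := by
  have := dot_self_nonneg (x - y)
  simp only [sub_dotProduct, dotProduct_sub, dotProduct_comm y x] at this
  linarith

theorem dot_self_add_le (x y : ι → ℝ) : (x + y) ⬝ᵥ (x + y) ≤ 2 * (x ⬝ᵥ x) + 2 * (y ⬝ᵥ y) := by
  have := dot_self_nonneg (x - y)
  simp only [sub_dotProduct, dotProduct_sub, add_dotProduct, dotProduct_add,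
    dotProduct_comm y x] at this ⊢
  linarith

theorem dot_self_neg (x : ι → ℝ) : (-x) ⬝ᵥ (-x) = x ⬝ᵥ x := by simp

theorem dot_self_sub_le (x y : ι → ℝ) : (x - y) ⬝ᵥ (x - y) ≤ 2 * (x ⬝ᵥ x) + 2 * (y ⬝ᵥ y) := by
  have := dot_self_add_le x (-y)
  rwa [dot_self_neg, ← sub_eq_add_neg] at this

theorem dot_mulVec_comm (M : Matrix ι κ ℝ) (x : ι → ℝ) (y : κ → ℝ) :
    x ⬝ᵥ (M *ᵥ y) = (Mᵀ *ᵥ x) ⬝ᵥ y := by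
  rw [dotProduct_mulVec, ← mulVec_transpose]

/-- Uniform boundedness of a matrix-valued mapping, as a family of linear mappings. -/
theorem mulVec_dot_le_of_abs_le {F : Matrix ι κ ℝ} {C : ℝ} (hC : ∀ i j, |F i j| ≤ C)
    (x : κ → ℝ) :
    (F *ᵥ x) ⬝ᵥ (F *ᵥ x) ≤ (Fintype.card ι * (Fintype.card κ * C ^ 2)) * (x ⬝ᵥ x) := by
  have h : ∀ i, (F *ᵥ x) i * (F *ᵥ x) i ≤ (Fintype.card κ * C ^ 2) * (x ⬝ᵥ x) := by
    intro i
    have h1 := dot_sq_le (fun j => F i j) x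
    rw [sq] at h1
    refine h1.trans (mul_le_mul_of_nonneg_right ?_ (dot_self_nonneg x))
    calc (∑ j, F i j * F i j) ≤ ∑ _j : κ, C ^ 2 := Finset.sum_le_sum fun j _ => by
          rw [← sq, ← sq_abs]
          exact pow_le_pow_left₀ (abs_nonneg _) (hC i j) 2
      _ = _ := by simp
  calc (F *ᵥ x) ⬝ᵥ (F *ᵥ x) ≤ ∑ _i : ι, (Fintype.card κ * C ^ 2) * (x ⬝ᵥ x) :=
        Finset.sum_le_sum fun i _ => h i
    _ = _ := by simp; ring

theorem BoundedMap.exists_mulVec_dot_le {F : ℝ → Matrix ι κ ℝ} (hF : BoundedMap F) :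
    ∃ C > 0, ∀ t x, (F t *ᵥ x) ⬝ᵥ (F t *ᵥ x) ≤ C * (x ⬝ᵥ x) := by
  obtain ⟨C, hC⟩ := hF
  refine ⟨Fintype.card ι * (Fintype.card κ * C ^ 2) + 1, by positivity, fun t x => ?_⟩
  have := mulVec_dot_le_of_abs_le (hC t) x
  have := dot_self_nonneg x
  linarith

theorem abs_apply_le_of_mulVec_dot_le [DecidableEq κ] {F : Matrix ι κ ℝ} {C : ℝ}
    (h : ∀ x, (F *ᵥ x) ⬝ᵥ (F *ᵥ x) ≤ C * (x ⬝ᵥ x)) (i : ι) (j : κ) : |F i j| ≤ C + 1 := by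
  have h1 := h (Pi.single j 1)
  have h2 : F i j * F i j ≤ C := by
    simp only [mulVec_single, MulOpposite.op_one, one_smul, single_dotProduct, Pi.single_eq_same,
      mul_one] at h1
    exact (Finset.single_le_sum (f := fun i => F i j * F i j) (fun i _ => mul_self_nonneg _)
      (Finset.mem_univ i)).trans h1
  have h3 : 0 ≤ C := (mul_self_nonneg _).trans h2
  -- The bound C + 1 replaces √C, since C ≤ (C + 1)².
  exact abs_le_of_sq_le_sq (by nlinarith) (by linarith)

theorem boundedMap_of_mulVec_dot_le [DecidableEq κ] {F : ℝ → Matrix ι κ ℝ} {C : ℝ}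
    (h : ∀ t x, (F t *ᵥ x) ⬝ᵥ (F t *ᵥ x) ≤ C * (x ⬝ᵥ x)) : BoundedMap F :=
  ⟨C + 1, fun t => abs_apply_le_of_mulVec_dot_le (h t)⟩

theorem isUnit_of_dot_le [DecidableEq ι] {F : Matrix ι ι ℝ} {c : ℝ} (hc : 0 < c)
    (h : ∀ x, c * (x ⬝ᵥ x) ≤ x ⬝ᵥ (F *ᵥ x)) : IsUnit F := by
  rw [← Matrix.mulVec_injective_iff_isUnit]
  intro x y hxy
  have h1 := h (x - y)
  rw [mulVec_sub, show F *ᵥ x = F *ᵥ y from hxy, sub_self, dotProduct_zero] at h1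
  have h2 := dot_self_nonneg (x - y)
  exact sub_eq_zero.1 (dotProduct_self_eq_zero.1 (by nlinarith))

theorem inv_mulVec_dot_le [DecidableEq ι] {F : Matrix ι ι ℝ} {c : ℝ} (hc : 0 < c)
    (h : ∀ x, c * (x ⬝ᵥ x) ≤ x ⬝ᵥ (F *ᵥ x)) (x : ι → ℝ) :
    (F⁻¹ *ᵥ x) ⬝ᵥ (F⁻¹ *ᵥ x) ≤ (c ^ 2)⁻¹ * (x ⬝ᵥ x) := by
  set y := F⁻¹ *ᵥ x with hy
  have hx : F *ᵥ y = x := by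
    rw [hy, mulVec_mulVec,
      mul_nonsing_inv _ ((Matrix.isUnit_iff_isUnit_det _).1 (isUnit_of_dot_le hc h)), one_mulVec]
  have h1 := h y
  rw [hx] at h1
  have h2 := dot_sq_le y x
  have h3 := dot_self_nonneg y
  have h4 := dot_self_nonneg x
  rw [inv_mul_eq_div, le_div_iff₀ (by positivity)]
  rcases h3.eq_or_lt with h5 | h5
  · rw [← h5]; simpa using h4
  · have h6 : (c * (y ⬝ᵥ y)) ^ 2 ≤ (y ⬝ᵥ y) * (x ⬝ᵥ x) :=
      (pow_le_pow_left₀ (by positivity) h1 2).trans h2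
    have h7 : (y ⬝ᵥ y) * ((y ⬝ᵥ y) * c ^ 2) ≤ (y ⬝ᵥ y) * (x ⬝ᵥ x) := by linarith
    exact le_of_mul_le_mul_left h7 h5

/-- A matrix-valued mapping bounded below by a positive multiple of the identity has a bounded
inverse. -/
theorem boundedMap_inv [DecidableEq ι] {F : ℝ → Matrix ι ι ℝ} {c : ℝ} (hc : 0 < c)
    (h : ∀ t x, c * (x ⬝ᵥ x) ≤ x ⬝ᵥ (F t *ᵥ x)) : BoundedMap fun t => (F t)⁻¹ :=
  boundedMap_of_mulVec_dot_le fun t => inv_mulVec_dot_le hc (h t)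

theorem UniformlyPosDef.exists_dot_le [DecidableEq κ] {R : ℝ → Matrix κ κ ℝ}
    (hR : UniformlyPosDef R) : ∃ c > 0, ∀ t x, c * (x ⬝ᵥ x) ≤ x ⬝ᵥ (R t *ᵥ x) := by
  obtain ⟨α, hα, h⟩ := hR
  refine ⟨α, hα, fun t x => ?_⟩
  have := (h t).posSemidef.dotProduct_mulVec_nonneg x
  simp only [star_trivial, sub_mulVec, smul_mulVec, one_mulVec, dotProduct_sub,
    dotProduct_smul, smul_eq_mul] at this
  linarith

theorem UniformlyPosDef.isUnit [DecidableEq κ] {R : ℝ → Matrix κ κ ℝ}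
    (hR : UniformlyPosDef R) (t : ℝ) : IsUnit (R t) := by
  obtain ⟨c, hc, h⟩ := hR.exists_dot_le
  exact isUnit_of_dot_le hc (h t)

theorem UniformlyPosDef.boundedMap_inv [DecidableEq κ] {R : ℝ → Matrix κ κ ℝ}
    (hR : UniformlyPosDef R) : BoundedMap fun t => (R t)⁻¹ := by
  obtain ⟨c, hc, h⟩ := hR.exists_dot_le
  exact LQ.boundedMap_inv hc h

theorem uniformlyPosDef_of_dot_le [DecidableEq κ] {R : ℝ → Matrix κ κ ℝ} {c : ℝ} (hc : 0 < c)
    (hs : ∀ t, (R t).IsSymm) (h : ∀ t x, c * (x ⬝ᵥ x) ≤ x ⬝ᵥ (R t *ᵥ x)) :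
    UniformlyPosDef R := by
  refine ⟨c / 2, by positivity, fun t => PosDef.of_dotProduct_mulVec_pos ?_ fun x hx => ?_⟩
  · have h1 : (R t)ᵀ = R t := hs t
    simp [Matrix.IsHermitian, Matrix.conjTranspose_eq_transpose_of_trivial, h1]
  · have h1 := h t x
    have h2 : 0 < x ⬝ᵥ x := (dot_self_nonneg x).lt_of_ne fun h0 =>
      hx (dotProduct_self_eq_zero.1 h0.symm)
    simp only [star_trivial, sub_mulVec, smul_mulVec, one_mulVec, dotProduct_sub,
      dotProduct_smul, smul_eq_mul]
    nlinarith

end Estimates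

/-! ### Growth of solutions -/

section Growth

variable {ι κ : Type*} [Fintype ι] [Fintype κ]

/-- Grönwall: exp (-c(t - a)) E - ∫ h is nonincreasing, because the exponential factor is at most 1
on the source h. -/
theorem le_exp_mul_of_deriv_le {E E' h : ℝ → ℝ} {c a b : ℝ} (hab : a ≤ b) (hc : 0 ≤ c)
    (hE : ∀ t, HasDerivAt E (E' t) t) (hh : Continuous h) (hh0 : ∀ t, 0 ≤ h t)
    (hle : ∀ t, E' t ≤ c * E t + h t) :
    E b ≤ Real.exp (c * (b - a)) * (E a + ∫ t in a..b, h t) := by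
  set φ : ℝ → ℝ := fun t => Real.exp (-(c * (t - a))) * E t - ∫ s in a..t, h s with hφ
  have hexp : ∀ t, HasDerivAt (fun t => Real.exp (-(c * (t - a))))
      (Real.exp (-(c * (t - a))) * -c) t := by
    intro t
    simpa using ((((hasDerivAt_id t).sub_const a).const_mul c).neg).exp
  have hd : ∀ t, HasDerivAt φ (Real.exp (-(c * (t - a))) * -c * E t +
      Real.exp (-(c * (t - a))) * E' t - h t) t := fun t =>
    ((hexp t).mul (hE t)).sub (hh.integral_hasStrictDerivAt a t).hasDerivAt
  have hanti : AntitoneOn φ (Set.Icc a b) := by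
    refine antitoneOn_of_deriv_nonpos (convex_Icc a b)
      (fun t _ => (hd t).continuousAt.continuousWithinAt)
      (fun t _ => (hd t).differentiableAt.differentiableWithinAt) fun t ht => ?_
    rw [interior_Icc] at ht
    rw [(hd t).deriv]
    have h1 : Real.exp (-(c * (t - a))) ≤ 1 :=
      Real.exp_le_one_iff.2 (neg_nonpos.2 (mul_nonneg hc (sub_nonneg.2 ht.1.le)))
    have h2 := mul_le_mul_of_nonneg_left (hle t) (Real.exp_pos (-(c * (t - a)))).le
    have h3 := mul_le_mul_of_nonneg_right h1 (hh0 t)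
    linarith
  have h1 := hanti (Set.left_mem_Icc.2 hab) (Set.right_mem_Icc.2 hab) hab
  simp only [hφ, sub_self, mul_zero, neg_zero, Real.exp_zero, one_mul,
    intervalIntegral.integral_same, sub_zero] at h1
  rw [Real.exp_neg] at h1
  have h2 : (Real.exp (c * (b - a)))⁻¹ * E b ≤ E a + ∫ t in a..b, h t := by linarith
  rwa [inv_mul_le_iff₀ (Real.exp_pos _)] at h2

/-- Grönwall for |x|². Its derivative 2x·Fx + 2x·f is at most (C + 2)|x|² + |f|² when |Fx|² ≤ C|x|²,
which explains the exponent. -/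
theorem exists_growth {F : ℝ → Matrix ι ι ℝ} (hF : BoundedMap F) :
    ∃ c > 0, ∀ (x f : ℝ → ι → ℝ) (a b : ℝ), a ≤ b → Continuous f →
      (∀ t, HasDerivAt x (F t *ᵥ x t + f t) t) →
      x b ⬝ᵥ x b ≤ Real.exp (c * (b - a)) * (x a ⬝ᵥ x a + ∫ t in a..b, f t ⬝ᵥ f t) := by
  obtain ⟨C, hC0, hC⟩ := hF.exists_mulVec_dot_le
  refine ⟨C + 2, by positivity, fun x f a b hab hf hx => ?_⟩
  refine le_exp_mul_of_deriv_le (E := fun t => x t ⬝ᵥ x t) hab (by positivity)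
    (fun t => hasDerivAt_dotProduct (hx t) (hx t)) (hf.dotProduct hf)
    (fun t => dot_self_nonneg _) fun t => ?_
  have h1 := two_dot_le (x t) (F t *ᵥ x t)
  have h2 := two_dot_le (x t) (f t)
  have h3 := hC t (x t)
  simp only [dotProduct_add, dotProduct_comm _ (x t)]
  linarith

theorem exists_growth_backward {F : ℝ → Matrix ι ι ℝ} (hF : BoundedMap F) :
    ∃ c > 0, ∀ (x : ℝ → ι → ℝ) (a b : ℝ), a ≤ b → (∀ t, HasDerivAt x (F t *ᵥ x t) t) →
      x a ⬝ᵥ x a ≤ Real.exp (c * (b - a)) * (x b ⬝ᵥ x b) := by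
  have hF' : BoundedMap fun t => -F (-t) := by
    obtain ⟨C, hC⟩ := hF
    exact ⟨C, fun t i j => by simpa using hC (-t) i j⟩
  obtain ⟨c, hc, h⟩ := exists_growth hF'
  refine ⟨c, hc, fun x a b hab hx => ?_⟩
  have := h (fun t => x (-t)) (fun _ => 0) (-b) (-a) (by linarith) continuous_const fun t => by
    have := (hx (-t)).scomp t (hasDerivAt_neg t)
    simpa [Function.comp_def, neg_mulVec] using this
  simpa [neg_add_eq_sub] using this

end Growth

/-! ### Observability and controllability -/

section Control

variable {ι κ : Type*} [Fintype ι] [Fintype κ]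

theorem dot_integral_mulVec {G : ℝ → Matrix ι κ ℝ} (hG : Continuous G) (a b : ℝ) (x : ι → ℝ)
    (y : κ → ℝ) : x ⬝ᵥ ((Matrix.of fun i j => ∫ τ in a..b, G τ i j) *ᵥ y) =
      ∫ τ in a..b, x ⬝ᵥ (G τ *ᵥ y) := by
  simp only [dotProduct, mulVec, Matrix.of_apply, Finset.mul_sum]
  have hc : ∀ i j, Continuous fun τ => x i * (G τ i j * y j) := fun i j =>
    continuous_const.mul ((hG.matrix_elem i j).mul continuous_const)
  rw [intervalIntegral.integral_finsetSum fun i _ =>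
    (continuous_finsetSum _ fun j _ => hc i j).intervalIntegrable _ _]
  refine Finset.sum_congr rfl fun i _ => ?_
  rw [intervalIntegral.integral_finsetSum fun j _ => (hc i j).intervalIntegrable _ _]
  refine Finset.sum_congr rfl fun j _ => ?_
  rw [intervalIntegral.integral_const_mul, intervalIntegral.integral_mul_const]

theorem dot_gram (Ψ : Matrix ι ι ℝ) (B : Matrix ι κ ℝ) (x : ι → ℝ) :
    x ⬝ᵥ ((Ψ * B * Bᵀ * Ψᵀ) *ᵥ x) = (Bᵀ *ᵥ (Ψᵀ *ᵥ x)) ⬝ᵥ (Bᵀ *ᵥ (Ψᵀ *ᵥ x)) := by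
  rw [Matrix.mul_assoc, Matrix.mul_assoc, ← mulVec_mulVec, ← mulVec_mulVec, ← mulVec_mulVec,
    dot_mulVec_comm, dot_mulVec_comm]

variable [DecidableEq ι] {A : ℝ → Matrix ι ι ℝ} {B : ℝ → Matrix ι κ ℝ}

theorem DynamicsAssumption.gramian (h : DynamicsAssumption A B) :
    ∃ Φ, IsTransitionMatrix A Φ ∧ ∃ s > (0 : ℝ), ∃ β > (0 : ℝ), ∀ (t : ℝ) (x : ι → ℝ),
      β * (x ⬝ᵥ x) ≤ x ⬝ᵥ ((Matrix.of fun i j =>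
        ∫ τ in t..(t + s), (Φ t τ * B τ * (B τ)ᵀ * (Φ t τ)ᵀ) i j) *ᵥ x) := by
  obtain ⟨Φ, hΦ, s, hs, β, hβ, hW⟩ := h.controllable
  refine ⟨Φ, hΦ, s, hs, β, hβ, fun t x => ?_⟩
  have := (hW t).posSemidef.dotProduct_mulVec_nonneg x
  simp only [star_trivial, sub_mulVec, smul_mulVec, one_mulVec, dotProduct_sub,
    dotProduct_smul, smul_eq_mul] at this
  linarith

theorem DynamicsAssumption.continuous_gram (h : DynamicsAssumption A B)
    {Φ : ℝ → ℝ → Matrix ι ι ℝ} (hΦ : IsTransitionMatrix A Φ) (t : ℝ) :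
    Continuous fun τ => Φ t τ * B τ * (B τ)ᵀ * (Φ t τ)ᵀ := by
  have h1 := hΦ.continuous_right h.smooth_A.continuous t
  have h2 := h.smooth_B.continuous
  exact ((h1.matrix_mul h2).matrix_mul h2.matrix_transpose).matrix_mul h1.matrix_transpose

/-- Uniform observability of the adjoint equation, with a source term. -/
theorem DynamicsAssumption.observability (h : DynamicsAssumption A B) :
    ∃ s > (0 : ℝ), ∃ C > (0 : ℝ), ∀ (p f : ℝ → ι → ℝ) (t : ℝ), Continuous f →
      (∀ τ, HasDerivAt p (-(A τ)ᵀ *ᵥ p τ + f τ) τ) →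
      p t ⬝ᵥ p t ≤ C * ∫ τ in t..(t + s),
        (((B τ)ᵀ *ᵥ p τ) ⬝ᵥ ((B τ)ᵀ *ᵥ p τ) + f τ ⬝ᵥ f τ) := by
  obtain ⟨Φ, hΦ, s, hs, β, hβ, hW⟩ := h.gramian
  obtain ⟨c, hc, hgrow⟩ := exists_growth h.bounded_A.transpose.neg
  obtain ⟨b, hb, hB⟩ := h.bounded_B.transpose.exists_mulVec_dot_le
  refine ⟨s, hs, (2 + 2 * b * Real.exp (c * s) * s) / β, by positivity,
    fun p f t hf hp => ?_⟩
  have hAc := h.smooth_A.continuous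
  have hBc := h.smooth_B.continuous
  have hpc : Continuous p := continuous_iff_continuousAt.2 fun τ => (hp τ).continuousAt
  -- The solution without source and with the same value at t: the Gramian bound applies to q, and
  -- `exists_growth` bounds p - q by the source.
  set q : ℝ → ι → ℝ := fun τ => (Φ t τ)ᵀ *ᵥ p t with hq
  have hqd : ∀ τ, HasDerivAt q (-(A τ)ᵀ *ᵥ q τ) τ := fun τ =>
    hΦ.hasDerivAt_transpose_mulVec hAc _ _ _
  have hqc : Continuous q := continuous_iff_continuousAt.2 fun τ => (hqd τ).continuousAt
  set I := ∫ τ in t..(t + s), f τ ⬝ᵥ f τ with hI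
  have hffc : Continuous fun τ => f τ ⬝ᵥ f τ := hf.dotProduct hf
  have hg : ∀ τ ∈ Set.Icc t (t + s), (p τ - q τ) ⬝ᵥ (p τ - q τ) ≤ Real.exp (c * s) * I := by
    intro τ hτ
    have h1 := hgrow (fun τ => p τ - q τ) f t τ hτ.1 hf fun σ => by
      refine ((hp σ).sub (hqd σ)).congr_deriv ?_
      rw [mulVec_sub]
      abel
    have h2 : p t - q t = 0 := by simp [hq, hΦ.self]
    simp only [h2, dotProduct_zero, zero_add] at h1
    refine h1.trans (mul_le_mul (Real.exp_le_exp.2 ?_) ?_ ?_ (Real.exp_pos _).le)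
    · exact mul_le_mul_of_nonneg_left (by linarith [hτ.2]) hc.le
    · exact intervalIntegral.integral_mono_interval le_rfl hτ.1 hτ.2
        (Filter.Eventually.of_forall fun σ => dot_self_nonneg _) (hffc.intervalIntegrable _ _)
    · exact intervalIntegral.integral_nonneg hτ.1 fun σ _ => dot_self_nonneg _
  have hBp : Continuous fun τ => ((B τ)ᵀ *ᵥ p τ) ⬝ᵥ ((B τ)ᵀ *ᵥ p τ) :=
    (hBc.matrix_transpose.matrix_mulVec hpc).dotProduct (hBc.matrix_transpose.matrix_mulVec hpc)
  have hBq : Continuous fun τ => ((B τ)ᵀ *ᵥ q τ) ⬝ᵥ ((B τ)ᵀ *ᵥ q τ) :=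
    (hBc.matrix_transpose.matrix_mulVec hqc).dotProduct (hBc.matrix_transpose.matrix_mulVec hqc)
  have h1 := hW t (p t)
  rw [dot_integral_mulVec (h.continuous_gram hΦ t)] at h1
  simp only [dot_gram] at h1
  have h2 : ∫ τ in t..(t + s), ((B τ)ᵀ *ᵥ q τ) ⬝ᵥ ((B τ)ᵀ *ᵥ q τ) ≤
      ∫ τ in t..(t + s), (2 * (((B τ)ᵀ *ᵥ p τ) ⬝ᵥ ((B τ)ᵀ *ᵥ p τ)) +
        2 * b * Real.exp (c * s) * I) := by
    refine intervalIntegral.integral_mono_on (by linarith) (hBq.intervalIntegrable _ _)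
      (((hBp.const_mul 2).add continuous_const).intervalIntegrable _ _) fun τ hτ => ?_
    have h3 := dot_self_sub_le ((B τ)ᵀ *ᵥ p τ) ((B τ)ᵀ *ᵥ (p τ - q τ))
    rw [← mulVec_sub, sub_sub_cancel] at h3
    have h4 := hB τ (p τ - q τ)
    have h5 := mul_le_mul_of_nonneg_left (hg τ hτ) hb.le
    linarith
  rw [intervalIntegral.integral_add ((hBp.const_mul 2).intervalIntegrable _ _)
    (continuous_const.intervalIntegrable _ _), intervalIntegral.integral_const_mul,
    intervalIntegral.integral_const, add_sub_cancel_left, smul_eq_mul] at h2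
  rw [intervalIntegral.integral_add (hBp.intervalIntegrable _ _) (hffc.intervalIntegrable _ _),
    div_mul_eq_mul_div, le_div_iff₀ hβ]
  have h6 : 0 ≤ I := intervalIntegral.integral_nonneg (by linarith) fun σ _ => dot_self_nonneg _
  have h7 : 0 ≤ ∫ τ in t..(t + s), ((B τ)ᵀ *ᵥ p τ) ⬝ᵥ ((B τ)ᵀ *ᵥ p τ) :=
    intervalIntegral.integral_nonneg (by linarith) fun σ _ => dot_self_nonneg _
  have h8 : 0 ≤ b * Real.exp (c * s) * s := by positivity
  nlinarith [mul_nonneg h8 h7]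

/-- Any two points can be joined in a fixed time, with uniform bounds. -/
theorem DynamicsAssumption.steering (h : DynamicsAssumption A B) :
    ∃ s > (0 : ℝ), ∃ C > (0 : ℝ), ∀ (t : ℝ) (a b : ι → ℝ), ∃ (y : ℝ → ι → ℝ) (v : ℝ → κ → ℝ),
      Continuous v ∧ (∀ τ, HasDerivAt y (A τ *ᵥ y τ + B τ *ᵥ v τ) τ) ∧ y t = a ∧
      y (t + s) = b ∧ ∀ τ ∈ Set.Icc t (t + s),
        y τ ⬝ᵥ y τ ≤ C * (a ⬝ᵥ a + b ⬝ᵥ b) ∧ v τ ⬝ᵥ v τ ≤ C * (a ⬝ᵥ a + b ⬝ᵥ b) := by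
  obtain ⟨Φ, hΦ, s, hs, β, hβ, hW⟩ := h.gramian
  obtain ⟨c₁, hc₁, hgrow⟩ := exists_growth h.bounded_A
  obtain ⟨c₂, hc₂, hback⟩ := exists_growth_backward h.bounded_A
  obtain ⟨c₃, hc₃, hadj⟩ := exists_growth h.bounded_A.transpose.neg
  obtain ⟨b₁, hb₁, hBt⟩ := h.bounded_B.transpose.exists_mulVec_dot_le
  obtain ⟨b₂, hb₂, hB⟩ := h.bounded_B.exists_mulVec_dot_le
  have hAc := h.smooth_A.continuous
  have hBc := h.smooth_B.continuous
  set D := (β ^ 2)⁻¹ * (2 + 2 * Real.exp (c₂ * s)) with hD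
  set D' := b₁ * (Real.exp (c₃ * s) * D) with hD'
  set D'' := Real.exp (c₁ * s) * (1 + s * (b₂ * D')) with hD''
  have hDp : 0 < D := by positivity
  have hDp' : 0 < D' := by positivity
  have hDp'' : 0 < D'' := by positivity
  refine ⟨s, hs, D' + D'', by positivity, fun t a b => ?_⟩
  set G : ℝ → Matrix ι ι ℝ := fun τ => Φ t τ * B τ * (B τ)ᵀ * (Φ t τ)ᵀ with hG
  have hGc : Continuous G := h.continuous_gram hΦ t
  set Y : ℝ → Matrix ι ι ℝ := fun τ => Matrix.of fun i j => ∫ σ in t..τ, G σ i j with hY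
  have hYd : ∀ τ, HasMatDerivAt Y (G τ) τ := fun τ i j =>
    ((hGc.matrix_elem i j).integral_hasStrictDerivAt t τ).hasDerivAt
  have hYt : Y t = 0 := by ext i j; simp [hY]
  -- The classical Gramian control Bᵀ Φ(t,τ)ᵀ η: variation of constants gives the state Φ(τ,t)(a +
  -- Y(τ)η), and η makes it equal b at time t + s.
  set η := (Y (t + s))⁻¹ *ᵥ (Φ t (t + s) *ᵥ b - a) with hη
  have hYη : Y (t + s) *ᵥ η = Φ t (t + s) *ᵥ b - a := by
    rw [hη, mulVec_mulVec, mul_nonsing_inv _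
      ((Matrix.isUnit_iff_isUnit_det _).1 (isUnit_of_dot_le hβ (hW t))), one_mulVec]
  set q : ℝ → ι → ℝ := fun τ => (Φ t τ)ᵀ *ᵥ η with hq
  have hqd : ∀ τ, HasDerivAt q (-(A τ)ᵀ *ᵥ q τ) τ := fun τ =>
    hΦ.hasDerivAt_transpose_mulVec hAc _ _ _
  have hqc : Continuous q := continuous_iff_continuousAt.2 fun τ => (hqd τ).continuousAt
  set v : ℝ → κ → ℝ := fun τ => (B τ)ᵀ *ᵥ q τ with hv
  have hvc : Continuous v := hBc.matrix_transpose.matrix_mulVec hqc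
  set y : ℝ → ι → ℝ := fun τ => Φ τ t *ᵥ (a + Y τ *ᵥ η) with hy
  have hyd : ∀ τ, HasDerivAt y (A τ *ᵥ y τ + B τ *ᵥ v τ) τ := by
    intro τ
    refine ((hΦ.hasMatDerivAt τ t).mulVec (((hYd τ).mulVec_const η).const_add a)).congr_deriv ?_
    simp only [hy, hv, hq, hG, mulVec_mulVec]
    congr 2
    simp only [← Matrix.mul_assoc]
    rw [hΦ.mul_self hAc, Matrix.one_mul]
  have hyt : y t = a := by simp [hy, hYt, hΦ.self]
  set N := a ⬝ᵥ a + b ⬝ᵥ b with hN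
  have hN0 : 0 ≤ N := add_nonneg (dot_self_nonneg a) (dot_self_nonneg b)
  have hηb : η ⬝ᵥ η ≤ D * N := by
    have h1 := inv_mulVec_dot_le hβ (hW t) (Φ t (t + s) *ᵥ b - a)
    have h2 := dot_self_sub_le (Φ t (t + s) *ᵥ b) a
    have h3 := hback (fun τ => Φ τ (t + s) *ᵥ b) t (t + s) (by linarith)
      fun τ => hΦ.hasDerivAt_mulVec b τ (t + s)
    simp only [hΦ.self, one_mulVec, add_sub_cancel_left] at h3
    have h4 := dot_self_nonneg a
    have h5 := mul_nonneg (Real.exp_pos (c₂ * s)).le h4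
    have h6 := dot_self_nonneg b
    refine h1.trans ?_
    rw [hD, mul_assoc]
    exact mul_le_mul_of_nonneg_left (by rw [hN]; linarith) (by positivity)
  have hvb : ∀ τ ∈ Set.Icc t (t + s), v τ ⬝ᵥ v τ ≤ D' * N := by
    intro τ hτ
    have h1 := hadj q (fun _ => 0) t τ hτ.1 continuous_const (by simpa using hqd)
    have h2 : q t = η := by simp [hq, hΦ.self]
    simp only [h2, dotProduct_zero, intervalIntegral.integral_zero, add_zero] at h1
    have h3 : Real.exp (c₃ * (τ - t)) ≤ Real.exp (c₃ * s) :=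
      Real.exp_le_exp.2 (mul_le_mul_of_nonneg_left (by linarith [hτ.2]) hc₃.le)
    refine (hBt τ (q τ)).trans ?_
    rw [hD', mul_assoc, mul_assoc]
    refine mul_le_mul_of_nonneg_left (h1.trans ?_) hb₁.le
    exact mul_le_mul h3 hηb (dot_self_nonneg _) (Real.exp_pos _).le
  refine ⟨y, v, hvc, hyd, hyt, ?_, fun τ hτ => ⟨?_, ?_⟩⟩
  · simp only [hy]
    rw [hYη, add_sub_cancel, mulVec_mulVec, hΦ.mul_self hAc, one_mulVec]
  · have h1 := hgrow y (fun τ => B τ *ᵥ v τ) t τ hτ.1 (hBc.matrix_mulVec hvc) hyd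
    have h3 : Real.exp (c₁ * (τ - t)) ≤ Real.exp (c₁ * s) :=
      Real.exp_le_exp.2 (mul_le_mul_of_nonneg_left (by linarith [hτ.2]) hc₁.le)
    have hBv : Continuous fun τ => (B τ *ᵥ v τ) ⬝ᵥ (B τ *ᵥ v τ) :=
      (hBc.matrix_mulVec hvc).dotProduct (hBc.matrix_mulVec hvc)
    have h4 : ∫ σ in t..τ, (B σ *ᵥ v σ) ⬝ᵥ (B σ *ᵥ v σ) ≤ ∫ _σ in t..τ, b₂ * (D' * N) :=
      intervalIntegral.integral_mono_on hτ.1 (hBv.intervalIntegrable _ _)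
        (continuous_const.intervalIntegrable _ _) fun σ hσ =>
        (hB σ _).trans (mul_le_mul_of_nonneg_left (hvb σ ⟨hσ.1, hσ.2.trans hτ.2⟩) hb₂.le)
    rw [intervalIntegral.integral_const, smul_eq_mul] at h4
    have h5 : (τ - t) * (b₂ * (D' * N)) ≤ s * (b₂ * (D' * N)) :=
      mul_le_mul_of_nonneg_right (by linarith [hτ.2]) (by positivity)
    have h6 : y t ⬝ᵥ y t ≤ N := by
      rw [hyt, hN]; linarith [dot_self_nonneg b]
    have h7 : 0 ≤ ∫ σ in t..τ, (B σ *ᵥ v σ) ⬝ᵥ (B σ *ᵥ v σ) :=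
      intervalIntegral.integral_nonneg hτ.1 fun σ _ => dot_self_nonneg _
    calc y τ ⬝ᵥ y τ ≤ Real.exp (c₁ * s) * (N + s * (b₂ * (D' * N))) :=
          h1.trans (mul_le_mul h3 (by linarith)
            (add_nonneg (dot_self_nonneg _) h7) (Real.exp_pos _).le)
      _ = D'' * N := by rw [hD'']; ring
      _ ≤ (D' + D'') * N := mul_le_mul_of_nonneg_right (by linarith) hN0
  · exact (hvb τ hτ).trans (mul_le_mul_of_nonneg_right (by linarith) hN0)

end Control

/-! ### Calculus along trajectories -/

section Trajectories

variable {ι κ : Type*} [Fintype ι] [Fintype κ]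
  {A : ℝ → Matrix ι ι ℝ} {B : ℝ → Matrix ι κ ℝ}

theorem intervalIntegrable_mulVec {ν : Type*} [Fintype ν] {M : ℝ → Matrix ν κ ℝ}
    (hM : Continuous M) {u : ℝ → κ → ℝ}
    {a b : ℝ} (hu : IntervalIntegrable u volume a b) :
    IntervalIntegrable (fun t => M t *ᵥ u t) volume a b := by
  have h1 : ∀ i, IntervalIntegrable (fun t => (M t *ᵥ u t) i) volume a b := by
    intro i
    simp only [mulVec, dotProduct]
    have h2 : ∀ j ∈ Finset.univ, IntervalIntegrable (fun t => M t i j * u t j) volume a b := by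
      intro j _
      have h3 : IntervalIntegrable (fun t => u t j) volume a b :=
        ⟨hu.1.eval j, hu.2.eval j⟩
      exact h3.continuousOn_mul (hM.matrix_elem i j).continuousOn
    simpa [Finset.sum_fn] using IntervalIntegrable.sum _ h2
  exact ⟨Integrable.of_eval fun i => (h1 i).1, Integrable.of_eval fun i => (h1 i).2⟩

namespace IsTrajectory

variable {t₀ t₁ : ℝ} {x : ℝ → ι → ℝ} {u : ℝ → κ → ℝ}

theorem intervalIntegrable_control (h : IsTrajectory A B t₀ t₁ x u) (h01 : t₀ ≤ t₁) :
    IntervalIntegrable u volume t₀ t₁ := by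
  rw [intervalIntegrable_iff_integrableOn_Icc_of_le h01]
  exact h.1.integrable one_le_two

theorem intervalIntegrable_velocity (h : IsTrajectory A B t₀ t₁ x u) (h01 : t₀ ≤ t₁)
    (hA : Continuous A) (hB : Continuous B) :
    IntervalIntegrable (fun s => A s *ᵥ x s + B s *ᵥ u s) volume t₀ t₁ := by
  refine (intervalIntegrable_mulVec hA (ContinuousOn.intervalIntegrable ?_)).add
    (intervalIntegrable_mulVec hB (h.intervalIntegrable_control h01))
  rw [Set.uIcc_of_le h01]
  exact h.2.1

theorem apply_eq (h : IsTrajectory A B t₀ t₁ x u) (h01 : t₀ ≤ t₁)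
    (hA : Continuous A) (hB : Continuous B) {t : ℝ} (ht : t ∈ Set.Icc t₀ t₁) (i : ι) :
    x t i = x t₀ i + ∫ s in t₀..t, (A s *ᵥ x s + B s *ᵥ u s) i := by
  conv_lhs => rw [h.2.2 t ht]
  have hi : IntervalIntegrable (fun s => A s *ᵥ x s + B s *ᵥ u s) volume t₀ t :=
    (h.intervalIntegrable_velocity h01 hA hB).mono_set
      (by rw [Set.uIcc_of_le ht.1, Set.uIcc_of_le h01]; exact Set.Icc_subset_Icc_right ht.2)
  rw [Pi.add_apply]
  exact congrArg _ ((ContinuousLinearMap.proj (R := ℝ) i).intervalIntegral_comp_comm hi).symm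

end IsTrajectory

theorem absolutelyContinuousOnInterval_finset_sum {α : Type*} (s : Finset α) {f : α → ℝ → ℝ}
    {a b : ℝ} (hf : ∀ i ∈ s, AbsolutelyContinuousOnInterval (f i) a b) :
    AbsolutelyContinuousOnInterval (fun t => ∑ i ∈ s, f i t) a b := by
  classical
  induction s using Finset.induction_on with
  | empty =>
    simpa using (contDiff_const (c := (0 : ℝ))).contDiffOn.absolutelyContinuousOnInterval
  | insert i s hi ih =>
    simp only [Finset.sum_insert hi]
    exact (hf i (Finset.mem_insert_self i s)).add
      (ih fun j hj => hf j (Finset.mem_insert_of_mem hj))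

theorem integral_eq_sub_of_ae_hasDerivAt {h g : ℝ → ℝ} {a b : ℝ}
    (hac : AbsolutelyContinuousOnInterval h a b)
    (hd : ∀ᵐ t, t ∈ Set.uIcc a b → HasDerivAt h (g t) t) :
    ∫ t in a..b, g t = h b - h a := by
  rw [← hac.integral_deriv_eq_sub]
  refine intervalIntegral.integral_congr_ae ?_
  filter_upwards [hd] with t ht hm
  exact (ht (Set.uIoc_subset_uIcc hm)).deriv.symm

/-- The derivative of a quadratic form along a trajectory, in integral form. -/
theorem IsTrajectory.integral_quadratic {t₀ t₁ : ℝ} {x : ℝ → ι → ℝ} {u : ℝ → κ → ℝ}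
    (h : IsTrajectory A B t₀ t₁ x u) (h01 : t₀ ≤ t₁) (hA : Continuous A) (hB : Continuous B)
    {P : ℝ → Matrix ι ι ℝ} (hP : SmoothMap P) :
    ∫ t in t₀..t₁, ((A t *ᵥ x t + B t *ᵥ u t) ⬝ᵥ (P t *ᵥ x t) +
      x t ⬝ᵥ (matDeriv P t *ᵥ x t + P t *ᵥ (A t *ᵥ x t + B t *ᵥ u t))) =
      x t₁ ⬝ᵥ (P t₁ *ᵥ x t₁) - x t₀ ⬝ᵥ (P t₀ *ᵥ x t₀) := by
  set g : ℝ → ι → ℝ := fun s => A s *ᵥ x s + B s *ᵥ u s with hg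
  have hgi : ∀ i, IntervalIntegrable (fun t => g t i) volume t₀ t₁ := fun i =>
    ⟨(h.intervalIntegrable_velocity h01 hA hB).1.eval i,
      (h.intervalIntegrable_velocity h01 hA hB).2.eval i⟩
  -- A trajectory is arbitrary outside [t₀, t₁], so x is replaced by a primitive equal to it there,
  -- which is absolutely continuous and has two-sided derivatives almost everywhere.
  set z : ℝ → ι → ℝ := fun t i => x t₀ i + ∫ s in t₀..t, g s i with hz
  have hzx : ∀ t ∈ Set.Icc t₀ t₁, z t = x t := fun t ht =>
    funext fun i => (h.apply_eq h01 hA hB ht i).symm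
  have hzac : ∀ i, AbsolutelyContinuousOnInterval (fun t => z t i) t₀ t₁ := fun i =>
    (contDiff_const (c := x t₀ i)).contDiffOn.absolutelyContinuousOnInterval.add
      ((hgi i).absolutelyContinuousOnInterval_intervalIntegral Set.left_mem_uIcc)
  have hPac : ∀ i j, AbsolutelyContinuousOnInterval (fun t => P t i j) t₀ t₁ := fun i j =>
    ((hP i j).of_le (by simp)).contDiffOn.absolutelyContinuousOnInterval
  have hac : AbsolutelyContinuousOnInterval (fun t => z t ⬝ᵥ (P t *ᵥ z t)) t₀ t₁ := by
    simp only [dotProduct, mulVec]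
    exact absolutelyContinuousOnInterval_finset_sum _ fun i _ => (hzac i).fun_mul
      (absolutelyContinuousOnInterval_finset_sum _ fun j _ => (hPac i j).fun_mul (hzac j))
  have hzd : ∀ᵐ t, t ∈ Set.uIcc t₀ t₁ → HasDerivAt z (g t) t := by
    have : ∀ᵐ t, ∀ i, t ∈ Set.uIcc t₀ t₁ → ∀ c ∈ Set.uIcc t₀ t₁,
        HasDerivAt (fun x => ∫ s in c..x, g s i) (g t i) t :=
      ae_all_iff.2 fun i => (hgi i).ae_hasDerivAt_integral
    filter_upwards [this] with t ht hm
    exact hasDerivAt_pi.2 fun i => (ht i hm t₀ Set.left_mem_uIcc).const_add _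
  have key := integral_eq_sub_of_ae_hasDerivAt
    (g := fun t => g t ⬝ᵥ (P t *ᵥ z t) + z t ⬝ᵥ (matDeriv P t *ᵥ z t + P t *ᵥ g t)) hac (by
      filter_upwards [hzd] with t ht hm
      exact hasDerivAt_dotProduct (ht hm) ((hP.hasMatDerivAt t).mulVec (ht hm)))
  rw [hzx t₀ (Set.left_mem_Icc.2 h01), hzx t₁ (Set.right_mem_Icc.2 h01)] at key
  rw [← key]
  refine intervalIntegral.integral_congr fun t ht => ?_
  rw [Set.uIcc_of_le h01] at ht
  simp only [hzx t ht, hg]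

theorem isTrajectory_of_hasDerivAt (hA : Continuous A) (hB : Continuous B) {x : ℝ → ι → ℝ}
    {u : ℝ → κ → ℝ} (hu : Continuous u)
    (hx : ∀ t, HasDerivAt x (A t *ᵥ x t + B t *ᵥ u t) t) (t₀ t₁ : ℝ) :
    IsTrajectory A B t₀ t₁ x u := by
  have hxc : Continuous x := continuous_iff_continuousAt.2 fun t => (hx t).continuousAt
  refine ⟨?_, hxc.continuousOn, fun t _ => ?_⟩
  · obtain ⟨C, hC⟩ := isCompact_Icc.exists_bound_of_continuousOn (s := Set.Icc t₀ t₁)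
      hu.continuousOn
    exact MemLp.of_bound hu.aestronglyMeasurable C
      (ae_restrict_of_forall_mem measurableSet_Icc hC)
  · rw [intervalIntegral.integral_eq_sub_of_hasDerivAt (fun s _ => hx s)
      (((hA.matrix_mulVec hxc).add (hB.matrix_mulVec hu)).intervalIntegrable _ _)]
    simp

end Trajectories

/-! ### Quadratic costs and Riccati equations -/

section Costs

variable {ι κ : Type*} [Fintype ι] [Fintype κ]
  {A : ℝ → Matrix ι ι ℝ} {B : ℝ → Matrix ι κ ℝ}
  {Q : ℝ → Matrix ι ι ℝ} {S : ℝ → Matrix ι κ ℝ} {R : ℝ → Matrix κ κ ℝ}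

theorem IsTrajectory.intervalIntegrable_quadCost {t₀ t₁ : ℝ} {x : ℝ → ι → ℝ} {u : ℝ → κ → ℝ}
    (h : IsTrajectory A B t₀ t₁ x u) (h01 : t₀ ≤ t₁) (hQ : Continuous Q) (hS : Continuous S)
    (hR : Continuous R) :
    IntervalIntegrable (fun t => quadCost Q S R t (x t) (u t)) volume t₀ t₁ := by
  have hxc : ∀ i, ContinuousOn (fun t => x t i) (Set.uIcc t₀ t₁) := by
    rw [Set.uIcc_of_le h01]
    exact fun i => (continuous_apply i).comp_continuousOn h.2.1
  have hui := h.intervalIntegrable_control h01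
  have h1 : ∀ j, IntervalIntegrable (fun t => u t j) volume t₀ t₁ := fun j =>
    ⟨hui.1.eval j, hui.2.eval j⟩
  have h2 : ∀ i j, IntervalIntegrable (fun t => u t i * u t j) volume t₀ t₁ := by
    intro i j
    rw [intervalIntegrable_iff_integrableOn_Icc_of_le h01]
    exact (h.1.eval i).integrable_mul (h.1.eval j)
  unfold quadCost
  refine IntervalIntegrable.add (IntervalIntegrable.add ?_ (IntervalIntegrable.const_mul ?_ 2)) ?_
  · refine ContinuousOn.intervalIntegrable ?_
    simp only [dotProduct, mulVec]
    exact continuousOn_finsetSum _ fun i _ => (hxc i).mul (continuousOn_finsetSum _ fun j _ =>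
      (hQ.matrix_elem i j).continuousOn.mul (hxc j))
  · simp only [dotProduct, mulVec, Finset.mul_sum]
    have : ∀ i ∈ Finset.univ, IntervalIntegrable (fun t => ∑ j, x t i * (S t i j * u t j))
        volume t₀ t₁ := by
      intro i _
      have : ∀ j ∈ Finset.univ, IntervalIntegrable (fun t => x t i * (S t i j * u t j))
          volume t₀ t₁ := fun j _ =>
        ((h1 j).continuousOn_mul (hS.matrix_elem i j).continuousOn).continuousOn_mul (hxc i)
      simpa [Finset.sum_fn] using IntervalIntegrable.sum _ this
    simpa [Finset.sum_fn] using IntervalIntegrable.sum _ this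
  · simp only [dotProduct, mulVec, Finset.mul_sum]
    have : ∀ i ∈ Finset.univ, IntervalIntegrable (fun t => ∑ j, u t i * (R t i j * u t j))
        volume t₀ t₁ := by
      intro i _
      have : ∀ j ∈ Finset.univ, IntervalIntegrable (fun t => u t i * (R t i j * u t j))
          volume t₀ t₁ := by
        intro j _
        refine ((h2 i j).continuousOn_mul (hR.matrix_elem i j).continuousOn).congr ?_
        exact fun t _ => by ring
      simpa [Finset.sum_fn] using IntervalIntegrable.sum _ this
    simpa [Finset.sum_fn] using IntervalIntegrable.sum _ this

theorem feedbackCost_eq_quadCost {K : ℝ → Matrix κ ι ℝ} (hR : ∀ t, (R t).IsSymm) :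
    feedbackCost K R = quadCost (fun t => (K t)ᵀ * R t * K t) (fun t => (K t)ᵀ * R t) R := by
  funext t x u
  have h1 : (K t *ᵥ x) ⬝ᵥ (R t *ᵥ u) = u ⬝ᵥ (R t *ᵥ (K t *ᵥ x)) := by
    rw [dot_mulVec_comm, (hR t).eq, dotProduct_comm]
  have h2 : x ⬝ᵥ (((K t)ᵀ * R t) *ᵥ u) = u ⬝ᵥ (R t *ᵥ (K t *ᵥ x)) := by
    rw [← h1, ← mulVec_mulVec, dot_mulVec_comm, transpose_transpose]
  have h3 : x ⬝ᵥ (((K t)ᵀ * R t * K t) *ᵥ x) = (K t *ᵥ x) ⬝ᵥ (R t *ᵥ (K t *ᵥ x)) := by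
    rw [← mulVec_mulVec, ← mulVec_mulVec, dot_mulVec_comm, transpose_transpose]
  simp only [feedbackCost, quadCost, mulVec_add, add_dotProduct, dotProduct_add, h1, h2, h3]
  ring

theorem feedbackCost_nonneg {K : ℝ → Matrix κ ι ℝ} {t : ℝ} (hR : ∀ v, 0 ≤ v ⬝ᵥ (R t *ᵥ v))
    (x : ι → ℝ) (u : κ → ℝ) : 0 ≤ feedbackCost K R t x u := hR _

/-- Polarization: 2P i j is the form at eᵢ + eⱼ minus its values at eᵢ and eⱼ, so 2|P i j| ≤ 4C + C
+ C. -/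
theorem boundedMap_of_isSymm [DecidableEq ι] {P : ℝ → Matrix ι ι ℝ} {C : ℝ} (hC : 0 ≤ C)
    (hs : ∀ t, (P t).IsSymm) (h : ∀ t x, |x ⬝ᵥ (P t *ᵥ x)| ≤ C * (x ⬝ᵥ x)) : BoundedMap P := by
  refine ⟨3 * C, fun t i j => ?_⟩
  set e : ι → ι → ℝ := fun i => Pi.single i 1 with he
  have hq : ∀ k l, e k ⬝ᵥ (P t *ᵥ e l) = P t k l := fun k l => by simp [he]
  have h1 := h t (e i + e j)
  have h2 := h t (e i)
  have h3 := h t (e j)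
  have hee : ∀ k, e k ⬝ᵥ e k = 1 := fun k => by simp [he]
  have h5 := dot_self_add_le (e i) (e j)
  simp only [mulVec_add, dotProduct_add, add_dotProduct, hq, hee] at h1 h2 h3 h5
  rw [show P t j i = P t i j from (hs t).apply i j] at h1
  rw [abs_le] at h1 h2 h3 ⊢
  constructor <;> nlinarith

variable [DecidableEq κ]

/-- The feedback associated with a solution of the Riccati equation. -/
noncomputable def riccatiGain (B : ℝ → Matrix ι κ ℝ) (S : ℝ → Matrix ι κ ℝ)
    (R : ℝ → Matrix κ κ ℝ) (P : ℝ → Matrix ι ι ℝ) (t : ℝ) : Matrix κ ι ℝ :=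
  (R t)⁻¹ * ((S t)ᵀ + (B t)ᵀ * P t)

theorem closedLoop_eq (P : ℝ → Matrix ι ι ℝ) (t : ℝ) :
    closedLoop A B S R P t = A t - B t * riccatiGain B S R P t := by
  rw [closedLoop, riccatiGain, Matrix.mul_assoc]

/-- The Riccati equation is what makes the cost plus the derivative of xᵀPx a perfect square. The
term added to the cost is this derivative, with the right-hand side of the equation in place of Ṗ.
-/
theorem completing_squares {P : ℝ → Matrix ι ι ℝ} {t : ℝ} (hR : (R t).IsSymm)
    (hRu : IsUnit (R t)) (hP : (P t).IsSymm) (x : ι → ℝ) (u : κ → ℝ) :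
    quadCost Q S R t x u + ((A t *ᵥ x + B t *ᵥ u) ⬝ᵥ (P t *ᵥ x) +
      x ⬝ᵥ ((-(P t * A t) - (A t)ᵀ * P t
        + (P t * B t + S t) * (R t)⁻¹ * ((B t)ᵀ * P t + (S t)ᵀ) - Q t) *ᵥ x +
          P t *ᵥ (A t *ᵥ x + B t *ᵥ u))) = feedbackCost (riccatiGain B S R P) R t x u := by
  set w := ((B t)ᵀ * P t + (S t)ᵀ) *ᵥ x with hw
  have hRi : R t * (R t)⁻¹ = 1 :=
    mul_nonsing_inv _ ((Matrix.isUnit_iff_isUnit_det _).1 hRu)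
  have hK : riccatiGain B S R P t *ᵥ x = (R t)⁻¹ *ᵥ w := by
    rw [riccatiGain, hw, mulVec_mulVec, add_comm (S t)ᵀ]
  have hRK : R t *ᵥ ((R t)⁻¹ *ᵥ w) = w := by rw [mulVec_mulVec, hRi, one_mulVec]
  have h1 : x ⬝ᵥ (((P t * B t + S t) * (R t)⁻¹ * ((B t)ᵀ * P t + (S t)ᵀ)) *ᵥ x) =
      ((R t)⁻¹ *ᵥ w) ⬝ᵥ w := by
    rw [← mulVec_mulVec, ← hw, ← mulVec_mulVec, dot_mulVec_comm, transpose_add, transpose_mul,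
      hP.eq, ← hw, dotProduct_comm]
  have h2 : ((R t)⁻¹ *ᵥ w) ⬝ᵥ (R t *ᵥ u) = u ⬝ᵥ w := by
    rw [dot_mulVec_comm, hR.eq, hRK, dotProduct_comm]
  have h3 : u ⬝ᵥ w = x ⬝ᵥ (P t *ᵥ (B t *ᵥ u)) + x ⬝ᵥ (S t *ᵥ u) := by
    rw [hw, dot_mulVec_comm, dotProduct_comm, transpose_add, transpose_mul, transpose_transpose,
      transpose_transpose, hP.eq, add_mulVec, dotProduct_add, mulVec_mulVec]
  have h4 : ∀ y, y ⬝ᵥ (P t *ᵥ x) = x ⬝ᵥ (P t *ᵥ y) := fun y => by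
    rw [dot_mulVec_comm, hP.eq, dotProduct_comm]
  have h5 : x ⬝ᵥ (((A t)ᵀ * P t) *ᵥ x) = x ⬝ᵥ (P t *ᵥ (A t *ᵥ x)) := by
    rw [← mulVec_mulVec, dot_mulVec_comm, transpose_transpose, h4]
  have h6 : x ⬝ᵥ ((P t * A t) *ᵥ x) = x ⬝ᵥ (P t *ᵥ (A t *ᵥ x)) := by rw [mulVec_mulVec]
  simp only [quadCost, feedbackCost, hK, mulVec_add, add_dotProduct, dotProduct_add, hRK,
    add_mulVec, sub_mulVec, neg_mulVec, dotProduct_sub, dotProduct_neg, h1, h2, h3, h4, h5, h6]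
  ring

/-- Bootstrapping: Ṗ is polynomial in P with smooth coefficients, so P gains one derivative at each
step. -/
theorem IsRiccatiSolution.smooth {P : ℝ → Matrix ι ι ℝ} (hP : IsRiccatiSolution A B Q S R P)
    (hA : SmoothMap A) (hB : SmoothMap B) (hQ : SmoothMap Q) (hS : SmoothMap S)
    (hR : SmoothMap R) (hRu : ∀ t, IsUnit (R t)) : SmoothMap P := by
  refine smoothMap_of_hasMatDerivAt hP.2 fun k hk => ?_
  have hRi := hR.inv hRu
  have h1 := contDiff_mul_apply hk (hA.contDiff_nat k)
  have h2 := contDiff_mul_apply (hA.transpose.contDiff_nat k) hk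
  have h3 := contDiff_mul_apply hk (hB.contDiff_nat k)
  have h4 := contDiff_mul_apply (hB.transpose.contDiff_nat k) hk
  have h5 := contDiff_mul_apply (contDiff_mul_apply (F := fun t => P t * B t + S t)
    (fun i j => (h3 i j).add (hS.contDiff_nat k i j)) (hRi.contDiff_nat k))
    (G := fun t => (B t)ᵀ * P t + (S t)ᵀ)
    (fun i j => (h4 i j).add (hS.transpose.contDiff_nat k i j))
  exact fun i j => ((((h1 i j).neg).sub (h2 i j)).add (h5 i j)).sub (hQ.contDiff_nat k i j)

/-- The cost of a trajectory in terms of a solution of the Riccati equation. -/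
theorem IsRiccatiSolution.integral_quadCost {P : ℝ → Matrix ι ι ℝ}
    (hP : IsRiccatiSolution A B Q S R P) (hA : SmoothMap A) (hB : SmoothMap B)
    (hQ : SmoothMap Q) (hS : SmoothMap S) (hR : SmoothMap R) (hRu : ∀ t, IsUnit (R t))
    (hRs : ∀ t, (R t).IsSymm) {t₀ t₁ : ℝ} (h01 : t₀ ≤ t₁) {x : ℝ → ι → ℝ} {u : ℝ → κ → ℝ}
    (h : IsTrajectory A B t₀ t₁ x u) :
    ∫ t in t₀..t₁, quadCost Q S R t (x t) (u t) =
      x t₀ ⬝ᵥ (P t₀ *ᵥ x t₀) - x t₁ ⬝ᵥ (P t₁ *ᵥ x t₁) +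
        ∫ t in t₀..t₁, feedbackCost (riccatiGain B S R P) R t (x t) (u t) := by
  have hPs := hP.smooth hA hB hQ hS hR hRu
  have hK : SmoothMap (riccatiGain B S R P) :=
    (hR.inv hRu).mul (hS.transpose.add (hB.transpose.mul hPs))
  have h1 := h.integral_quadratic h01 hA.continuous hB.continuous hPs
  have h2 := h.intervalIntegrable_quadCost h01 hQ.continuous hS.continuous hR.continuous
  have h3 : IntervalIntegrable (fun t => feedbackCost (riccatiGain B S R P) R t (x t) (u t))
      volume t₀ t₁ := by
    rw [feedbackCost_eq_quadCost hRs]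
    exact h.intervalIntegrable_quadCost h01 ((hK.transpose.mul hR).mul hK).continuous
      (hK.transpose.mul hR).continuous hR.continuous
  have h4 : ∫ t in t₀..t₁, (feedbackCost (riccatiGain B S R P) R t (x t) (u t) -
      quadCost Q S R t (x t) (u t)) =
      x t₁ ⬝ᵥ (P t₁ *ᵥ x t₁) - x t₀ ⬝ᵥ (P t₀ *ᵥ x t₀) := by
    rw [← h1]
    refine intervalIntegral.integral_congr fun t _ => ?_
    simp only [← completing_squares (A := A) (B := B) (Q := Q) (S := S) (hRs t) (hRu t) (hP.1 t),
      (hP.2 t).matDeriv_eq, add_sub_cancel_left]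
  rw [intervalIntegral.integral_sub h3 h2] at h4
  linarith

variable [DecidableEq ι]

/-- Symmetric solutions of the Riccati equation on the whole line are bounded. -/
theorem IsRiccatiSolution.boundedMap {P : ℝ → Matrix ι ι ℝ}
    (hP : IsRiccatiSolution A B Q S R P) (hAB : DynamicsAssumption A B)
    (hc : CostAssumption Q S R) : BoundedMap P := by
  obtain ⟨s, hs, C, hC, hsteer⟩ := hAB.steering
  obtain ⟨q, hq, hQ⟩ := hc.bounded_Q.exists_mulVec_dot_le
  obtain ⟨σ, hσ, hS⟩ := hc.bounded_S.exists_mulVec_dot_le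
  obtain ⟨r, hr, hR⟩ := hc.bounded_R.exists_mulVec_dot_le
  have hA := hAB.smooth_A.continuous
  have hB := hAB.smooth_B.continuous
  set k := (2 + q + σ + r) with hk
  have hk0 : 0 < k := by positivity
  obtain ⟨ρ, hρ, hRp⟩ := hc.posDef_R.exists_dot_le
  have hcost : ∀ t x u, quadCost Q S R t x u ≤ k * (x ⬝ᵥ x + u ⬝ᵥ u) := by
    intro t x u
    have h1 := two_dot_le x (Q t *ᵥ x)
    have h2 := two_dot_le x (S t *ᵥ u)
    have h3 := two_dot_le u (R t *ᵥ u)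
    have h4 := hQ t x
    have h5 := hS t u
    have h6 := hR t u
    have h7 := dot_self_nonneg x
    have h8 := dot_self_nonneg u
    unfold quadCost
    nlinarith [mul_nonneg hq.le h7, mul_nonneg hσ.le h7, mul_nonneg hr.le h7,
      mul_nonneg hq.le h8, mul_nonneg hσ.le h8, mul_nonneg hr.le h8]
  -- The square being nonnegative, the left side is at most the cost of any trajectory from a to b,
  -- and `steering` provides a cheap one. Taking b = 0, then a = 0, bounds the form of P on both
  -- sides.
  have key : ∀ t a b, a ⬝ᵥ (P t *ᵥ a) - b ⬝ᵥ (P (t + s) *ᵥ b) ≤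
      s * (k * (2 * C)) * (a ⬝ᵥ a + b ⬝ᵥ b) := by
    intro t a b
    obtain ⟨y, v, hv, hy, hya, hyb, hbd⟩ := hsteer t a b
    have htr := isTrajectory_of_hasDerivAt hA hB hv hy t (t + s)
    have h1 := hP.integral_quadCost hAB.smooth_A hAB.smooth_B hc.smooth_Q hc.smooth_S
      hc.smooth_R hc.posDef_R.isUnit hc.symm_R (by linarith) htr
    have h2 : 0 ≤ ∫ τ in t..(t + s), feedbackCost (riccatiGain B S R P) R τ (y τ) (v τ) :=
      intervalIntegral.integral_nonneg (by linarith) fun τ _ =>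
        feedbackCost_nonneg (fun w => (mul_nonneg hρ.le (dot_self_nonneg w)).trans (hRp τ w)) _ _
    have h3 : ∫ τ in t..(t + s), quadCost Q S R τ (y τ) (v τ) ≤
        ∫ _τ in t..(t + s), k * (2 * C * (a ⬝ᵥ a + b ⬝ᵥ b)) := by
      refine intervalIntegral.integral_mono_on (by linarith) (htr.intervalIntegrable_quadCost
        (by linarith) hc.smooth_Q.continuous hc.smooth_S.continuous hc.smooth_R.continuous)
        (continuous_const.intervalIntegrable _ _) fun τ hτ => (hcost _ _ _).trans ?_
      obtain ⟨h4, h5⟩ := hbd τ hτ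
      exact mul_le_mul_of_nonneg_left (by linarith) hk0.le
    rw [intervalIntegral.integral_const, add_sub_cancel_left, smul_eq_mul] at h3
    rw [hya, hyb] at h1
    linarith
  refine boundedMap_of_isSymm (C := s * (k * (2 * C))) (by positivity) hP.1 fun t x => ?_
  have h1 := key t x 0
  have h2 := key (t - s) 0 x
  simp only [mulVec_zero, dotProduct_zero, sub_add_cancel, zero_add, add_zero, sub_zero] at h1 h2
  exact abs_le.2 ⟨by linarith, h1⟩

end Costs

/-! ### Comparison of optimal syntheses -/

section Synthesis

variable {ι κ : Type*} [Fintype ι] [Fintype κ]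
  {A : ℝ → Matrix ι ι ℝ} {B : ℝ → Matrix ι κ ℝ}

/-- Costs which differ by a positive factor and a function of the end-points have the same optimal
synthesis. -/
theorem optimalSynthesis_eq {c c' : ℝ → (ι → ℝ) → (κ → ℝ) → ℝ} {μ : ℝ} (hμ : 0 < μ)
    (b : ℝ → (ι → ℝ) → ℝ)
    (h : ∀ t₀ t₁ x u, t₀ ≤ t₁ → IsTrajectory A B t₀ t₁ x u →
      ∫ t in t₀..t₁, c' t (x t) (u t) =
        b t₀ (x t₀) - b t₁ (x t₁) + μ * ∫ t in t₀..t₁, c t (x t) (u t)) :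
    optimalSynthesis A B c = optimalSynthesis A B c' := by
  ext ⟨t₀, t₁, x⟩
  refine and_congr_right fun h01 => exists_congr fun u => and_congr_right fun hx =>
    forall_congr' fun y => forall_congr' fun v => ?_
  refine forall_congr' fun hy => forall_congr' fun h0 => forall_congr' fun h1 => ?_
  have h2 := h t₀ t₁ x u (le_of_lt h01) hx
  have h3 := h t₀ t₁ y v (le_of_lt h01) hy
  simp only at h0 h1 ⊢
  rw [h2, h3, h0, h1, add_le_add_iff_left, mul_le_mul_iff_right₀ hμ]

end Synthesis

/-! ### First order necessary conditions -/

section Adjoint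

variable {ι : Type*} [Fintype ι] [DecidableEq ι] {F : ℝ → Matrix ι ι ℝ}
  {Φ : ℝ → ℝ → Matrix ι ι ℝ}

theorem IsTransitionMatrix.adjoint (h : IsTransitionMatrix F Φ) (hF : Continuous F) :
    IsTransitionMatrix (fun t => -(F t)ᵀ) (fun t τ => (Φ τ t)ᵀ) := fun τ =>
  ⟨by simp only [h.self, transpose_one], fun t =>
    (h.hasMatDerivAt_right hF t τ).transpose.congr_deriv (by simp)⟩

/-- Variation of constants: the solution with source f starting from 0 at t₀. -/
theorem IsTransitionMatrix.hasDerivAt_duhamel (h : IsTransitionMatrix F Φ) (hF : Continuous F)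
    {f : ℝ → ι → ℝ} (hf : Continuous f) (t₀ t : ℝ) :
    HasDerivAt (fun t => Φ t t₀ *ᵥ ∫ s in t₀..t, Φ t₀ s *ᵥ f s)
      (F t *ᵥ (Φ t t₀ *ᵥ ∫ s in t₀..t, Φ t₀ s *ᵥ f s) + f t) t := by
  have h1 := (((h.continuous_right hF t₀).matrix_mulVec hf).integral_hasStrictDerivAt t₀ t).hasDerivAt
  refine ((h.hasMatDerivAt t t₀).mulVec h1).congr_deriv ?_
  rw [mulVec_mulVec, mulVec_mulVec, h.mul_self hF, one_mulVec]

end Adjoint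

/-! ### First variation and the maximum principle -/

section FirstVariation

variable {ι κ : Type*} [Fintype ι] [Fintype κ]
  {A : ℝ → Matrix ι ι ℝ} {B : ℝ → Matrix ι κ ℝ}
  {Q : ℝ → Matrix ι ι ℝ} {S : ℝ → Matrix ι κ ℝ} {R : ℝ → Matrix κ κ ℝ}

/-- The curve determines its velocity almost everywhere, and injectivity of B then determines the
control. This matters because the synthesis records curves, not controls. -/
theorem IsTrajectory.control_unique {t₀ t₁ : ℝ} {x : ℝ → ι → ℝ} {u v : ℝ → κ → ℝ}
    (hu : IsTrajectory A B t₀ t₁ x u) (hv : IsTrajectory A B t₀ t₁ x v) (h01 : t₀ ≤ t₁)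
    (hA : Continuous A) (hB : Continuous B)
    (hinj : ∀ t, Function.Injective (fun v : κ → ℝ => B t *ᵥ v)) :
    ∀ᵐ t, t ∈ Set.uIoc t₀ t₁ → u t = v t := by
  have hgi : ∀ {w : ℝ → κ → ℝ}, IsTrajectory A B t₀ t₁ x w →
      ∀ᵐ t, ∀ i, t ∈ Set.uIcc t₀ t₁ → ∀ c ∈ Set.uIcc t₀ t₁,
        HasDerivAt (fun r => ∫ s in c..r, (A s *ᵥ x s + B s *ᵥ w s) i)
          ((A t *ᵥ x t + B t *ᵥ w t) i) t := fun hw =>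
    ae_all_iff.2 fun i => IntervalIntegrable.ae_hasDerivAt_integral
      ⟨(hw.intervalIntegrable_velocity h01 hA hB).1.eval i,
        (hw.intervalIntegrable_velocity h01 hA hB).2.eval i⟩
  -- At t₁ the two primitives are only known to agree on one side, so this point is discarded.
  have hne : ∀ᵐ t : ℝ, t ≠ t₁ := by simp [ae_iff, measure_singleton]
  filter_upwards [hgi hu, hgi hv, hne] with t h1 h2 h3 ht
  have hm := Set.uIoc_subset_uIcc ht
  rw [Set.uIoc_of_le h01] at ht
  have h4 : A t *ᵥ x t + B t *ᵥ u t = A t *ᵥ x t + B t *ᵥ v t := by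
    ext i
    refine (h1 i hm t₀ Set.left_mem_uIcc).unique
      ((h2 i hm t₀ Set.left_mem_uIcc).congr_of_eventuallyEq ?_)
    filter_upwards [Icc_mem_nhds ht.1 (ht.2.lt_of_ne h3)] with r hr
    have h5 := hu.apply_eq h01 hA hB hr i
    have h6 := hv.apply_eq h01 hA hB hr i
    linarith
  exact hinj t (add_left_cancel h4)

theorem isMinimizer_of_mem_optimalSynthesis {t₀ t₁ : ℝ} {x : ℝ → ι → ℝ} {u : ℝ → κ → ℝ}
    {c : ℝ → (ι → ℝ) → (κ → ℝ) → ℝ}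
    (hA : Continuous A) (hB : Continuous B)
    (hinj : ∀ t, Function.Injective (fun v : κ → ℝ => B t *ᵥ v))
    (hu : IsTrajectory A B t₀ t₁ x u) (h : (t₀, t₁, x) ∈ optimalSynthesis A B c) :
    IsMinimizer A B c t₀ t₁ x u := by
  obtain ⟨h01, v, hv, hmin⟩ := h
  refine ⟨hu, fun y w hy h0 h1 => ?_⟩
  refine le_of_eq_of_le (intervalIntegral.integral_congr_ae ?_) (hmin y w hy h0 h1)
  filter_upwards [hu.control_unique hv (le_of_lt h01) hA hB hinj] with t ht hm
  simp only [ht hm]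

theorem quadCost_add_smul {t : ℝ} (hQ : (Q t).IsSymm) (hR : (R t).IsSymm) (x y : ι → ℝ)
    (u v : κ → ℝ) (ε : ℝ) :
    quadCost Q S R t (x + ε • y) (u + ε • v) = quadCost Q S R t x u +
      2 * ε * (y ⬝ᵥ (Q t *ᵥ x + S t *ᵥ u) + v ⬝ᵥ ((S t)ᵀ *ᵥ x + R t *ᵥ u)) +
      ε ^ 2 * quadCost Q S R t y v := by
  have h1 : x ⬝ᵥ (Q t *ᵥ y) = y ⬝ᵥ (Q t *ᵥ x) := by
    rw [dot_mulVec_comm, hQ.eq, dotProduct_comm]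
  have h2 : u ⬝ᵥ (R t *ᵥ v) = v ⬝ᵥ (R t *ᵥ u) := by
    rw [dot_mulVec_comm, hR.eq, dotProduct_comm]
  have h3 : v ⬝ᵥ ((S t)ᵀ *ᵥ x) = x ⬝ᵥ (S t *ᵥ v) := by
    rw [dot_mulVec_comm, transpose_transpose, dotProduct_comm]
  simp only [quadCost, mulVec_add, mulVec_smul, add_dotProduct, dotProduct_add, smul_dotProduct,
    dotProduct_smul, smul_eq_mul, h1, h2, h3]
  ring

/-- Minimality along x + εy gives 0 ≤ 2εb + ε²a for every ε, b being the integral and a the cost of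
the variation; this forces b = 0. -/
theorem IsMinimizer.first_variation {t₀ t₁ : ℝ} {x : ℝ → ι → ℝ} {u : ℝ → κ → ℝ}
    (h : IsMinimizer A B (quadCost Q S R) t₀ t₁ x u)
    (hA : Continuous A) (hB : Continuous B)
    (hQ : Continuous Q) (hS : Continuous S) (hR : Continuous R)
    (hQs : ∀ t, (Q t).IsSymm) (hRs : ∀ t, (R t).IsSymm) (hu : Continuous u)
    (hx : ∀ t, HasDerivAt x (A t *ᵥ x t + B t *ᵥ u t) t) {y : ℝ → ι → ℝ} {v : ℝ → κ → ℝ}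
    (hv : Continuous v) (hy : ∀ t, HasDerivAt y (A t *ᵥ y t + B t *ᵥ v t) t)
    (hy0 : y t₀ = 0) (hy1 : y t₁ = 0) :
    ∫ t in t₀..t₁, (y t ⬝ᵥ (Q t *ᵥ x t + S t *ᵥ u t) +
      v t ⬝ᵥ ((S t)ᵀ *ᵥ x t + R t *ᵥ u t)) = 0 := by
  have hxc : Continuous x := continuous_iff_continuousAt.2 fun t => (hx t).continuousAt
  have hyc : Continuous y := continuous_iff_continuousAt.2 fun t => (hy t).continuousAt
  have hcq : ∀ {x : ℝ → ι → ℝ} {u : ℝ → κ → ℝ}, Continuous x → Continuous u →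
      Continuous fun t => quadCost Q S R t (x t) (u t) := by
    intro x u hx hu
    exact ((hx.dotProduct (hQ.matrix_mulVec hx)).add
      (continuous_const.mul (hx.dotProduct (hS.matrix_mulVec hu)))).add
      (hu.dotProduct (hR.matrix_mulVec hu))
  have hcb : Continuous fun t => y t ⬝ᵥ (Q t *ᵥ x t + S t *ᵥ u t) +
      v t ⬝ᵥ ((S t)ᵀ *ᵥ x t + R t *ᵥ u t) :=
    (hyc.dotProduct ((hQ.matrix_mulVec hxc).add (hS.matrix_mulVec hu))).add
      (hv.dotProduct ((hS.matrix_transpose.matrix_mulVec hxc).add (hR.matrix_mulVec hu)))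
  set b := ∫ t in t₀..t₁, (y t ⬝ᵥ (Q t *ᵥ x t + S t *ᵥ u t) +
      v t ⬝ᵥ ((S t)ᵀ *ᵥ x t + R t *ᵥ u t)) with hb
  set a := ∫ t in t₀..t₁, quadCost Q S R t (y t) (v t) with ha
  have key : ∀ ε : ℝ, 0 ≤ 2 * ε * b + ε ^ 2 * a := by
    intro ε
    have htr : IsTrajectory A B t₀ t₁ (fun t => x t + ε • y t) (fun t => u t + ε • v t) := by
      refine isTrajectory_of_hasDerivAt hA hB
        (hu.add (hv.const_smul ε) : Continuous fun t => u t + ε • v t) (fun t => ?_) t₀ t₁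
      refine ((hx t).add ((hy t).const_smul ε)).congr_deriv ?_
      simp only [Pi.add_apply, mulVec_add, mulVec_smul, smul_add]
      abel
    have h1 := h.2 _ _ htr (by simp [hy0]) (by simp [hy1])
    simp only [quadCost_add_smul (hQs _) (hRs _)] at h1
    have h2 : Continuous fun t => quadCost Q S R t (x t) (u t) +
        2 * ε * (y t ⬝ᵥ (Q t *ᵥ x t + S t *ᵥ u t) + v t ⬝ᵥ ((S t)ᵀ *ᵥ x t + R t *ᵥ u t)) :=
      (hcq hxc hu).add (hcb.const_mul _)
    rw [intervalIntegral.integral_add (h2.intervalIntegrable _ _)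
      (((hcq hyc hv).const_mul _).intervalIntegrable _ _),
      intervalIntegral.integral_add ((hcq hxc hu).intervalIntegrable _ _)
      ((hcb.const_mul _).intervalIntegrable _ _), intervalIntegral.integral_const_mul,
      intervalIntegral.integral_const_mul] at h1
    linarith
  by_contra hb0
  have h1 : 0 < b ^ 2 := by positivity
  -- A step opposite to b, short enough for the linear term to dominate; the + 1 avoids dividing by
  -- zero.
  have h2 := key (-b / (|a| + 1))
  have h3 : 0 < |a| + 1 := by positivity
  have h4 : 2 * (-b / (|a| + 1)) * b + (-b / (|a| + 1)) ^ 2 * a =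
      b ^ 2 / (|a| + 1) ^ 2 * (a - 2 * (|a| + 1)) := by
    field_simp
    ring
  rw [h4] at h2
  have h5 : a - 2 * (|a| + 1) < 0 := by linarith [le_abs_self a, abs_nonneg a]
  have h6 : 0 < b ^ 2 / (|a| + 1) ^ 2 := by positivity
  nlinarith

variable [DecidableEq ι] [DecidableEq κ]

/-- The Pontryagin maximum principle on an interval which is long enough. -/
theorem DynamicsAssumption.exists_adjoint_on (hAB : DynamicsAssumption A B)
    (hc : CostAssumption Q S R) :
    ∃ s > (0 : ℝ), ∀ {x : ℝ → ι → ℝ} {u : ℝ → κ → ℝ}, Continuous u →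
      (∀ t, HasDerivAt x (A t *ᵥ x t + B t *ᵥ u t) t) →
      ∀ t₀ t₁, t₀ + s ≤ t₁ → (t₀, t₁, x) ∈ optimalSynthesis A B (quadCost Q S R) →
      ∃ p : ℝ → ι → ℝ, (∀ t, HasDerivAt p (-(A t)ᵀ *ᵥ p t + -(Q t *ᵥ x t + S t *ᵥ u t)) t) ∧
        ∀ t ∈ Set.Icc t₀ t₁, (B t)ᵀ *ᵥ p t + ((S t)ᵀ *ᵥ x t + R t *ᵥ u t) = 0 := by
  obtain ⟨Φ, hΦ, s, hs, β, hβ, hW⟩ := hAB.gramian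
  refine ⟨s, hs, fun {x u} hu hx t₀ t₁ h01 hmem => ?_⟩
  have hA := hAB.smooth_A.continuous
  have hB := hAB.smooth_B.continuous
  have hQ := hc.smooth_Q.continuous
  have hS := hc.smooth_S.continuous
  have hR := hc.smooth_R.continuous
  have hxc : Continuous x := continuous_iff_continuousAt.2 fun t => (hx t).continuousAt
  have hle : t₀ ≤ t₁ := by linarith
  have hmin := isMinimizer_of_mem_optimalSynthesis hA hB hAB.injective_B
    (isTrajectory_of_hasDerivAt hA hB hu hx t₀ t₁) hmem
  set f : ℝ → ι → ℝ := fun t => -(Q t *ᵥ x t + S t *ᵥ u t) with hf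
  have hfc : Continuous f := ((hQ.matrix_mulVec hxc).add (hS.matrix_mulVec hu)).neg
  have hAt : Continuous fun t => -(A t)ᵀ := hA.matrix_transpose.neg
  -- The solution of the adjoint equation that vanishes at t₀. The multiplier sought differs from it
  -- by a solution q of the homogeneous equation.
  set p : ℝ → ι → ℝ := fun t => (Φ t₀ t)ᵀ *ᵥ ∫ s in t₀..t, (Φ s t₀)ᵀ *ᵥ f s with hp
  have hpd : ∀ t, HasDerivAt p (-(A t)ᵀ *ᵥ p t + f t) t := fun t =>
    (hΦ.adjoint hA).hasDerivAt_duhamel hAt hfc t₀ t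
  have hpc : Continuous p := continuous_iff_continuousAt.2 fun t => (hpd t).continuousAt
  set w : ℝ → κ → ℝ := fun t => (B t)ᵀ *ᵥ p t + ((S t)ᵀ *ᵥ x t + R t *ᵥ u t) with hw
  have hwc : Continuous w := (hB.matrix_transpose.matrix_mulVec hpc).add
    ((hS.matrix_transpose.matrix_mulVec hxc).add (hR.matrix_mulVec hu))
  set G : ℝ → Matrix ι ι ℝ := fun τ => Φ t₀ τ * B τ * (B τ)ᵀ * (Φ t₀ τ)ᵀ with hG
  have hGc : Continuous G := hAB.continuous_gram hΦ t₀
  set W : Matrix ι ι ℝ := Matrix.of fun i j => ∫ τ in t₀..t₁, G τ i j with hWdef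
  have hWpos : ∀ z, β * (z ⬝ᵥ z) ≤ z ⬝ᵥ (W *ᵥ z) := by
    intro z
    refine (hW t₀ z).trans ?_
    rw [dot_integral_mulVec hGc, dot_integral_mulVec hGc]
    refine intervalIntegral.integral_mono_interval le_rfl (by linarith) h01
      (Filter.Eventually.of_forall fun τ => ?_)
      ((continuous_const.dotProduct (hGc.matrix_mulVec continuous_const)).intervalIntegrable _ _)
    simp only [hG, dot_gram, Pi.zero_apply]
    exact dot_self_nonneg _
  have hBw : Continuous fun τ => Φ t₀ τ *ᵥ (B τ *ᵥ w τ) :=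
    (hΦ.continuous_right hA t₀).matrix_mulVec (hB.matrix_mulVec hwc)
  -- With this η, the control v = w - Bᵀq is the part of w orthogonal to all the outputs
  -- BᵀΦ(t₀,τ)ᵀz. It therefore steers 0 to 0 and is an admissible variation.
  set η := W⁻¹ *ᵥ ∫ τ in t₀..t₁, Φ t₀ τ *ᵥ (B τ *ᵥ w τ) with hη
  have hWη : W *ᵥ η = ∫ τ in t₀..t₁, Φ t₀ τ *ᵥ (B τ *ᵥ w τ) := by
    rw [hη, mulVec_mulVec, mul_nonsing_inv _
      ((Matrix.isUnit_iff_isUnit_det _).1 (isUnit_of_dot_le hβ hWpos)), one_mulVec]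
  set q : ℝ → ι → ℝ := fun τ => (Φ t₀ τ)ᵀ *ᵥ η with hq
  have hqd : ∀ τ, HasDerivAt q (-(A τ)ᵀ *ᵥ q τ) τ := fun τ =>
    hΦ.hasDerivAt_transpose_mulVec hA _ _ _
  have hqc : Continuous q := continuous_iff_continuousAt.2 fun τ => (hqd τ).continuousAt
  set v : ℝ → κ → ℝ := fun τ => w τ - (B τ)ᵀ *ᵥ q τ with hv
  have hvc : Continuous v := hwc.sub (hB.matrix_transpose.matrix_mulVec hqc)
  set y : ℝ → ι → ℝ := fun t => Φ t t₀ *ᵥ ∫ τ in t₀..t, Φ t₀ τ *ᵥ (B τ *ᵥ v τ) with hy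
  have hyd : ∀ t, HasDerivAt y (A t *ᵥ y t + B t *ᵥ v t) t := fun t =>
    hΦ.hasDerivAt_duhamel hA (hB.matrix_mulVec hvc) t₀ t
  have hyc : Continuous y := continuous_iff_continuousAt.2 fun t => (hyd t).continuousAt
  have hy0 : y t₀ = 0 := by simp [hy]
  have hy1 : y t₁ = 0 := by
    have h1 : ∀ z, z ⬝ᵥ ∫ τ in t₀..t₁, Φ t₀ τ *ᵥ (B τ *ᵥ v τ) = 0 := by
      have hdot : ∀ (z : ι → ℝ) {g : ℝ → ι → ℝ}, Continuous g →
          z ⬝ᵥ ∫ τ in t₀..t₁, g τ = ∫ τ in t₀..t₁, z ⬝ᵥ g τ := by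
        intro z g hg
        have := ((LinearMap.toContinuousLinearMap
          (dotProductBilin ℝ ℝ z)).intervalIntegral_comp_comm
            (hg.intervalIntegrable (μ := volume) t₀ t₁)).symm
        simpa using this
      intro z
      have h2 := dot_integral_mulVec hGc t₀ t₁ z η
      rw [← hWdef, hWη, hdot z hBw] at h2
      have hGη : Continuous fun τ => z ⬝ᵥ (G τ *ᵥ η) :=
        continuous_const.dotProduct (hGc.matrix_mulVec continuous_const)
      rw [hdot z ((hΦ.continuous_right hA t₀).matrix_mulVec (hB.matrix_mulVec hvc)),
        ← sub_eq_zero.2 h2, ← intervalIntegral.integral_sub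
          ((continuous_const.dotProduct hBw).intervalIntegrable _ _)
          (hGη.intervalIntegrable _ _)]
      refine intervalIntegral.integral_congr fun τ _ => ?_
      simp only [hv, hq, hG, mulVec_sub, dotProduct_sub, mulVec_mulVec, Matrix.mul_assoc]
    have h2 := h1 (∫ τ in t₀..t₁, Φ t₀ τ *ᵥ (B τ *ᵥ v τ))
    rw [dotProduct_self_eq_zero] at h2
    simp only [hy, h2, mulVec_zero]
  have hvar := hmin.first_variation hA hB hQ hS hR hc.symm_Q hc.symm_R hu hx hvc hyd hy0 hy1
  -- Both `p` and `q` pair with the variation through their derivatives.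
  have hpair : ∫ t in t₀..t₁, (-(y t ⬝ᵥ (Q t *ᵥ x t + S t *ᵥ u t)) + v t ⬝ᵥ ((B t)ᵀ *ᵥ p t) -
      v t ⬝ᵥ ((B t)ᵀ *ᵥ q t)) = 0 := by
    have hd : ∀ t ∈ Set.uIcc t₀ t₁, HasDerivAt (fun t => (p t - q t) ⬝ᵥ y t)
        (-(y t ⬝ᵥ (Q t *ᵥ x t + S t *ᵥ u t)) + v t ⬝ᵥ ((B t)ᵀ *ᵥ p t) -
          v t ⬝ᵥ ((B t)ᵀ *ᵥ q t)) t := by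
      intro t _
      refine (hasDerivAt_dotProduct ((hpd t).fun_sub (hqd t)) (hyd t)).congr_deriv ?_
      have h1 : ∀ r, (-(A t)ᵀ *ᵥ r) ⬝ᵥ y t = -(r ⬝ᵥ (A t *ᵥ y t)) := fun r => by
        rw [dot_mulVec_comm (A t) r, neg_mulVec, neg_dotProduct]
      have h2 : ∀ r, r ⬝ᵥ (B t *ᵥ v t) = v t ⬝ᵥ ((B t)ᵀ *ᵥ r) := fun r => by
        rw [dot_mulVec_comm (B t) r, dotProduct_comm]
      simp only [sub_dotProduct, add_dotProduct, dotProduct_add, h1, h2, hf, neg_dotProduct,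
        mulVec_sub, dotProduct_sub,
        dotProduct_comm (y t)]
      ring
    rw [intervalIntegral.integral_eq_sub_of_hasDerivAt hd, hy0, hy1]
    · simp
    · refine Continuous.intervalIntegrable ?_ _ _
      exact (((hyc.dotProduct ((hQ.matrix_mulVec hxc).add (hS.matrix_mulVec hu))).neg.add
        (hvc.dotProduct (hB.matrix_transpose.matrix_mulVec hpc))).sub
        (hvc.dotProduct (hB.matrix_transpose.matrix_mulVec hqc)))
  -- Adding the first variation and the pairing cancels the terms in y and leaves v paired with w -
  -- Bᵀq, which is v itself.
  have hvv : ∫ t in t₀..t₁, v t ⬝ᵥ v t = 0 := by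
    have h1 := congrArg₂ (· + ·) hvar hpair
    simp only [add_zero] at h1
    rw [← intervalIntegral.integral_add] at h1
    · rw [← h1]
      refine intervalIntegral.integral_congr fun t _ => ?_
      have h2 : v t ⬝ᵥ v t = v t ⬝ᵥ (w t - (B t)ᵀ *ᵥ q t) := rfl
      simp only [h2, hw, dotProduct_sub, dotProduct_add]
      ring
    · refine Continuous.intervalIntegrable ?_ _ _
      exact (hyc.dotProduct ((hQ.matrix_mulVec hxc).add (hS.matrix_mulVec hu))).add
        (hvc.dotProduct ((hS.matrix_transpose.matrix_mulVec hxc).add (hR.matrix_mulVec hu)))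
    · refine Continuous.intervalIntegrable ?_ _ _
      exact (((hyc.dotProduct ((hQ.matrix_mulVec hxc).add (hS.matrix_mulVec hu))).neg.add
        (hvc.dotProduct (hB.matrix_transpose.matrix_mulVec hpc))).sub
        (hvc.dotProduct (hB.matrix_transpose.matrix_mulVec hqc)))
  have hv0 : ∀ t ∈ Set.Icc t₀ t₁, v t = 0 := by
    intro t ht
    by_contra hne
    have hpos : 0 < v t ⬝ᵥ v t := (dot_self_nonneg _).lt_of_ne fun h0 =>
      hne (dotProduct_self_eq_zero.1 h0.symm)
    have := intervalIntegral.integral_pos (by linarith : t₀ < t₁)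
      (hvc.dotProduct hvc).continuousOn (fun t _ => dot_self_nonneg _) ⟨t, ht, hpos⟩
    exact this.ne' hvv
  refine ⟨fun t => p t - q t, fun t => ?_, fun t ht => ?_⟩
  · refine ((hpd t).fun_sub (hqd t)).congr_deriv ?_
    simp only [hf, mulVec_sub]
    abel
  · have h1 := hv0 t ht
    simp only [hv, hw] at h1
    rw [mulVec_sub, ← h1]
    abel

end FirstVariation

/-! ### From optimal trajectories to the Riccati equation -/

section RiccatiOfSynthesis

variable {ι κ : Type*} [Fintype ι] [Fintype κ] [DecidableEq ι] [DecidableEq κ]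
  {A : ℝ → Matrix ι ι ℝ} {B : ℝ → Matrix ι κ ℝ}
  {Q : ℝ → Matrix ι ι ℝ} {S : ℝ → Matrix ι κ ℝ} {R : ℝ → Matrix κ κ ℝ}

/-- The Pontryagin maximum principle on the whole line. -/
theorem DynamicsAssumption.exists_adjoint (hAB : DynamicsAssumption A B)
    (hc : CostAssumption Q S R) {x : ℝ → ι → ℝ} {u : ℝ → κ → ℝ} (hu : Continuous u)
    (hx : ∀ t, HasDerivAt x (A t *ᵥ x t + B t *ᵥ u t) t)
    (hmem : ∀ t₀ t₁, t₀ < t₁ → (t₀, t₁, x) ∈ optimalSynthesis A B (quadCost Q S R)) :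
    ∃ p : ℝ → ι → ℝ, (∀ t, HasDerivAt p (-(A t)ᵀ *ᵥ p t + -(Q t *ᵥ x t + S t *ᵥ u t)) t) ∧
      ∀ t, (B t)ᵀ *ᵥ p t + ((S t)ᵀ *ᵥ x t + R t *ᵥ u t) = 0 := by
  obtain ⟨s, hs, hpmp⟩ := hAB.exists_adjoint_on hc
  obtain ⟨r, hr, C, hC, hobs⟩ := hAB.observability
  have hex : ∀ k : ℝ, 0 ≤ k → ∃ p : ℝ → ι → ℝ,
      (∀ t, HasDerivAt p (-(A t)ᵀ *ᵥ p t + -(Q t *ᵥ x t + S t *ᵥ u t)) t) ∧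
        ∀ t ∈ Set.Icc (-(s + r + k)) (s + r + k),
          (B t)ᵀ *ᵥ p t + ((S t)ᵀ *ᵥ x t + R t *ᵥ u t) = 0 := fun k hk =>
    hpmp hu hx _ _ (by linarith) (hmem _ _ (by linarith))
  choose p hp hpw using fun k : {k : ℝ // 0 ≤ k} => hex k.1 k.2
  -- Multipliers of two intervals have the same output Bᵀp on [0, r], so observability makes them
  -- equal at 0, hence everywhere. The intervals are chosen to contain [0, r].
  have huniq : ∀ k l, p k = p l := by
    intro k l
    have hd : ∀ t, HasDerivAt (fun t => p k t - p l t) (-(A t)ᵀ *ᵥ (p k t - p l t)) t := by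
      intro t
      refine ((hp k t).fun_sub (hp l t)).congr_deriv ?_
      rw [mulVec_sub]
      abel
    have h1 := hobs (fun t => p k t - p l t) (fun _ => 0) 0 continuous_const
      (by simpa using hd)
    have h2 : ∫ τ in (0 : ℝ)..(0 + r), (((B τ)ᵀ *ᵥ (p k τ - p l τ)) ⬝ᵥ
        ((B τ)ᵀ *ᵥ (p k τ - p l τ)) + (0 : ι → ℝ) ⬝ᵥ 0) = ∫ _τ in (0 : ℝ)..(0 + r), (0 : ℝ) := by
      refine intervalIntegral.integral_congr fun τ hτ => ?_
      rw [Set.uIcc_of_le (by linarith)] at hτ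
      have h3 := hpw k τ ⟨by linarith [hτ.1, k.2], by linarith [hτ.2, k.2]⟩
      have h4 := hpw l τ ⟨by linarith [hτ.1, l.2], by linarith [hτ.2, l.2]⟩
      have h5 : (B τ)ᵀ *ᵥ (p k τ - p l τ) = 0 := by
        rw [mulVec_sub, sub_eq_zero]
        exact add_right_cancel (h3.trans h4.symm)
      simp [h5]
    rw [h2, intervalIntegral.integral_zero, mul_zero] at h1
    have h6 : p k 0 - p l 0 = 0 :=
      dotProduct_self_eq_zero.1 (le_antisymm h1 (dot_self_nonneg _))
    have h7 := linear_unique (N := fun t => -(A t)ᵀ)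
      hAB.smooth_A.continuous.matrix_transpose.neg hd
      (y := fun _ => 0) (fun t => by simpa using hasDerivAt_const t (0 : ι → ℝ)) 0 h6
    funext t
    exact sub_eq_zero.1 (congrFun h7 t)
  refine ⟨p ⟨0, le_rfl⟩, hp _, fun t => ?_⟩
  rw [huniq _ ⟨|t|, abs_nonneg t⟩]
  exact hpw _ t ⟨by linarith [neg_abs_le t], by linarith [le_abs_self t]⟩

/-- The synthesis alone determines Riccati solutions: the multipliers Y of a fundamental matrix X of
optimal solutions give P = Y X⁻¹, and the stationarity condition makes its gain equal to L. The
filter `l` is +∞ for the stable closed loop and -∞ for the anti-stable one. -/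
theorem exists_riccati_of_optimalSynthesis (hAB : DynamicsAssumption A B)
    (hc : CostAssumption Q S R) {L : ℝ → Matrix κ ι ℝ} (hL : Continuous L) (hLb : BoundedMap L)
    {Φ : ℝ → ℝ → Matrix ι ι ℝ} (hΦ : IsTransitionMatrix (fun t => A t - B t * L t) Φ)
    {l : Filter ℝ} [l.NeBot] (hlim : ∀ i j, Filter.Tendsto (fun t => Φ t 0 i j) l (nhds 0))
    (hmem : ∀ v t₀ t₁, t₀ < t₁ →
      (t₀, t₁, fun t => Φ t 0 *ᵥ v) ∈ optimalSynthesis A B (quadCost Q S R)) :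
    ∃ P, IsRiccatiSolution A B Q S R P ∧ (fun t => A t - B t * L t) = closedLoop A B S R P := by
  have hA := hAB.smooth_A.continuous
  have hB := hAB.smooth_B.continuous
  have hQ := hc.smooth_Q.continuous
  have hS := hc.smooth_S.continuous
  have hR := hc.smooth_R.continuous
  have hF : Continuous fun t => A t - B t * L t := hA.sub (hB.matrix_mul hL)
  have hFb : BoundedMap fun t => A t - B t * L t := hAB.bounded_A.sub (hAB.bounded_B.mul hLb)
  set X : ℝ → Matrix ι ι ℝ := fun t => Φ t 0 with hX
  have hXd : ∀ t, HasMatDerivAt X ((A t - B t * L t) * X t) t := fun t => hΦ.hasMatDerivAt t 0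
  have hXc : Continuous X := hΦ.continuous_left 0
  have hex : ∀ j : ι, ∃ p : ℝ → ι → ℝ, (∀ t, HasDerivAt p
      (-(A t)ᵀ *ᵥ p t + -(Q t *ᵥ (X t *ᵥ Pi.single j 1) +
        S t *ᵥ (-(L t *ᵥ (X t *ᵥ Pi.single j 1))))) t) ∧
      ∀ t, (B t)ᵀ *ᵥ p t + ((S t)ᵀ *ᵥ (X t *ᵥ Pi.single j 1) +
        R t *ᵥ (-(L t *ᵥ (X t *ᵥ Pi.single j 1)))) = 0 := by
    intro j
    refine hAB.exists_adjoint hc (x := fun t => X t *ᵥ Pi.single j 1)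
      (u := fun t => -(L t *ᵥ (X t *ᵥ Pi.single j 1)))
      (hL.matrix_mulVec (hXc.matrix_mulVec continuous_const)).neg (fun t => ?_)
      (hmem (Pi.single j 1))
    refine (hΦ.hasDerivAt_mulVec (Pi.single j 1) t 0).congr_deriv ?_
    simp only [sub_mulVec, mulVec_neg, ← mulVec_mulVec, hX]
    abel
  choose p hp hpw using hex
  set Y : ℝ → Matrix ι ι ℝ := fun t => Matrix.of fun i j => p j t i with hY
  have hYcol : ∀ t j, p j t = Y t *ᵥ Pi.single j 1 := fun t j => by ext i; simp [hY]
  have hYd : ∀ t, HasMatDerivAt Y (-(A t)ᵀ * Y t - (Q t - S t * L t) * X t) t := by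
    intro t i j
    refine ((hasDerivAt_pi.1 (hp j t)) i).congr_deriv ?_
    have : -(A t)ᵀ *ᵥ p j t + -(Q t *ᵥ (X t *ᵥ Pi.single j 1) +
        S t *ᵥ (-(L t *ᵥ (X t *ᵥ Pi.single j 1)))) =
        (-(A t)ᵀ * Y t - (Q t - S t * L t) * X t) *ᵥ Pi.single j 1 := by
      simp only [hYcol, sub_mulVec, mulVec_neg, ← mulVec_mulVec]
      abel
    rw [this]
    simp
  have hYw : ∀ t, (B t)ᵀ * Y t = (R t * L t - (S t)ᵀ) * X t := by
    intro t
    ext i j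
    have h1 := hpw j t
    rw [hYcol] at h1
    have h2 : (B t)ᵀ *ᵥ Y t *ᵥ Pi.single j 1 + ((S t)ᵀ *ᵥ X t *ᵥ Pi.single j 1 +
        R t *ᵥ -(L t *ᵥ X t *ᵥ Pi.single j 1)) =
        ((B t)ᵀ * Y t - (R t * L t - (S t)ᵀ) * X t) *ᵥ Pi.single j 1 := by
      simp only [sub_mulVec, mulVec_neg, ← mulVec_mulVec]
      abel
    rw [h2] at h1
    have h3 := congrFun h1 i
    simp only [mulVec_single_one, Pi.zero_apply] at h3
    exact sub_eq_zero.1 h3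
  set P : ℝ → Matrix ι ι ℝ := fun t => Y t * Φ 0 t with hP
  have hPX : ∀ t, P t * X t = Y t := fun t => by
    simp only [hP, hX]
    rw [Matrix.mul_assoc, hΦ.mul_self hF, Matrix.mul_one]
  have hPw : ∀ t, (B t)ᵀ * P t = R t * L t - (S t)ᵀ := fun t => by
    simp only [hP]
    rw [← Matrix.mul_assoc, hYw, Matrix.mul_assoc]
    simp only [hX]
    rw [hΦ.mul_self hF, Matrix.mul_one]
  have hPd : ∀ t, HasMatDerivAt P
      (-(A t)ᵀ * P t - (Q t - S t * L t) - P t * (A t - B t * L t)) t := by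
    intro t
    refine ((hYd t).mul (hΦ.hasMatDerivAt_right hF t 0)).congr_deriv ?_
    simp only [hP]
    rw [sub_mul, Matrix.mul_assoc (Q t - S t * L t), show X t * Φ 0 t = 1 from hΦ.mul_self hF t 0]
    simp only [Matrix.mul_neg, Matrix.mul_one, Matrix.mul_assoc, ← sub_eq_add_neg]
  -- boundedness
  have hPb : BoundedMap P := by
    obtain ⟨s, hs, C, hC, hobs⟩ := hAB.observability
    obtain ⟨c, hc0, hgrow⟩ := exists_growth hFb
    obtain ⟨a, ha, h1⟩ :=
      (hc.bounded_Q.sub (hc.bounded_S.mul hLb)).exists_mulVec_dot_le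
    obtain ⟨b, hb, h2⟩ :=
      ((hc.bounded_R.mul hLb).sub hc.bounded_S.transpose).exists_mulVec_dot_le
    refine boundedMap_of_mulVec_dot_le (C := C * (s * ((a + b) * Real.exp (c * s))))
      fun t v => ?_
    -- Along z, the vector Pz solves the adjoint equation with a source, and stationarity gives BᵀPz
    -- = (RL - Sᵀ)z. Observability thus bounds P(t)v by quantities controlled by |v|.
    set z : ℝ → ι → ℝ := fun τ => Φ τ t *ᵥ v with hz
    have hzd : ∀ τ, HasDerivAt z ((A τ - B τ * L τ) *ᵥ z τ) τ := fun τ =>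
      hΦ.hasDerivAt_mulVec v τ t
    have hzc : Continuous z := continuous_iff_continuousAt.2 fun τ => (hzd τ).continuousAt
    have hq : ∀ τ, HasDerivAt (fun τ => P τ *ᵥ z τ)
        (-(A τ)ᵀ *ᵥ (P τ *ᵥ z τ) + -((Q τ - S τ * L τ) *ᵥ z τ)) τ := by
      intro τ
      refine ((hPd τ).mulVec (hzd τ)).congr_deriv ?_
      rw [sub_mulVec, sub_mulVec, ← mulVec_mulVec (z τ) (P τ), ← mulVec_mulVec (z τ) (-(A τ)ᵀ)]
      abel
    have h3 := hobs _ (fun τ => -((Q τ - S τ * L τ) *ᵥ z τ)) t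
      ((hQ.sub (hS.matrix_mul hL)).matrix_mulVec hzc).neg hq
    have h4 : ∫ τ in t..(t + s), (((B τ)ᵀ *ᵥ (P τ *ᵥ z τ)) ⬝ᵥ ((B τ)ᵀ *ᵥ (P τ *ᵥ z τ)) +
        (-((Q τ - S τ * L τ) *ᵥ z τ)) ⬝ᵥ (-((Q τ - S τ * L τ) *ᵥ z τ))) ≤
        ∫ _τ in t..(t + s), (a + b) * (Real.exp (c * s) * (v ⬝ᵥ v)) := by
      have hBP : ∀ τ, (B τ)ᵀ *ᵥ (P τ *ᵥ z τ) = (R τ * L τ - (S τ)ᵀ) *ᵥ z τ := fun τ => by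
        rw [mulVec_mulVec, hPw]
      simp only [hBP, dot_self_neg]
      refine intervalIntegral.integral_mono_on (by linarith) (Continuous.intervalIntegrable ?_ _ _)
        (continuous_const.intervalIntegrable _ _) fun τ hτ => ?_
      · have h5 := ((hR.matrix_mul hL).sub hS.matrix_transpose).matrix_mulVec hzc
        have h6 := (hQ.sub (hS.matrix_mul hL)).matrix_mulVec hzc
        exact (h5.dotProduct h5).add (h6.dotProduct h6)
      · have h5 := h1 τ (z τ)
        have h6 := h2 τ (z τ)
        have h7 := hgrow z (fun _ => 0) t τ hτ.1 continuous_const (by simpa using hzd)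
        have h8 : z t = v := by simp [hz, hΦ.self]
        simp only [h8, dotProduct_zero, intervalIntegral.integral_zero, add_zero] at h7
        have h9 : Real.exp (c * (τ - t)) ≤ Real.exp (c * s) :=
          Real.exp_le_exp.2 (mul_le_mul_of_nonneg_left (by linarith [hτ.2]) hc0.le)
        have h10 := mul_le_mul_of_nonneg_left
          (h7.trans (mul_le_mul_of_nonneg_right h9 (dot_self_nonneg v))) (add_pos ha hb).le
        linarith
    rw [intervalIntegral.integral_const, add_sub_cancel_left, smul_eq_mul] at h4
    have h5 := mul_le_mul_of_nonneg_left h4 hC.le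
    have h6 : P t *ᵥ z t = P t *ᵥ v := by simp [hz, hΦ.self]
    rw [h6] at h3
    linarith
  -- symmetry
  have hN : ∀ t, (X t)ᵀ * Y t - (Y t)ᵀ * X t = 0 := by
    set N : ℝ → Matrix ι ι ℝ := fun t => (X t)ᵀ * Y t - (Y t)ᵀ * X t with hNdef
    -- XᵀY has a symmetric derivative, so its antisymmetric part N is constant. As P is bounded and
    -- X tends to 0, N = XᵀPX - (XᵀPX)ᵀ also tends to 0 along `l`.
    have hNd : ∀ t, HasMatDerivAt N 0 t := by
      intro t
      have h1 := (hXd t).transpose.mul (hYd t)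
      have hsymQ : (Q t)ᵀ = Q t := hc.symm_Q t
      have hsymR : (R t)ᵀ = R t := hc.symm_R t
      have h2 : ((A t - B t * L t) * X t)ᵀ * Y t +
          (X t)ᵀ * (-(A t)ᵀ * Y t - (Q t - S t * L t) * X t) =
          (X t)ᵀ * ((L t)ᵀ * (S t)ᵀ + S t * L t - (L t)ᵀ * (R t * L t) - Q t) * X t := by
        have h3 : ((A t - B t * L t) * X t)ᵀ * Y t =
            (X t)ᵀ * ((A t)ᵀ * Y t) - (X t)ᵀ * ((L t)ᵀ * ((B t)ᵀ * Y t)) := by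
          simp only [transpose_mul, transpose_sub, Matrix.sub_mul,
            Matrix.mul_assoc]
        rw [h3, hYw]
        simp only [Matrix.mul_sub, Matrix.sub_mul, Matrix.mul_add, Matrix.add_mul,
          Matrix.mul_assoc, Matrix.neg_mul, Matrix.mul_neg]
        abel
      rw [h2] at h1
      have h4 := h1.sub h1.transpose
      refine (h4.congr_fun fun s => ?_).congr_deriv ?_
      · simp [hNdef, transpose_mul]
      · simp only [transpose_mul, transpose_sub, transpose_add, transpose_transpose, hsymQ, hsymR,
          Matrix.mul_assoc]
        rw [add_comm ((L t)ᵀ * (S t)ᵀ), sub_self]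
    have hlimN : ∀ i j, Filter.Tendsto (fun t => N t i j) l (nhds 0) := by
      intro i j
      obtain ⟨C, hC⟩ := hPb
      have h1 : ∀ k k' i j, Filter.Tendsto (fun t => P t k k' * X t i j) l (nhds 0) := by
        intro k k' i j
        refine bdd_le_mul_tendsto_zero' C (Filter.Eventually.of_forall fun t => hC t k k')
          (hlim i j)
      have h2 : ∀ i j, Filter.Tendsto (fun t => ((X t)ᵀ * Y t) i j) l (nhds 0) := by
        intro i j
        simp only [← hPX, Matrix.mul_apply, transpose_apply]
        rw [show (0 : ℝ) = ∑ _k : ι, 0 * ∑ _k' : ι, 0 by simp]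
        refine tendsto_finsetSum _ fun k _ => (hlim k i).mul ?_
        exact tendsto_finsetSum _ fun k' _ => h1 k k' k' j
      have h3 : (fun t => N t i j) = fun t => ((X t)ᵀ * Y t) i j - ((X t)ᵀ * Y t) j i := by
        funext t
        simp [hNdef, Matrix.mul_apply, mul_comm]
      rw [h3]
      simpa using (h2 i j).sub (h2 j i)
    intro t
    ext i j
    have h1 : (fun s => N s i j) = fun _ => N t i j := by
      funext s
      rw [eq_of_hasMatDerivAt_zero hNd s t]
    have h2 := hlimN i j
    rw [h1] at h2
    exact tendsto_nhds_unique tendsto_const_nhds h2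
  have hPs : ∀ t, (P t).IsSymm := by
    intro t
    have h1 : X t * Φ 0 t = 1 := hΦ.mul_self hF t 0
    have h2 : (Φ 0 t)ᵀ * (X t)ᵀ = 1 := by rw [← transpose_mul, h1, transpose_one]
    have h3 := congrArg (fun M => (Φ 0 t)ᵀ * M * Φ 0 t) (sub_eq_zero.1 (hN t))
    simp only [Matrix.mul_assoc] at h3
    rw [h1, Matrix.mul_one, ← Matrix.mul_assoc, h2, Matrix.one_mul] at h3
    rw [Matrix.IsSymm, hP, transpose_mul]
    exact h3.symm
  have hRu := hc.posDef_R.isUnit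
  have hgain : ∀ t, (R t)⁻¹ * ((S t)ᵀ + (B t)ᵀ * P t) = L t := by
    intro t
    rw [hPw, add_sub_cancel, ← Matrix.mul_assoc,
      nonsing_inv_mul _ ((Matrix.isUnit_iff_isUnit_det _).1 (hRu t)), Matrix.one_mul]
  refine ⟨P, ⟨hPs, fun t => (hPd t).congr_deriv ?_⟩, ?_⟩
  · rw [Matrix.mul_assoc _ (R t)⁻¹, add_comm ((B t)ᵀ * P t), hgain]
    simp only [Matrix.mul_sub, Matrix.add_mul, Matrix.mul_assoc, Matrix.neg_mul]
    abel
  · funext t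
    rw [closedLoop, Matrix.mul_assoc, hgain]

end RiccatiOfSynthesis

/-! ### The controllability Gramian from minus infinity -/

section Gramian

variable {ι κ : Type*} [Fintype ι] [Fintype κ]

theorem dot_setIntegral_mulVec {G : ℝ → Matrix ι κ ℝ} {s : Set ℝ}
    (hG : ∀ i j, IntegrableOn (fun τ => G τ i j) s) (x : ι → ℝ) (y : κ → ℝ) :
    x ⬝ᵥ ((Matrix.of fun i j => ∫ τ in s, G τ i j) *ᵥ y) = ∫ τ in s, x ⬝ᵥ (G τ *ᵥ y) := by
  simp only [dotProduct, mulVec, Matrix.of_apply, Finset.mul_sum]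
  have hc : ∀ i j, IntegrableOn (fun τ => x i * (G τ i j * y j)) s := fun i j =>
    ((hG i j).mul_const _).const_mul _
  rw [integral_finsetSum _ fun i _ => integrable_finsetSum _ fun j _ => hc i j]
  refine Finset.sum_congr rfl fun i _ => ?_
  rw [integral_finsetSum _ fun j _ => hc i j]
  refine Finset.sum_congr rfl fun j _ => ?_
  rw [integral_const_mul, integral_mul_const]

theorem integrableOn_dot_mulVec {G : ℝ → Matrix ι κ ℝ} {s : Set ℝ}
    (hG : ∀ i j, IntegrableOn (fun τ => G τ i j) s) (x : ι → ℝ) (y : κ → ℝ) :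
    IntegrableOn (fun τ => x ⬝ᵥ (G τ *ᵥ y)) s := by
  simp only [dotProduct, mulVec, Finset.mul_sum]
  exact integrable_finsetSum _ fun i _ => integrable_finsetSum _ fun j _ =>
    ((hG i j).mul_const _).const_mul _

theorem abs_dot_le (x y : ι → ℝ) : |x ⬝ᵥ y| ≤ (x ⬝ᵥ x + y ⬝ᵥ y) / 2 := by
  have h1 := two_dot_le x y
  have h2 := two_dot_le x (-y)
  simp only [dotProduct_neg, neg_dotProduct, neg_neg] at h2
  exact abs_le.2 ⟨by linarith, by linarith⟩

theorem apply_eq_dot [DecidableEq ι] [DecidableEq κ] (M : Matrix ι κ ℝ) (i : ι) (j : κ) :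
    M i j = Pi.single i 1 ⬝ᵥ (M *ᵥ Pi.single j 1) := by simp

/-- With y = R⁻¹v, the right side is y·Ry ≥ ρ|y|², while |v|² = |Ry|² ≤ C|y|². -/
theorem inv_dot_le [DecidableEq κ] {R : Matrix κ κ ℝ} {ρ C : ℝ} (hρ : 0 < ρ) (hC : 0 < C)
    (h : ∀ x, ρ * (x ⬝ᵥ x) ≤ x ⬝ᵥ (R *ᵥ x)) (h' : ∀ x, (R *ᵥ x) ⬝ᵥ (R *ᵥ x) ≤ C * (x ⬝ᵥ x))
    (v : κ → ℝ) : ρ / C * (v ⬝ᵥ v) ≤ v ⬝ᵥ (R⁻¹ *ᵥ v) := by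
  have hv : R *ᵥ (R⁻¹ *ᵥ v) = v := by
    rw [mulVec_mulVec,
      mul_nonsing_inv _ ((Matrix.isUnit_iff_isUnit_det _).1 (isUnit_of_dot_le hρ h)), one_mulVec]
  have h1 := h (R⁻¹ *ᵥ v)
  have h2 := h' (R⁻¹ *ᵥ v)
  rw [hv] at h1 h2
  rw [dotProduct_comm v (R⁻¹ *ᵥ v)]
  refine le_trans ?_ h1
  rw [div_mul_eq_mul_div, div_le_iff₀ hC]
  nlinarith

variable [DecidableEq ι] [DecidableEq κ] {A : ℝ → Matrix ι ι ℝ} {B : ℝ → Matrix ι κ ℝ}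

/-- W is the controllability Gramian of the closed loop from -∞, convergent by stability. Symmetries
Z of the flow and of B R⁻¹ Bᵀ pass to the integrand, hence to W; the last clause carries the product
structure over to the anti-stable mapping. -/
theorem exists_gramian (hAB : DynamicsAssumption A B) {K : ℝ → Matrix κ ι ℝ}
    {R : ℝ → Matrix κ κ ℝ} (hcan : IsCanonicalCost A B K R) {Φ : ℝ → ℝ → Matrix ι ι ℝ}
    (hΦ : IsTransitionMatrix (fun t => A t - B t * K t) Φ) {α β : ℝ} (hβ : 0 < β)
    (hdec : ∀ t₀ t, t₀ ≤ t → ∀ i j, |Φ t t₀ i j| ≤ α * Real.exp (-β * (t - t₀))) :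
    ∃ W : ℝ → Matrix ι ι ℝ, (∀ t, (W t).IsSymm) ∧
      (∀ t, HasMatDerivAt W ((A t - B t * K t) * W t + W t * (A t - B t * K t)ᵀ +
        B t * (R t)⁻¹ * (B t)ᵀ) t) ∧ BoundedMap W ∧
      (∃ c > 0, ∀ t x, c * (x ⬝ᵥ x) ≤ x ⬝ᵥ (W t *ᵥ x)) ∧
      ∀ Z : ℝ → Matrix ι ι ℝ, (∀ t τ, Z t * Φ t τ = Φ t τ * Z τ) →
        (∀ t, Z t * (B t * (R t)⁻¹ * (B t)ᵀ) = B t * (R t)⁻¹ * (B t)ᵀ * (Z t)ᵀ) →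
        ∀ t, Z t * W t = W t * (Z t)ᵀ := by
  have hA := hAB.smooth_A.continuous
  have hB := hAB.smooth_B.continuous
  have hK := hcan.smooth_K.continuous
  have hRu := hcan.posDef_R.isUnit
  have hRi := (hcan.smooth_R.inv hRu).continuous
  have hF : Continuous fun t => A t - B t * K t := hA.sub (hB.matrix_mul hK)
  have hFb : BoundedMap fun t => A t - B t * K t :=
    hAB.bounded_A.sub (hAB.bounded_B.mul hcan.bounded_K)
  set G : ℝ → Matrix ι ι ℝ := fun t => B t * (R t)⁻¹ * (B t)ᵀ with hG
  have hGs : ∀ t, (G t)ᵀ = G t := fun t => by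
    simp only [hG, transpose_mul, transpose_transpose, transpose_nonsing_inv,
      (hcan.symm_R t).eq, Matrix.mul_assoc]
  have hGc : Continuous G := (hB.matrix_mul hRi).matrix_mul hB.matrix_transpose
  obtain ⟨g, hg, hGb⟩ := ((hAB.bounded_B.mul hcan.posDef_R.boundedMap_inv).mul
    hAB.bounded_B.transpose).exists_mulVec_dot_le
  obtain ⟨r, hr, hGl⟩ : ∃ r > 0, ∀ t x, r * (((B t)ᵀ *ᵥ x) ⬝ᵥ ((B t)ᵀ *ᵥ x)) ≤
      x ⬝ᵥ (G t *ᵥ x) := by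
    obtain ⟨ρ, hρ, h1⟩ := hcan.posDef_R.exists_dot_le
    obtain ⟨C, hC, h2⟩ := hcan.bounded_R.exists_mulVec_dot_le
    refine ⟨ρ / C, by positivity, fun t x => ?_⟩
    have h3 := inv_dot_le hρ hC (h1 t) (h2 t) ((B t)ᵀ *ᵥ x)
    simp only [hG]
    rwa [← mulVec_mulVec, ← mulVec_mulVec, dot_mulVec_comm (B t)]
  set k : ℝ := Fintype.card ι * (Fintype.card ι * α ^ 2) with hk
  have hk0 : 0 ≤ k := by positivity
  have hq : ∀ t τ, τ ≤ t → ∀ x : ι → ℝ, ((Φ t τ)ᵀ *ᵥ x) ⬝ᵥ ((Φ t τ)ᵀ *ᵥ x) ≤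
      k * Real.exp (2 * β * (τ - t)) * (x ⬝ᵥ x) := by
    intro t τ hτ x
    have h1 := mulVec_dot_le_of_abs_le (F := (Φ t τ)ᵀ) (fun i j => hdec τ t hτ j i) x
    have h2 : Real.exp (-β * (t - τ)) ^ 2 = Real.exp (2 * β * (τ - t)) := by
      rw [← Real.exp_nat_mul]
      congr 1
      push_cast
      ring
    rw [mul_pow, h2] at h1
    refine h1.trans (le_of_eq ?_)
    rw [hk]
    ring
  -- Pulling back to time 0 leaves t only as a limit of integration, so the derivative of the
  -- Gramian comes from the fundamental theorem of calculus and the product rule.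
  set H : ℝ → Matrix ι ι ℝ := fun τ => Φ 0 τ * G τ * (Φ 0 τ)ᵀ with hH
  have hHc : Continuous H := ((hΦ.continuous_right hF 0).matrix_mul hGc).matrix_mul
    (hΦ.continuous_right hF 0).matrix_transpose
  have hHdot : ∀ τ x y, x ⬝ᵥ (H τ *ᵥ y) = ((Φ 0 τ)ᵀ *ᵥ x) ⬝ᵥ (G τ *ᵥ ((Φ 0 τ)ᵀ *ᵥ y)) := by
    intro τ x y
    simp only [hH]
    rw [← mulVec_mulVec, ← mulVec_mulVec, dot_mulVec_comm]
  have hcomp : ∀ t τ x, (Φ 0 τ)ᵀ *ᵥ ((Φ t 0)ᵀ *ᵥ x) = (Φ t τ)ᵀ *ᵥ x := fun t τ x => by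
    rw [mulVec_mulVec, ← transpose_mul, hΦ.mul hF]
  have hHi0 : ∀ i j, IntegrableOn (fun τ => H τ i j) (Set.Iic 0) := by
    intro i j
    refine Integrable.mono'
      ((integrableOn_exp_mul_Iic (a := 2 * β) (by positivity) 0).const_mul ((1 + g) * k / 2))
      (hHc.matrix_elem i j).aestronglyMeasurable
      (ae_restrict_of_forall_mem measurableSet_Iic fun τ hτ => ?_)
    rw [Real.norm_eq_abs, apply_eq_dot (H τ) i j, hHdot]
    refine (abs_dot_le _ _).trans ?_
    have h1 := hq 0 τ hτ (Pi.single i 1)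
    have h2 := hq 0 τ hτ (Pi.single j 1)
    have h3 := hGb τ ((Φ 0 τ)ᵀ *ᵥ Pi.single j 1)
    simp only [single_dotProduct, Pi.single_eq_same, mul_one, sub_zero] at h1 h2
    have h4 := mul_le_mul_of_nonneg_left h2 hg.le
    linarith
  have hHi : ∀ t i j, IntegrableOn (fun τ => H τ i j) (Set.Iic t) := by
    intro t i j
    refine ((hHi0 i j).union ((hHc.matrix_elem i j).integrableOn_Icc (a := 0) (b := t))).mono_set ?_
    intro τ hτ
    rcases le_total τ 0 with h | h
    · exact Or.inl h
    · exact Or.inr ⟨h, hτ⟩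
  set Y : ℝ → Matrix ι ι ℝ := fun t => Matrix.of fun i j => ∫ τ in Set.Iic t, H τ i j with hY
  have hYd : ∀ t, HasMatDerivAt Y (H t) t := by
    intro t i j
    have h1 : (fun s => Y s i j) = fun s => Y 0 i j + ∫ τ in (0 : ℝ)..s, H τ i j := by
      funext s
      rw [← intervalIntegral.integral_Iic_sub_Iic (hHi 0 i j) (hHi s i j)]
      simp [hY]
    rw [h1]
    exact ((hHc.matrix_elem i j).integral_hasStrictDerivAt 0 t).hasDerivAt.const_add _
  have hHs : ∀ τ, (H τ)ᵀ = H τ := fun τ => by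
    simp only [hH, transpose_mul, transpose_transpose, hGs, Matrix.mul_assoc]
  have hYs : ∀ t, (Y t)ᵀ = Y t := by
    intro t
    ext i j
    simp only [hY, transpose_apply, of_apply]
    refine integral_congr_ae (Filter.Eventually.of_forall fun τ => ?_)
    exact congrFun (congrFun (hHs τ) i) j
  set W : ℝ → Matrix ι ι ℝ := fun t => Φ t 0 * Y t * (Φ t 0)ᵀ with hW
  have hWdot : ∀ t x, x ⬝ᵥ (W t *ᵥ x) =
      ∫ τ in Set.Iic t, ((Φ t τ)ᵀ *ᵥ x) ⬝ᵥ (G τ *ᵥ ((Φ t τ)ᵀ *ᵥ x)) := by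
    intro t x
    simp only [hW]
    rw [← mulVec_mulVec, ← mulVec_mulVec, dot_mulVec_comm, dot_setIntegral_mulVec (hHi t)]
    refine integral_congr_ae (Filter.Eventually.of_forall fun τ => ?_)
    simp only [hHdot, hcomp]
  have hWi : ∀ t x, IntegrableOn (fun τ => ((Φ t τ)ᵀ *ᵥ x) ⬝ᵥ (G τ *ᵥ ((Φ t τ)ᵀ *ᵥ x)))
      (Set.Iic t) := by
    intro t x
    have h1 := integrableOn_dot_mulVec (hHi t) ((Φ t 0)ᵀ *ᵥ x) ((Φ t 0)ᵀ *ᵥ x)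
    simpa only [hHdot, hcomp] using h1
  have hWs : ∀ t, (W t).IsSymm := fun t => by
    simp only [hW, Matrix.IsSymm, transpose_mul, transpose_transpose, hYs, Matrix.mul_assoc]
  have hG0 : ∀ t x, 0 ≤ x ⬝ᵥ (G t *ᵥ x) := fun t x =>
    (mul_nonneg hr.le (dot_self_nonneg _)).trans (hGl t x)
  refine ⟨W, hWs, fun t => ?_, ?_, ?_, fun Z hZΦ hZG t => ?_⟩
  · refine (((hΦ.hasMatDerivAt t 0).mul (hYd t)).mul (hΦ.hasMatDerivAt t 0).transpose).congr_deriv ?_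
    have h1 : Φ t 0 * H t * (Φ t 0)ᵀ = G t := by
      have h2 : Φ t 0 * Φ 0 t = 1 := hΦ.mul_self hF t 0
      have h3 : (Φ 0 t)ᵀ * (Φ t 0)ᵀ = 1 := by rw [← transpose_mul, h2, transpose_one]
      simp only [hH, Matrix.mul_assoc]
      rw [h3, Matrix.mul_one, ← Matrix.mul_assoc, h2, Matrix.one_mul]
    rw [Matrix.add_mul, h1, transpose_mul]
    simp only [hW, hG, Matrix.mul_assoc]
    abel
  · refine boundedMap_of_isSymm (C := (1 + g) * k / 2 / (2 * β)) (by positivity) hWs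
      fun t x => ?_
    rw [hWdot, abs_of_nonneg (integral_nonneg fun τ => hG0 _ _)]
    have h1 : ∫ τ in Set.Iic t, ((Φ t τ)ᵀ *ᵥ x) ⬝ᵥ (G τ *ᵥ ((Φ t τ)ᵀ *ᵥ x)) ≤
        ∫ τ in Set.Iic t, ((1 + g) * k / 2 * (x ⬝ᵥ x) * Real.exp (-(2 * β * t))) *
          Real.exp (2 * β * τ) := by
      refine setIntegral_mono_on (hWi t x)
        ((integrableOn_exp_mul_Iic (a := 2 * β) (by positivity) t).const_mul _)
        measurableSet_Iic fun τ hτ => ?_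
      refine ((le_abs_self _).trans (abs_dot_le _ _)).trans ?_
      have h2 := hq t τ hτ x
      have h3 := hGb τ ((Φ t τ)ᵀ *ᵥ x)
      have h4 := mul_le_mul_of_nonneg_left h2 hg.le
      have h5 : Real.exp (2 * β * (τ - t)) = Real.exp (-(2 * β * t)) * Real.exp (2 * β * τ) := by
        rw [← Real.exp_add]
        congr 1
        ring
      rw [h5] at h2 h4
      linarith
    refine h1.trans (le_of_eq ?_)
    rw [integral_const_mul, integral_exp_mul_Iic (by positivity), mul_assoc, mul_div_assoc',
      ← Real.exp_add, neg_add_cancel, Real.exp_zero]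
    ring
  · obtain ⟨s, hs, C, hC, hobs⟩ := hAB.observability
    obtain ⟨c, hc, hgrow⟩ := exists_growth hFb.transpose.neg
    obtain ⟨l, hl, hKb⟩ := hcan.bounded_K.transpose.exists_mulVec_dot_le
    refine ⟨r / (Real.exp (c * s) * (C * (1 + l))), by positivity, fun t x => ?_⟩
    set q : ℝ → ι → ℝ := fun τ => (Φ t τ)ᵀ *ᵥ x with hqdef
    have hqd : ∀ τ, HasDerivAt q (-(A τ - B τ * K τ)ᵀ *ᵥ q τ) τ := fun τ =>
      hΦ.hasDerivAt_transpose_mulVec hF x τ t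
    have hqc : Continuous q := continuous_iff_continuousAt.2 fun τ => (hqd τ).continuousAt
    have hBq : Continuous fun τ => (B τ)ᵀ *ᵥ q τ := hB.matrix_transpose.matrix_mulVec hqc
    have hKBq : Continuous fun τ => (K τ)ᵀ *ᵥ ((B τ)ᵀ *ᵥ q τ) :=
      hK.matrix_transpose.matrix_mulVec hBq
    -- The closed-loop adjoint equation is that of A with source KᵀBᵀq. The source is bounded by the
    -- output Bᵀq, so feedback preserves observability.
    have h1 := hobs q (fun τ => (K τ)ᵀ *ᵥ ((B τ)ᵀ *ᵥ q τ)) (t - s) hKBq fun τ => by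
      refine (hqd τ).congr_deriv ?_
      simp only [transpose_sub, transpose_mul, neg_mulVec, sub_mulVec, mulVec_mulVec]
      abel
    have h2 := hgrow q (fun _ => 0) (t - s) t (by linarith) continuous_const (by simpa using hqd)
    simp only [dotProduct_zero, intervalIntegral.integral_zero, add_zero, sub_sub_cancel] at h2
    have h3 : q t = x := by simp [hqdef, hΦ.self]
    rw [h3] at h2
    rw [sub_add_cancel] at h1
    have h4 : ∫ τ in (t - s)..t, (((B τ)ᵀ *ᵥ q τ) ⬝ᵥ ((B τ)ᵀ *ᵥ q τ) +
        ((K τ)ᵀ *ᵥ ((B τ)ᵀ *ᵥ q τ)) ⬝ᵥ ((K τ)ᵀ *ᵥ ((B τ)ᵀ *ᵥ q τ))) ≤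
        ∫ τ in (t - s)..t, (1 + l) * (((B τ)ᵀ *ᵥ q τ) ⬝ᵥ ((B τ)ᵀ *ᵥ q τ)) := by
      refine intervalIntegral.integral_mono_on (by linarith)
        (((hBq.dotProduct hBq).add (hKBq.dotProduct hKBq)).intervalIntegrable _ _)
        (((hBq.dotProduct hBq).const_mul _).intervalIntegrable _ _) fun τ _ => ?_
      have := hKb τ ((B τ)ᵀ *ᵥ q τ)
      linarith
    rw [intervalIntegral.integral_const_mul] at h4
    have h5 : r * ∫ τ in (t - s)..t, ((B τ)ᵀ *ᵥ q τ) ⬝ᵥ ((B τ)ᵀ *ᵥ q τ) ≤ x ⬝ᵥ (W t *ᵥ x) := by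
      rw [hWdot, ← intervalIntegral.integral_const_mul,
        intervalIntegral.integral_of_le (by linarith)]
      refine (setIntegral_mono_on
        ((hBq.dotProduct hBq).const_mul r |>.integrableOn_Ioc)
        ((hWi t x).mono_set Set.Ioc_subset_Iic_self) measurableSet_Ioc
        fun τ _ => hGl τ (q τ)).trans ?_
      exact setIntegral_mono_set (hWi t x) (Filter.Eventually.of_forall fun τ => hG0 _ _)
        (Filter.Eventually.of_forall Set.Ioc_subset_Iic_self)
    have h6 : x ⬝ᵥ x ≤ Real.exp (c * s) * (C * (1 + l)) *
        ∫ τ in (t - s)..t, ((B τ)ᵀ *ᵥ q τ) ⬝ᵥ ((B τ)ᵀ *ᵥ q τ) := by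
      refine h2.trans ?_
      rw [mul_assoc, mul_assoc]
      exact mul_le_mul_of_nonneg_left (h1.trans (mul_le_mul_of_nonneg_left h4 hC.le))
        (Real.exp_pos _).le
    refine le_trans ?_ h5
    rw [div_mul_eq_mul_div, div_le_iff₀ (by positivity), mul_assoc]
    refine mul_le_mul_of_nonneg_left ?_ hr.le
    linarith
  · have h1 : ∀ τ, Z 0 * H τ = H τ * (Z 0)ᵀ := by
      intro τ
      have h2 : (Φ 0 τ)ᵀ * (Z 0)ᵀ = (Z τ)ᵀ * (Φ 0 τ)ᵀ := by
        rw [← transpose_mul, ← transpose_mul, hZΦ]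
      have h3 : Z τ * G τ = G τ * (Z τ)ᵀ := hZG τ
      simp only [hH]
      rw [Matrix.mul_assoc _ _ (Z 0)ᵀ, h2, ← Matrix.mul_assoc, ← Matrix.mul_assoc, hZΦ,
        Matrix.mul_assoc (Φ 0 τ), h3]
      simp only [Matrix.mul_assoc]
    have h2 : Z 0 * Y t = Y t * (Z 0)ᵀ := by
      ext i j
      rw [apply_eq_dot (Z 0 * Y t), apply_eq_dot (Y t * (Z 0)ᵀ), ← mulVec_mulVec, ← mulVec_mulVec,
        dot_mulVec_comm (Z 0), dot_setIntegral_mulVec (hHi t), dot_setIntegral_mulVec (hHi t)]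
      refine integral_congr_ae (Filter.Eventually.of_forall fun τ => ?_)
      simp only
      rw [← dot_mulVec_comm, mulVec_mulVec, mulVec_mulVec, h1]
    have h3 : (Φ t 0)ᵀ * (Z t)ᵀ = (Z 0)ᵀ * (Φ t 0)ᵀ := by
      rw [← transpose_mul, ← transpose_mul, hZΦ]
    simp only [hW]
    rw [Matrix.mul_assoc _ _ (Z t)ᵀ, h3, ← Matrix.mul_assoc, ← Matrix.mul_assoc, hZΦ,
      Matrix.mul_assoc (Φ t 0), h2]
    simp only [Matrix.mul_assoc]

end Gramian

/-! ### The synthesis mappings of a canonical cost -/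

section Canonical

variable {ι κ : Type*} [Fintype ι] [Fintype κ]
  {A : ℝ → Matrix ι ι ℝ} {B : ℝ → Matrix ι κ ℝ}

/-- The control -Lx has zero cost, and the cost is nonnegative. -/
theorem mem_optimalSynthesis_feedbackCost {L : ℝ → Matrix κ ι ℝ} {R : ℝ → Matrix κ κ ℝ}
    (hA : Continuous A) (hB : Continuous B) (hL : Continuous L)
    (hR : ∀ t v, 0 ≤ v ⬝ᵥ (R t *ᵥ v)) {x : ℝ → ι → ℝ}
    (hx : ∀ t, HasDerivAt x ((A t - B t * L t) *ᵥ x t) t) {t₀ t₁ : ℝ} (h : t₀ < t₁) :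
    (t₀, t₁, x) ∈ optimalSynthesis A B (feedbackCost L R) := by
  have hxc : Continuous x := continuous_iff_continuousAt.2 fun t => (hx t).continuousAt
  refine ⟨h, fun t => -(L t *ᵥ x t), ?_, fun y v _ _ _ => ?_⟩
  · refine isTrajectory_of_hasDerivAt hA hB (hL.matrix_mulVec hxc).neg (fun t => ?_) t₀ t₁
    refine (hx t).congr_deriv ?_
    simp only [Pi.neg_apply]
    rw [sub_mulVec, mulVec_neg, mulVec_mulVec, sub_eq_add_neg]
  · simp only [feedbackCost, neg_add_cancel, zero_dotProduct, intervalIntegral.integral_zero]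
    exact intervalIntegral.integral_nonneg h.le fun t _ => hR t _

theorem abs_mul_apply_le {ν μ : Type*} {M : Matrix ν ι ℝ} {N : Matrix ι μ ℝ} {a b : ℝ} (ha : 0 ≤ a)
    (hM : ∀ i j, |M i j| ≤ a) (hN : ∀ i j, |N i j| ≤ b) (i : ν) (j : μ) :
    |(M * N) i j| ≤ Fintype.card ι * (a * b) := by
  rw [Matrix.mul_apply]
  refine (Finset.abs_sum_le_sum_abs _ _).trans ((Finset.sum_le_sum (g := fun _ => a * b)
    fun k _ => ?_).trans (by simp))
  rw [abs_mul]
  exact mul_le_mul (hM i k) (hN k j) (abs_nonneg _) ha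

variable [DecidableEq ι] [DecidableEq κ]

/-- For a canonical cost P = 0 is a solution, so an invertible solution has an inverse satisfying a
linear equation, here the Lyapunov equation of the Gramian up to sign. -/
theorem isRiccatiSolution_neg_inv {K : ℝ → Matrix κ ι ℝ} {R : ℝ → Matrix κ κ ℝ}
    {W : ℝ → Matrix ι ι ℝ} (hRu : ∀ t, IsUnit (R t)) (hRs : ∀ t, (R t).IsSymm)
    (hWu : ∀ t, IsUnit (W t)) (hWs : ∀ t, (W t).IsSymm)
    (hW : ∀ t, HasMatDerivAt W ((A t - B t * K t) * W t + W t * (A t - B t * K t)ᵀ +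
        B t * (R t)⁻¹ * (B t)ᵀ) t) :
    IsRiccatiSolution A B (fun t => (K t)ᵀ * R t * K t) (fun t => (K t)ᵀ * R t) R
      (fun t => -(W t)⁻¹) := by
  refine ⟨fun t => ?_, fun t => ?_⟩
  · simp only [Matrix.IsSymm, transpose_neg, transpose_nonsing_inv, (hWs t).eq]
  · refine (hasMatDerivAt_inv hWu (hW t)).neg.congr_deriv ?_
    have h1 : W t * (W t)⁻¹ = 1 := mul_nonsing_inv _ ((Matrix.isUnit_iff_isUnit_det _).1 (hWu t))
    have h2 : (W t)⁻¹ * W t = 1 := nonsing_inv_mul _ ((Matrix.isUnit_iff_isUnit_det _).1 (hWu t))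
    have h3 : R t * (R t)⁻¹ = 1 := mul_nonsing_inv _ ((Matrix.isUnit_iff_isUnit_det _).1 (hRu t))
    have h4 : (R t)⁻¹ * R t = 1 := nonsing_inv_mul _ ((Matrix.isUnit_iff_isUnit_det _).1 (hRu t))
    set V := (W t)⁻¹
    set T := (R t)⁻¹
    have e1 : V * (((A t - B t * K t) * W t + W t * (A t - B t * K t)ᵀ + B t * T * (B t)ᵀ) * V) =
        V * (A t - B t * K t) + (A t - B t * K t)ᵀ * V + V * B t * T * (B t)ᵀ * V := by
      calc _ = V * (A t - B t * K t) * (W t * V) + V * W t * (A t - B t * K t)ᵀ * V +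
            V * B t * T * (B t)ᵀ * V := by
              simp only [Matrix.add_mul, Matrix.mul_add, Matrix.mul_assoc]
        _ = _ := by rw [h1, h2, Matrix.mul_one, Matrix.one_mul]
    have e2 : (-V * B t + (K t)ᵀ * R t) * T * ((B t)ᵀ * -V + ((K t)ᵀ * R t)ᵀ) =
        V * B t * T * (B t)ᵀ * V - V * B t * K t - (K t)ᵀ * (B t)ᵀ * V +
          (K t)ᵀ * R t * K t := by
      calc _ = V * B t * T * (B t)ᵀ * V - V * B t * (T * R t) * K t -
            (K t)ᵀ * (R t * T) * (B t)ᵀ * V + (K t)ᵀ * (R t * T) * R t * K t := by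
              simp only [transpose_mul, transpose_transpose, (hRs t).eq, Matrix.add_mul,
                Matrix.mul_add, Matrix.mul_assoc, Matrix.neg_mul, Matrix.mul_neg]
              abel
        _ = _ := by rw [h3, h4, Matrix.mul_one, Matrix.mul_one]
    rw [neg_neg, Matrix.mul_assoc V, e1, e2]
    simp only [transpose_sub, transpose_mul, Matrix.sub_mul, Matrix.mul_sub, Matrix.mul_assoc,
      Matrix.neg_mul, Matrix.mul_neg, neg_neg]
    abel

/-- W conjugates the adjoint flow of F to the flow of F + G W⁻¹. With W and W⁻¹ bounded, forward
decay of Φ becomes backward decay of the other flow. -/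
theorem isTransitionMatrix_dual {F W V : ℝ → Matrix ι ι ℝ} {G : ℝ → Matrix ι ι ℝ}
    {Φ : ℝ → ℝ → Matrix ι ι ℝ} (hΦ : IsTransitionMatrix F Φ) (hF : Continuous F)
    (hW : ∀ t, HasMatDerivAt W (F t * W t + W t * (F t)ᵀ + G t) t)
    (hWV : ∀ t, W t * V t = 1) :
    IsTransitionMatrix (fun t => F t + G t * V t) (fun t τ => W t * (Φ τ t)ᵀ * V τ) := by
  refine fun τ => ⟨by simp [hΦ.self, hWV], fun t => ?_⟩
  refine (((hW t).mul (hΦ.hasMatDerivAt_right hF t τ).transpose).mul_const (V τ)).congr_deriv ?_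
  have h1 : V t * W t = 1 := mul_eq_one_comm.1 (hWV t)
  have h2 : G t * V t * (W t * (Φ τ t)ᵀ * V τ) = G t * (Φ τ t)ᵀ * V τ := by
    calc _ = G t * (V t * W t) * (Φ τ t)ᵀ * V τ := by simp only [Matrix.mul_assoc]
      _ = _ := by rw [h1, Matrix.mul_one]
  rw [Matrix.add_mul (F t), h2]
  simp only [transpose_neg, transpose_mul, Matrix.add_mul, Matrix.mul_neg, Matrix.neg_mul,
    Matrix.mul_assoc]
  abel

/-- Solutions of both closed loops of the canonical cost are optimal for it, hence for the original
cost, whose Riccati solutions are recovered from them. The last clause records the inheritance of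
symmetries by the Gramian. -/
theorem IsCanonicalCost.exists_areSynthesisMappings (hAB : DynamicsAssumption A B)
    {Q : ℝ → Matrix ι ι ℝ} {S : ℝ → Matrix ι κ ℝ} {R₀ : ℝ → Matrix κ κ ℝ}
    (hc : CostAssumption Q S R₀) {K : ℝ → Matrix κ ι ℝ} {R : ℝ → Matrix κ κ ℝ}
    (hcan : IsCanonicalCost A B K R)
    (hsyn : optimalSynthesis A B (feedbackCost K R) = optimalSynthesis A B (quadCost Q S R₀)) :
    ∃ W : ℝ → Matrix ι ι ℝ, (∀ t, IsUnit (W t)) ∧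
      AreSynthesisMappings A B Q S R₀ (fun t => A t - B t * K t)
        (fun t => A t - B t * K t + B t * (R t)⁻¹ * (B t)ᵀ * (W t)⁻¹) ∧
      ∀ Φ, IsTransitionMatrix (fun t => A t - B t * K t) Φ →
      ∀ Z : ℝ → Matrix ι ι ℝ, (∀ t τ, Z t * Φ t τ = Φ t τ * Z τ) →
        (∀ t, Z t * (B t * (R t)⁻¹ * (B t)ᵀ) = B t * (R t)⁻¹ * (B t)ᵀ * (Z t)ᵀ) →
        ∀ t, Z t * W t = W t * (Z t)ᵀ := by
  have hA := hAB.smooth_A.continuous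
  have hB := hAB.smooth_B.continuous
  have hK := hcan.smooth_K.continuous
  have hRu := hcan.posDef_R.isUnit
  have hRi := (hcan.smooth_R.inv hRu).continuous
  have hF : Continuous fun t => A t - B t * K t := hA.sub (hB.matrix_mul hK)
  have hR0 : ∀ t v, 0 ≤ v ⬝ᵥ (R t *ᵥ v) := by
    obtain ⟨ρ, hρ, h⟩ := hcan.posDef_R.exists_dot_le
    exact fun t v => (mul_nonneg hρ.le (dot_self_nonneg v)).trans (h t v)
  obtain ⟨Φ, hΦ, α, hα, β, hβ, hdec⟩ := hcan.stable
  obtain ⟨W, hWs, hWd, hWb, ⟨c, hc0, hWc⟩, hWZ⟩ := exists_gramian hAB hcan hΦ hβ hdec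
  have hWu : ∀ t, IsUnit (W t) := fun t => isUnit_of_dot_le hc0 (hWc t)
  have hWV : ∀ t, W t * (W t)⁻¹ = 1 := fun t =>
    mul_nonsing_inv _ ((Matrix.isUnit_iff_isUnit_det _).1 (hWu t))
  have hVb := boundedMap_inv hc0 hWc
  have hP := isRiccatiSolution_neg_inv (A := A) (B := B) hRu hcan.symm_R hWu hWs hWd
  have hΦ' := isTransitionMatrix_dual hΦ hF hWd hWV
  have hVc : Continuous fun t => (W t)⁻¹ :=
    continuous_of_hasMatDerivAt fun t => hasMatDerivAt_inv hWu (hWd t)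
  set L := riccatiGain B (fun t => (K t)ᵀ * R t) R (fun t => -(W t)⁻¹) with hL
  have hLeq : ∀ t, L t = K t - (R t)⁻¹ * (B t)ᵀ * (W t)⁻¹ := fun t => by
    simp only [hL, riccatiGain, transpose_mul, transpose_transpose, (hcan.symm_R t).eq,
      Matrix.mul_add, Matrix.mul_neg, ← Matrix.mul_assoc,
      nonsing_inv_mul _ ((Matrix.isUnit_iff_isUnit_det _).1 (hRu t)), Matrix.one_mul,
      sub_eq_add_neg]
  have hLc : Continuous L := by
    rw [show L = _ from funext hLeq]
    exact hK.sub ((hRi.matrix_mul hB.matrix_transpose).matrix_mul hVc)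
  have hLb : BoundedMap L := by
    rw [show L = _ from funext hLeq]
    exact hcan.bounded_K.sub
      ((hcan.posDef_R.boundedMap_inv.mul hAB.bounded_B.transpose).mul hVb)
  have hFeq : (fun t => A t - B t * K t + B t * (R t)⁻¹ * (B t)ᵀ * (W t)⁻¹) =
      fun t => A t - B t * L t := by
    funext t
    rw [hLeq, Matrix.mul_sub]
    simp only [Matrix.mul_assoc]
    abel
  rw [hFeq] at hΦ'
  -- Completing the square with -W⁻¹: the square with gain L differs from the canonical cost by
  -- end-point terms, so the anti-stable solutions also belong to the synthesis.
  have hsyn' : optimalSynthesis A B (feedbackCost L R) =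
      optimalSynthesis A B (feedbackCost K R) := by
    rw [feedbackCost_eq_quadCost (K := K) hcan.symm_R]
    refine optimalSynthesis_eq one_pos (fun t x => x ⬝ᵥ (-(W t)⁻¹ *ᵥ x))
      fun t₀ t₁ x u h01 h => ?_
    rw [one_mul]
    exact hP.integral_quadCost hAB.smooth_A hAB.smooth_B
      ((hcan.smooth_K.transpose.mul hcan.smooth_R).mul hcan.smooth_K)
      (hcan.smooth_K.transpose.mul hcan.smooth_R) hcan.smooth_R hRu hcan.symm_R h01 h
  obtain ⟨Cw, hCw⟩ := hWb
  obtain ⟨Cv, hCv⟩ := hVb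
  set n : ℝ := (Fintype.card ι : ℝ) with hn
  -- Entrywise bound of a product of three matrices; the + 1 only ensures positivity.
  set α' : ℝ := n * (n * (|Cw| * α) * |Cv|) + 1 with hα'
  have hn0 : 0 ≤ n := by positivity
  have hα'0 : 0 < α' := by positivity
  have hdec' : ∀ t₀ t, t ≤ t₀ → ∀ i j,
      |(W t * (Φ t₀ t)ᵀ * (W t₀)⁻¹) i j| ≤ α' * Real.exp (β * (t - t₀)) := by
    intro t₀ t h i j
    have h1 : ∀ i j, |(Φ t₀ t)ᵀ i j| ≤ α * Real.exp (β * (t - t₀)) := fun i j => by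
      refine (hdec t t₀ h j i).trans (le_of_eq ?_)
      congr 2
      ring
    refine (abs_mul_apply_le (by positivity) (abs_mul_apply_le (abs_nonneg Cw)
      (fun i j => (hCw t i j).trans (le_abs_self _)) h1)
      (fun i j => (hCv t₀ i j).trans (le_abs_self _)) i j).trans ?_
    have h2 := Real.exp_pos (β * (t - t₀))
    rw [hα', add_mul, ← hn]
    nlinarith
  have hlim : ∀ i j, Filter.Tendsto (fun t => Φ t 0 i j) Filter.atTop (nhds 0) := fun i j => by
    refine squeeze_zero_norm' (a := fun t => α * Real.exp (-β * t))
      ((Filter.eventually_ge_atTop 0).mono fun t ht => by simpa using hdec 0 t ht i j) ?_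
    rw [← mul_zero α]
    refine (Real.tendsto_exp_atBot.comp ?_).const_mul α
    exact Filter.tendsto_id.const_mul_atTop_of_neg (by linarith)
  have hlim' : ∀ i j, Filter.Tendsto (fun t => (W t * (Φ 0 t)ᵀ * (W 0)⁻¹) i j)
      Filter.atBot (nhds 0) := fun i j => by
    refine squeeze_zero_norm' (a := fun t => α' * Real.exp (β * t))
      ((Filter.eventually_le_atBot 0).mono fun t ht => by simpa using hdec' 0 t ht i j) ?_
    rw [← mul_zero α']
    refine (Real.tendsto_exp_atBot.comp ?_).const_mul α'
    exact Filter.tendsto_id.const_mul_atBot hβ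
  refine ⟨W, hWu, ⟨?_, hFeq ▸ ?_⟩, fun Ψ hΨ Z hZΨ hZG t => hWZ Z (fun t τ => ?_) hZG t⟩
  · obtain ⟨P, hP, hPe⟩ := exists_riccati_of_optimalSynthesis hAB hc hK hcan.bounded_K hΦ hlim
      fun v t₀ t₁ h => hsyn ▸ mem_optimalSynthesis_feedbackCost hA hB hK hR0
        (fun t => hΦ.hasDerivAt_mulVec v t 0) h
    exact ⟨P, hP, hPe, hcan.stable⟩
  · obtain ⟨P, hP, hPe⟩ := exists_riccati_of_optimalSynthesis hAB hc hLc hLb hΦ' hlim'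
      fun v t₀ t₁ h => hsyn ▸ hsyn' ▸ mem_optimalSynthesis_feedbackCost hA hB hLc hR0
        (fun t => hΦ'.hasDerivAt_mulVec v t 0) h
    exact ⟨P, hP, hPe, _, hΦ', α', hα'0, β, hβ, hdec'⟩
  · have : Φ t τ = Ψ t τ := linear_unique_matrix hF (fun s => hΦ.hasMatDerivAt s τ)
      (fun s => hΨ.hasMatDerivAt s τ) τ (by rw [hΦ.self, hΨ.self]) t
    rw [this]
    exact hZΨ t τ

end Canonical

/-! ### A product structure yields a product form -/

section BlockDiag

variable {N p' q' r' : ℕ} {p q r : Fin N → ℕ}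

/-- The position of the `a`-th coordinate of the `i`-th block. -/
def blockEquiv (hp : ∑ i, p i = p') : (Σ i, Fin (p i)) ≃ Fin p' :=
  finSigmaFinEquiv.trans (finCongr hp)

theorem blockDiag_eq_submatrix (hp : ∑ i, p i = p') (hq : ∑ i, q i = q')
    (D : ∀ i, Matrix (Fin (p i)) (Fin (q i)) ℝ) : blockDiag hp hq D =
      (Matrix.blockDiagonal' D).submatrix (blockEquiv hp).symm (blockEquiv hq).symm := rfl

theorem blockDiag_apply (hp : ∑ i, p i = p') (hq : ∑ i, q i = q')
    (D : ∀ i, Matrix (Fin (p i)) (Fin (q i)) ℝ) (i : Fin N) (a : Fin (p i)) (b : Fin (q i)) :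
    blockDiag hp hq D (blockEquiv hp ⟨i, a⟩) (blockEquiv hq ⟨i, b⟩) = D i a b := by
  simp [blockDiag_eq_submatrix, blockDiagonal'_apply_eq]

theorem blockDiag_mul (hp : ∑ i, p i = p') (hq : ∑ i, q i = q') (hr : ∑ i, r i = r')
    (D : ∀ i, Matrix (Fin (p i)) (Fin (q i)) ℝ) (E : ∀ i, Matrix (Fin (q i)) (Fin (r i)) ℝ) :
    blockDiag hp hq D * blockDiag hq hr E = blockDiag hp hr fun i => D i * E i := by
  simp only [blockDiag_eq_submatrix, submatrix_mul_equiv, blockDiagonal'_mul]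

theorem blockDiag_transpose (hp : ∑ i, p i = p') (hq : ∑ i, q i = q')
    (D : ∀ i, Matrix (Fin (p i)) (Fin (q i)) ℝ) :
    (blockDiag hp hq D)ᵀ = blockDiag hq hp fun i => (D i)ᵀ := by
  simp only [blockDiag_eq_submatrix, transpose_submatrix, blockDiagonal'_transpose]

end BlockDiag

/-- The coordinate projections onto the first block. They are nontrivial on the states because there
are at least two blocks, all of positive size. -/
theorem IsProduct.exists_projection {n m : ℕ} {A : ℝ → Matrix (Fin n) (Fin n) ℝ}
    {B : ℝ → Matrix (Fin n) (Fin m) ℝ} {R : ℝ → Matrix (Fin m) (Fin m) ℝ}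
    (h : IsProduct A B R) :
    ∃ (E : Matrix (Fin n) (Fin n) ℝ) (E' : Matrix (Fin m) (Fin m) ℝ),
      E * E = E ∧ Eᵀ = E ∧ E'ᵀ = E' ∧ E ≠ 0 ∧ E ≠ 1 ∧
      ∀ t, E * A t = A t * E ∧ E * B t = B t * E' ∧ E' * R t = R t * E' := by
  obtain ⟨N, hN, d, k, hd, hk, hdk, A', B', R', -, hABR⟩ := h
  let i₀ : Fin N := ⟨0, by omega⟩
  let i₁ : Fin N := ⟨1, hN⟩
  have hd0 : ∀ i, 0 < d i := fun i => (hdk i).1.trans_le (hdk i).2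
  refine ⟨blockDiag hd hd fun i => if i = i₀ then 1 else 0,
    blockDiag hk hk fun i => if i = i₀ then 1 else 0, ?_, ?_, ?_, fun h => ?_, fun h => ?_,
    fun t => ⟨?_, ?_, ?_⟩⟩
  · rw [blockDiag_mul]
    congr 1
    funext i
    split_ifs <;> simp
  · rw [blockDiag_transpose]
    congr 1
    funext i
    split_ifs <;> simp
  · rw [blockDiag_transpose]
    congr 1
    funext i
    split_ifs <;> simp
  · have h1 := blockDiag_apply hd hd
      (fun i => if i = i₀ then (1 : Matrix (Fin (d i)) (Fin (d i)) ℝ) else 0) i₀ ⟨0, hd0 _⟩ ⟨0, hd0 _⟩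
    rw [h] at h1
    simp at h1
  · have h1 := blockDiag_apply hd hd
      (fun i => if i = i₀ then (1 : Matrix (Fin (d i)) (Fin (d i)) ℝ) else 0) i₁ ⟨0, hd0 _⟩ ⟨0, hd0 _⟩
    rw [h, if_neg (by simp [i₀, i₁])] at h1
    simp at h1
  · rw [(hABR t).1, blockDiag_mul, blockDiag_mul]
    congr 1
    funext i
    split_ifs <;> simp
  · rw [(hABR t).2.1, blockDiag_mul, blockDiag_mul]
    congr 1
    funext i
    split_ifs <;> simp
  · rw [(hABR t).2.2, blockDiag_mul, blockDiag_mul]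
    congr 1
    funext i
    split_ifs <;> simp

/-! ### Projections commuting with the dynamics -/

section Form

variable {ι κ : Type*} [Fintype ι] [Fintype κ] [DecidableEq ι] [DecidableEq κ]

theorem mul_inv_self_of_isUnit {M : Matrix ι ι ℝ} (h : IsUnit M) : M * M⁻¹ = 1 :=
  mul_nonsing_inv _ ((Matrix.isUnit_iff_isUnit_det _).1 h)

theorem inv_mul_self_of_isUnit {M : Matrix ι ι ℝ} (h : IsUnit M) : M⁻¹ * M = 1 :=
  nonsing_inv_mul _ ((Matrix.isUnit_iff_isUnit_det _).1 h)

/-- A matrix commuting with a projection leaves its range and its kernel invariant. -/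
theorem mulVec_mem_range_ker {E X : Matrix ι ι ℝ} (h : E * X = X * E) :
    (∀ v ∈ LinearMap.range (toLin' E), X *ᵥ v ∈ LinearMap.range (toLin' E)) ∧
      ∀ v ∈ LinearMap.ker (toLin' E), X *ᵥ v ∈ LinearMap.ker (toLin' E) := by
  refine ⟨?_, fun v hv => ?_⟩
  · rintro _ ⟨w, rfl⟩
    refine ⟨X *ᵥ w, ?_⟩
    simp only [toLin'_apply, mulVec_mulVec, h]
  · rw [LinearMap.mem_ker, toLin'_apply] at hv ⊢
    rw [mulVec_mulVec, h, ← mulVec_mulVec, hv, mulVec_zero]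

theorem hasMatDerivAt_changeCoord {M F : ℝ → Matrix ι ι ℝ} {Φ : ℝ → ℝ → Matrix ι ι ℝ}
    (hM : SmoothMap M) (hMu : ∀ t, IsUnit (M t)) (hΦ : IsTransitionMatrix F Φ) (t τ : ℝ) :
    HasMatDerivAt (fun s => (M s)⁻¹ * Φ s τ) (changeCoord M F t * ((M t)⁻¹ * Φ t τ)) t := by
  refine ((hasMatDerivAt_inv hMu (hM.hasMatDerivAt t)).mul (hΦ.hasMatDerivAt t τ)).congr_deriv ?_
  have h1 : changeCoord M F t * ((M t)⁻¹ * Φ t τ) =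
      -((M t)⁻¹ * matDeriv M t * (M t)⁻¹ * Φ t τ) + (M t)⁻¹ * F t * (M t * (M t)⁻¹) * Φ t τ := by
    simp only [changeCoord, Matrix.mul_add, Matrix.add_mul, Matrix.mul_neg, Matrix.neg_mul,
      Matrix.mul_assoc]
  rw [h1, mul_inv_self_of_isUnit (hMu t), Matrix.mul_one, Matrix.neg_mul, Matrix.mul_assoc _ (F t)]

theorem continuous_changeCoord {M F : ℝ → Matrix ι ι ℝ} (hM : SmoothMap M)
    (hMu : ∀ t, IsUnit (M t)) (hF : Continuous F) : Continuous (changeCoord M F) :=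
  (hM.inv hMu).continuous.matrix_mul (hM.matDeriv.continuous.neg.add (hF.matrix_mul hM.continuous))

/-- In the coordinates M⁻¹x, both sides solve the same linear equation and agree at τ. -/
theorem conj_comm_transition {M F : ℝ → Matrix ι ι ℝ} {Φ : ℝ → ℝ → Matrix ι ι ℝ}
    (hM : SmoothMap M) (hMu : ∀ t, IsUnit (M t)) (hF : Continuous F)
    (hΦ : IsTransitionMatrix F Φ) {E : Matrix ι ι ℝ}
    (h : ∀ t, E * changeCoord M F t = changeCoord M F t * E) (t τ : ℝ) :
    M t * E * (M t)⁻¹ * Φ t τ = Φ t τ * (M τ * E * (M τ)⁻¹) := by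
  have hV := fun t => hasMatDerivAt_changeCoord hM hMu hΦ t τ
  have h1 : E * ((M t)⁻¹ * Φ t τ) = (M t)⁻¹ * Φ t τ * (M τ * E * (M τ)⁻¹) := by
    refine linear_unique_matrix (X := fun t => E * ((M t)⁻¹ * Φ t τ))
      (Y := fun t => (M t)⁻¹ * Φ t τ * (M τ * E * (M τ)⁻¹))
      (continuous_changeCoord hM hMu hF) (fun s => ((hV s).const_mul E).congr_deriv ?_)
      (fun s => ((hV s).mul_const _).congr_deriv ?_) τ ?_ t
    · rw [← Matrix.mul_assoc, h, Matrix.mul_assoc]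
    · simp only [Matrix.mul_assoc]
    · simp only [hΦ.self, Matrix.mul_one]
      rw [← Matrix.mul_assoc, ← Matrix.mul_assoc, inv_mul_self_of_isUnit (hMu τ), Matrix.one_mul]
  calc _ = M t * (E * ((M t)⁻¹ * Φ t τ)) := by simp only [Matrix.mul_assoc]
    _ = M t * (M t)⁻¹ * Φ t τ * (M τ * E * (M τ)⁻¹) := by rw [h1]; simp only [Matrix.mul_assoc]
    _ = _ := by rw [mul_inv_self_of_isUnit (hMu t), Matrix.one_mul]

theorem comm_inv {E X : Matrix ι ι ℝ} (hX : IsUnit X) (h : E * X = X * E) :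
    E * X⁻¹ = X⁻¹ * E := by
  calc _ = X⁻¹ * X * E * X⁻¹ := by rw [inv_mul_self_of_isUnit hX, Matrix.one_mul]
    _ = X⁻¹ * (X * E) * X⁻¹ := by simp only [Matrix.mul_assoc]
    _ = X⁻¹ * E * (X * X⁻¹) := by rw [← h]; simp only [Matrix.mul_assoc]
    _ = _ := by rw [mul_inv_self_of_isUnit hX, Matrix.mul_one]

end Form

/-- The decomposition is given by the range and kernel of a block projection E. It preserves the
stable mapping by assumption; for the anti-stable one, ZG = GZᵀ and ZW = WZᵀ imply that Z = M E M⁻¹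
commutes with G W⁻¹. -/
theorem admitsProductForm_of_productStructure {n m : ℕ}
    {A : ℝ → Matrix (Fin n) (Fin n) ℝ} {B : ℝ → Matrix (Fin n) (Fin m) ℝ}
    (hAB : DynamicsAssumption A B)
    {Q : ℝ → Matrix (Fin n) (Fin n) ℝ} {S : ℝ → Matrix (Fin n) (Fin m) ℝ}
    {R₀ : ℝ → Matrix (Fin m) (Fin m) ℝ} (hc : CostAssumption Q S R₀)
    {K : ℝ → Matrix (Fin m) (Fin n) ℝ} {R : ℝ → Matrix (Fin m) (Fin m) ℝ}
    (hcan : IsCanonicalCost A B K R) (hprod : AdmitsProductStructure A B K R)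
    (hsyn : optimalSynthesis A B (feedbackCost K R) = optimalSynthesis A B (quadCost Q S R₀)) :
    AdmitsProductForm A B Q S R₀ := by
  obtain ⟨W, hWu, hmaps, hWZ⟩ := hcan.exists_areSynthesisMappings hAB hc hsyn
  obtain ⟨M, U, hM, hMu, hU, hUu, hprod⟩ := hprod
  obtain ⟨E, E', hE, hEs, hE's, hE0, hE1, hcomm⟩ := hprod.exists_projection
  have hF : Continuous fun t => A t - B t * K t :=
    hAB.smooth_A.continuous.sub (hAB.smooth_B.continuous.matrix_mul hcan.smooth_K.continuous)
  obtain ⟨Φ, hΦ, -⟩ := hcan.stable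
  set G : ℝ → Matrix (Fin n) (Fin n) ℝ := fun t => B t * (R t)⁻¹ * (B t)ᵀ with hG
  have hRu := hcan.posDef_R.isUnit
  have hM1 : ∀ t, M t * (M t)⁻¹ = 1 := fun t => mul_inv_self_of_isUnit (hMu t)
  have hM2 : ∀ t, (M t)⁻¹ * M t = 1 := fun t => inv_mul_self_of_isUnit (hMu t)
  -- B R⁻¹ Bᵀ does not depend on the input frame, so in state coordinates it is B' R'⁻¹ B'ᵀ with
  -- block-diagonal factors.
  have hEG : ∀ t, E * ((M t)⁻¹ * G t * ((M t)⁻¹)ᵀ) = (M t)⁻¹ * G t * ((M t)⁻¹)ᵀ * E := by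
    intro t
    set B' := (M t)⁻¹ * B t * U t with hB'
    set R' := (U t)ᵀ * R t * U t with hR'
    have hR'u : IsUnit R' := (((isUnit_transpose _).2 (hUu t)).mul (hRu t)).mul (hUu t)
    have hb : E * B' = B' * E' := (hcomm t).2.1
    have hbt : B'ᵀ * E = E' * B'ᵀ := by
      have := congrArg Matrix.transpose hb
      rwa [transpose_mul E, transpose_mul B', hEs, hE's] at this
    have hr : E' * R'⁻¹ = R'⁻¹ * E' := comm_inv hR'u (hcomm t).2.2
    have hGe : (M t)⁻¹ * G t * ((M t)⁻¹)ᵀ = B' * R'⁻¹ * B'ᵀ := by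
      have h1 : U t * R'⁻¹ * (U t)ᵀ = (R t)⁻¹ := by
        rw [hR', Matrix.mul_inv_rev, Matrix.mul_inv_rev, ← transpose_nonsing_inv]
        calc _ = U t * (U t)⁻¹ * (R t)⁻¹ * (((U t)⁻¹)ᵀ * (U t)ᵀ) := by
              simp only [Matrix.mul_assoc]
          _ = _ := by
            rw [← transpose_mul, mul_inv_self_of_isUnit (hUu t), transpose_one, Matrix.mul_one,
              Matrix.one_mul]
      simp only [hG]
      rw [← h1, hB']
      simp only [transpose_mul, Matrix.mul_assoc]
    rw [hGe, ← Matrix.mul_assoc, ← Matrix.mul_assoc, hb, Matrix.mul_assoc B', hr,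
      Matrix.mul_assoc _ B'ᵀ, hbt]
    simp only [Matrix.mul_assoc]
  have hGM : ∀ t, G t = M t * ((M t)⁻¹ * G t * ((M t)⁻¹)ᵀ) * (M t)ᵀ := fun t => by
    calc _ = M t * (M t)⁻¹ * G t * (((M t)⁻¹)ᵀ * (M t)ᵀ) := by
          rw [← transpose_mul, hM1, transpose_one, Matrix.one_mul, Matrix.mul_one]
      _ = _ := by simp only [Matrix.mul_assoc]
  have hZG : ∀ t, M t * E * (M t)⁻¹ * G t = G t * (M t * E * (M t)⁻¹)ᵀ := by
    intro t
    have h2 := hEG t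
    have h3 := hGM t
    set X := (M t)⁻¹ * G t * ((M t)⁻¹)ᵀ
    rw [h3]
    calc _ = M t * E * ((M t)⁻¹ * M t) * X * (M t)ᵀ := by simp only [Matrix.mul_assoc]
      _ = M t * (E * X) * (M t)ᵀ := by rw [hM2, Matrix.mul_one]; simp only [Matrix.mul_assoc]
      _ = M t * X * (((M t)⁻¹ * M t)ᵀ * E) * (M t)ᵀ := by
        rw [h2, hM2, transpose_one, Matrix.one_mul]; simp only [Matrix.mul_assoc]
      _ = _ := by simp only [transpose_mul, hEs, Matrix.mul_assoc]
  have hZΦ := conj_comm_transition hM hMu hF hΦ fun t => (hcomm t).1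
  have hZW := hWZ Φ hΦ (fun t => M t * E * (M t)⁻¹) hZΦ hZG
  have hEm : ∀ t, E * changeCoord M (fun t => A t - B t * K t + G t * (W t)⁻¹) t =
      changeCoord M (fun t => A t - B t * K t + G t * (W t)⁻¹) t * E := by
    intro t
    set Z := M t * E * (M t)⁻¹ with hZ
    have hZWt : Z * W t = W t * Zᵀ := hZW t
    have hZGt : Z * G t = G t * Zᵀ := hZG t
    have h1 : Zᵀ * (W t)⁻¹ = (W t)⁻¹ * Z := by
      calc _ = (W t)⁻¹ * (W t * Zᵀ) * (W t)⁻¹ := by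
            rw [← Matrix.mul_assoc, inv_mul_self_of_isUnit (hWu t), Matrix.one_mul]
        _ = (W t)⁻¹ * Z * (W t * (W t)⁻¹) := by rw [← hZWt]; simp only [Matrix.mul_assoc]
        _ = _ := by rw [mul_inv_self_of_isUnit (hWu t), Matrix.mul_one]
    have h2 : Z * (G t * (W t)⁻¹) = G t * (W t)⁻¹ * Z := by
      rw [← Matrix.mul_assoc, hZGt, Matrix.mul_assoc (G t), h1, ← Matrix.mul_assoc]
    have h3 : E * ((M t)⁻¹ * (G t * (W t)⁻¹) * M t) =
        (M t)⁻¹ * (G t * (W t)⁻¹) * M t * E := by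
      calc _ = (M t)⁻¹ * M t * E * ((M t)⁻¹ * (G t * (W t)⁻¹) * M t) := by
            rw [hM2, Matrix.one_mul]
        _ = (M t)⁻¹ * (Z * (G t * (W t)⁻¹)) * M t := by simp only [hZ, Matrix.mul_assoc]
        _ = (M t)⁻¹ * (G t * (W t)⁻¹) * M t * E * ((M t)⁻¹ * M t) := by
          rw [h2]; simp only [hZ, Matrix.mul_assoc]
        _ = _ := by rw [hM2, Matrix.mul_one]
    have h4 : changeCoord M (fun t => A t - B t * K t + G t * (W t)⁻¹) t =
        changeCoord M (fun t => A t - B t * K t) t + (M t)⁻¹ * (G t * (W t)⁻¹) * M t := by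
      simp only [changeCoord, Matrix.add_mul, Matrix.mul_add, Matrix.mul_assoc]
      abel
    rw [h4, Matrix.mul_add, Matrix.add_mul, h3, (hcomm t).1]
  have hEid : IsIdempotentElem (toLin' E) := by
    rw [IsIdempotentElem, Module.End.mul_eq_comp, ← Matrix.toLin'_mul, hE]
  refine ⟨_, _, hmaps, LinearMap.range (toLin' E), LinearMap.ker (toLin' E),
    LinearMap.IsIdempotentElem.isCompl hEid, fun h => hE0 ?_, fun h => hE1 ?_, M, hM, hMu,
    fun t => ⟨fun v hv => ⟨(mulVec_mem_range_ker (hcomm t).1).1 v hv,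
      (mulVec_mem_range_ker (hEm t)).1 v hv⟩, fun v hv =>
      ⟨(mulVec_mem_range_ker (hcomm t).1).2 v hv, (mulVec_mem_range_ker (hEm t)).2 v hv⟩⟩⟩
  · rw [LinearMap.range_eq_bot] at h
    exact (toLin').injective (by rw [h, map_zero])
  · rw [LinearMap.ker_eq_bot] at h
    refine toLin'.injective (LinearMap.ext fun v => ?_)
    refine h ?_
    simp only [toLin'_apply, mulVec_mulVec, hE, Matrix.one_mulVec]

/-! ### Simultaneous diagonalization -/

section Diagonalization

variable {ι : Type*} [Fintype ι] [DecidableEq ι]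

theorem exists_orthogonal_diagonal {X : Matrix ι ι ℝ} (hX : X.IsSymm) :
    ∃ (O : Matrix ι ι ℝ) (d : ι → ℝ), Oᵀ * O = 1 ∧ Oᵀ * X * O = diagonal d := by
  have hX' : X.IsHermitian := by rw [Matrix.IsHermitian, conjTranspose_eq_transpose_of_trivial, hX.eq]
  have h2 := hX'.spectral_theorem
  rw [Unitary.conjStarAlgAut_apply] at h2
  obtain ⟨O, hO⟩ : ∃ O : Matrix ι ι ℝ, O = hX'.eigenvectorUnitary := ⟨_, rfl⟩
  have h1 : Oᵀ * O = 1 := by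
    rw [← conjTranspose_eq_transpose_of_trivial, ← star_eq_conjTranspose, hO]
    exact Unitary.coe_star_mul_self _
  have h3 : X = O * diagonal (RCLike.ofReal ∘ hX'.eigenvalues) * Oᵀ := by
    rwa [← conjTranspose_eq_transpose_of_trivial, ← star_eq_conjTranspose, hO]
  refine ⟨O, RCLike.ofReal ∘ hX'.eigenvalues, h1, ?_⟩
  calc Oᵀ * X * O = Oᵀ * (O * diagonal (RCLike.ofReal ∘ hX'.eigenvalues) * Oᵀ) * O := by rw [← h3]
    _ = Oᵀ * O * diagonal (RCLike.ofReal ∘ hX'.eigenvalues) * (Oᵀ * O) := by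
      simp only [Matrix.mul_assoc]
    _ = _ := by rw [h1, Matrix.one_mul, Matrix.mul_one]

/-- Diagonalize D, scale it to the identity, then rotate: an orthogonal matrix diagonalizing X keeps
the identity. -/
theorem exists_simultaneous_diagonal {D X : Matrix ι ι ℝ} (hD : D.IsSymm)
    (hD0 : ∀ v, 0 ≤ v ⬝ᵥ (D *ᵥ v)) (hDu : IsUnit D) (hX : X.IsSymm) :
    ∃ (N : Matrix ι ι ℝ) (d : ι → ℝ), IsUnit N ∧ Nᵀ * D * N = 1 ∧ Nᵀ * X * N = diagonal d := by
  obtain ⟨O, e, hO, he⟩ := exists_orthogonal_diagonal hD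
  have hOu : IsUnit O := IsUnit.of_mul_eq_one_right _ hO
  have he0 : ∀ i, 0 < e i := by
    intro i
    refine lt_of_le_of_ne ?_ fun h => ?_
    · have h1 : e i = Pi.single i 1 ⬝ᵥ (diagonal e *ᵥ Pi.single i 1) := by simp
      rw [h1, ← he, ← mulVec_mulVec, ← mulVec_mulVec, dot_mulVec_comm, transpose_transpose]
      exact hD0 _
    · have h1 : IsUnit (diagonal e) := he ▸ (((isUnit_transpose _).2 hOu).mul hDu).mul hOu
      rw [isUnit_diagonal, Pi.isUnit_iff] at h1
      exact (h1 i).ne_zero h.symm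
  set T : Matrix ι ι ℝ := diagonal fun i => (√(e i))⁻¹ with hT
  have hTt : Tᵀ = T := diagonal_transpose _
  have hTT : T * diagonal e * T = 1 := by
    rw [hT, diagonal_mul_diagonal, diagonal_mul_diagonal, ← diagonal_one]
    congr 1
    funext i
    have h1 : √(e i) ≠ 0 := (Real.sqrt_pos.2 (he0 i)).ne'
    have h2 := Real.mul_self_sqrt (he0 i).le
    field_simp
    nlinarith
  have hX' : (((O * T)ᵀ * X) * (O * T)).IsSymm := by
    rw [Matrix.IsSymm, transpose_mul, transpose_mul _ X, transpose_transpose, hX.eq,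
      Matrix.mul_assoc]
  obtain ⟨V, d, hV, hd⟩ := exists_orthogonal_diagonal hX'
  have h1 : (O * T * V)ᵀ * D * (O * T * V) = 1 := by
    calc _ = Vᵀ * (T * (Oᵀ * D * O) * T) * V := by
          simp only [transpose_mul, hTt, Matrix.mul_assoc]
      _ = 1 := by rw [he, hTT, Matrix.mul_one, hV]
  refine ⟨O * T * V, d, IsUnit.of_mul_eq_one_right _ h1, h1, ?_⟩
  rw [← hd]
  simp only [transpose_mul, Matrix.mul_assoc]

theorem apply_eq_zero_of_comm_diagonal {X : Matrix ι ι ℝ} {d : ι → ℝ}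
    (h : X * diagonal d = diagonal d * X) {i j : ι} (hij : d i ≠ d j) : X i j = 0 := by
  have h1 := congrFun (congrFun h i) j
  rw [mul_diagonal, diagonal_mul] at h1
  have h2 : (d i - d j) * X i j = 0 := by linarith
  exact (mul_eq_zero.1 h2).resolve_left (sub_ne_zero.2 hij)

/-- The symmetric matrices `Γ` such that `Γ D` commutes with a nontrivial projection are
simultaneously block diagonal in coordinates in which `D` is the identity. -/
theorem exists_block_coordinates {D Z : Matrix ι ι ℝ} (hD : D.IsSymm)
    (hD0 : ∀ v, 0 ≤ v ⬝ᵥ (D *ᵥ v)) (hDu : IsUnit D) (hZ : Z * Z = Z) (hZ0 : Z ≠ 0) (hZ1 : Z ≠ 1) :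
    ∃ (N : Matrix ι ι ℝ) (c : ι → Fin 2), IsUnit N ∧ Function.Surjective c ∧
      ∀ Γ : Matrix ι ι ℝ, Γᵀ = Γ → Z * (Γ * D) = Γ * D * Z →
        ∀ i j, c i ≠ c j → (N⁻¹ * Γ * (N⁻¹)ᵀ) i j = 0 := by
  -- Z need not be orthogonal for D. Its eigenspaces are replaced by those of the form ZᵀDZ: in
  -- coordinates where D = 1, a symmetric Γ commuting with Z commutes with Zᵀ, hence with ZᵀZ.
  have hX : (Zᵀ * D * Z).IsSymm := by
    rw [Matrix.IsSymm, transpose_mul, transpose_mul, transpose_transpose, hD.eq, Matrix.mul_assoc]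
  obtain ⟨N, d, hN, hND, hNX⟩ := exists_simultaneous_diagonal hD hD0 hDu hX
  have hN1 := mul_inv_self_of_isUnit hN
  have hN2 := inv_mul_self_of_isUnit hN
  have hNt1 : (N⁻¹)ᵀ * Nᵀ = 1 := by rw [← transpose_mul, hN1, transpose_one]
  have hNi : N⁻¹ = Nᵀ * D := inv_eq_left_inv hND
  have hNit : (N⁻¹)ᵀ = D * N := by rw [hNi, transpose_mul, transpose_transpose, hD.eq]
  -- Without a zero entry Z would be invertible, hence 1; with only zeros it would vanish. The two
  -- classes are the zero and the nonzero entries.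
  have hd0 : ∃ i, d i = 0 := by
    by_contra! h
    have h1 : IsUnit (diagonal d) := isUnit_diagonal.2 (Pi.isUnit_iff.2 fun i => (h i).isUnit)
    rw [← hNX, ← Matrix.mul_assoc, Matrix.mul_assoc] at h1
    have h2 : IsUnit (Z * N) := isUnit_of_mul_isUnit_right h1
    have h3 : IsUnit Z := isUnit_of_mul_isUnit_left h2
    exact hZ1 (h3.mul_left_cancel (by rw [hZ, Matrix.mul_one]))
  have hd1 : ∃ i, d i ≠ 0 := by
    by_contra! h
    have h1 : (N⁻¹ * Z * N)ᴴ * (N⁻¹ * Z * N) = 0 := by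
      rw [conjTranspose_eq_transpose_of_trivial]
      have h2 : (N⁻¹)ᵀ * N⁻¹ = D := by rw [hNit, Matrix.mul_assoc, hN1, Matrix.mul_one]
      calc _ = Nᵀ * (Zᵀ * ((N⁻¹)ᵀ * N⁻¹) * Z) * N := by simp only [transpose_mul, Matrix.mul_assoc]
        _ = 0 := by rw [h2, hNX, show d = 0 from funext h, diagonal_zero']
    rw [conjTranspose_mul_self_eq_zero] at h1
    refine hZ0 ?_
    calc Z = N * N⁻¹ * Z * (N * N⁻¹) := by rw [hN1, Matrix.one_mul, Matrix.mul_one]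
      _ = N * (N⁻¹ * Z * N) * N⁻¹ := by simp only [Matrix.mul_assoc]
      _ = 0 := by rw [h1, Matrix.mul_zero, Matrix.zero_mul]
  refine ⟨N, fun i => if d i = 0 then 0 else 1, hN, fun b => ?_, fun Γ hΓ hc i j hij => ?_⟩
  · obtain ⟨i₀, h0⟩ := hd0
    obtain ⟨i₁, h1⟩ := hd1
    fin_cases b
    · exact ⟨i₀, by simp [h0]⟩
    · exact ⟨i₁, by simp [h1]⟩
  · refine apply_eq_zero_of_comm_diagonal (d := d) ?_ fun h => hij (by simp only [h])
    have hct : D * Γ * Zᵀ = Zᵀ * D * Γ := by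
      have := congrArg Matrix.transpose hc
      simp only [transpose_mul, hΓ, hD.eq] at this
      rw [this, Matrix.mul_assoc]
    rw [← hNX]
    calc _ = N⁻¹ * Γ * ((N⁻¹)ᵀ * Nᵀ) * Zᵀ * D * Z * N := by simp only [Matrix.mul_assoc]
      _ = Nᵀ * (D * Γ * Zᵀ) * D * Z * N := by
        rw [hNt1, Matrix.mul_one, hNi]; simp only [Matrix.mul_assoc]
      _ = Nᵀ * Zᵀ * D * (Γ * D * Z) * N := by rw [hct]; simp only [Matrix.mul_assoc]
      _ = Nᵀ * Zᵀ * D * (Z * (Γ * D)) * N := by rw [hc]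
      _ = Nᵀ * Zᵀ * D * Z * (N * N⁻¹) * Γ * D * N := by
        rw [hN1, Matrix.mul_one]; simp only [Matrix.mul_assoc]
      _ = _ := by rw [hNit]; simp only [Matrix.mul_assoc]

end Diagonalization

/-! ### The difference of two solutions of the Riccati equation -/

section Difference

variable {ι κ : Type*} [Fintype ι] [Fintype κ] [DecidableEq κ]
  {A : ℝ → Matrix ι ι ℝ} {B : ℝ → Matrix ι κ ℝ}
  {Q : ℝ → Matrix ι ι ℝ} {S : ℝ → Matrix ι κ ℝ} {R : ℝ → Matrix κ κ ℝ}

/-- The quadratic terms are absorbed by using one closed loop on each side, which makes the equation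
linear in the difference. -/
theorem IsRiccatiSolution.hasMatDerivAt_sub {P P' : ℝ → Matrix ι ι ℝ}
    (hP : IsRiccatiSolution A B Q S R P) (hP' : IsRiccatiSolution A B Q S R P')
    (hR : ∀ t, (R t).IsSymm) (t : ℝ) :
    HasMatDerivAt (fun t => P t - P' t)
      (-((closedLoop A B S R P t)ᵀ * (P t - P' t)) -
        (P t - P' t) * closedLoop A B S R P' t) t := by
  refine ((hP.2 t).sub (hP'.2 t)).congr_deriv ?_
  have hT : ((R t)⁻¹)ᵀ = (R t)⁻¹ := by rw [transpose_nonsing_inv, (hR t).eq]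
  simp only [closedLoop, transpose_sub, transpose_mul, transpose_add, transpose_transpose, hT,
    (hP.1 t).eq, Matrix.mul_add, Matrix.add_mul, Matrix.mul_sub, Matrix.sub_mul, Matrix.mul_assoc]
  abel

theorem closedLoop_sub (P P' : ℝ → Matrix ι ι ℝ) (t : ℝ) :
    closedLoop A B S R P' t =
      closedLoop A B S R P t + B t * (R t)⁻¹ * (B t)ᵀ * (P t - P' t) := by
  simp only [closedLoop, Matrix.mul_add, Matrix.mul_sub, Matrix.mul_assoc]
  abel

end Difference

/-! ### Positivity of the difference of the two solutions -/

section Duality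

variable {ι : Type*} [Fintype ι] [DecidableEq ι] {F F' G D : ℝ → Matrix ι ι ℝ}
  {Φ Φ' : ℝ → ℝ → Matrix ι ι ℝ}

/-- D intertwines the flow of F' with the adjoint flow of F: both sides solve ẏ = -Fᵀy. -/
theorem duality (hΦ : IsTransitionMatrix F Φ) (hF : Continuous F)
    (hΦ' : IsTransitionMatrix F' Φ')
    (hD : ∀ t, HasMatDerivAt D (-((F t)ᵀ * D t) - D t * F' t) t) (t : ℝ) :
    D t * Φ' t 0 = (Φ 0 t)ᵀ * D 0 := by
  refine linear_unique_matrix (N := fun t => -(F t)ᵀ) (X := fun t => D t * Φ' t 0)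
    (Y := fun t => (Φ 0 t)ᵀ * D 0) hF.matrix_transpose.neg (fun s => ?_) (fun s => ?_) 0 ?_ t
  · refine ((hD s).mul (hΦ'.hasMatDerivAt s 0)).congr_deriv ?_
    simp only [Matrix.sub_mul, Matrix.neg_mul, Matrix.mul_assoc]
    abel
  · refine ((hΦ.hasMatDerivAt_right hF s 0).transpose.mul_const _).congr_deriv ?_
    simp only [transpose_neg, transpose_mul, Matrix.neg_mul, Matrix.mul_assoc]
  · simp [hΦ.self, hΦ'.self]

/-- Comparing the two flows leaves only F' - F = GD; by `duality`, D becomes the fixed matrix D(0)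
and the rest of the derivative is symmetric. -/
theorem hasMatDerivAt_scattering (hΦ : IsTransitionMatrix F Φ) (hF : Continuous F)
    (hΦ' : IsTransitionMatrix F' Φ') (hFF' : ∀ t, F' t = F t + G t * D t)
    (hD : ∀ t, HasMatDerivAt D (-((F t)ᵀ * D t) - D t * F' t) t) (t : ℝ) :
    HasMatDerivAt (fun t => Φ 0 t * Φ' t 0) (Φ 0 t * G t * (Φ 0 t)ᵀ * D 0) t := by
  refine ((hΦ.hasMatDerivAt_right hF t 0).mul (hΦ'.hasMatDerivAt t 0)).congr_deriv ?_
  rw [Matrix.mul_assoc _ _ (D 0), ← duality hΦ hF hΦ' hD, hFF']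
  simp only [Matrix.neg_mul, Matrix.add_mul, Matrix.mul_add, Matrix.mul_assoc]
  abel

/-- With H = Φ(0,t)Φ'(t,0), the function D(0)v · H(t)v increases from 0 at -∞ to D(0)v · v at time
0. If D(0)z = 0, then H(t)z is constantly z and tends to 0. -/
theorem dot_nonneg_of_tendsto (hΦ : IsTransitionMatrix F Φ) (hF : Continuous F)
    (hΦ' : IsTransitionMatrix F' Φ') (hFF' : ∀ t, F' t = F t + G t * D t)
    (hD : ∀ t, HasMatDerivAt D (-((F t)ᵀ * D t) - D t * F' t) t)
    (hG : ∀ t v, 0 ≤ v ⬝ᵥ (G t *ᵥ v))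
    (hlim : ∀ i j, Filter.Tendsto (fun t => (Φ 0 t * Φ' t 0) i j) Filter.atBot (nhds 0)) :
    (∀ v, 0 ≤ v ⬝ᵥ (D 0 *ᵥ v)) ∧ IsUnit (D 0) := by
  have hH := hasMatDerivAt_scattering hΦ hF hΦ' hFF' hD
  have hH0 : Φ 0 0 * Φ' 0 0 = 1 := by rw [hΦ.self, hΦ'.self, Matrix.one_mul]
  have hlimv : ∀ v, Filter.Tendsto (fun t => (Φ 0 t * Φ' t 0) *ᵥ v) Filter.atBot (nhds 0) := by
    intro v
    rw [tendsto_pi_nhds]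
    intro i
    simp only [mulVec, dotProduct, Pi.zero_apply]
    rw [← Finset.sum_const_zero (s := Finset.univ) (ι := ι)]
    refine tendsto_finsetSum _ fun j _ => ?_
    simpa using (hlim i j).mul_const (v j)
  refine ⟨fun v => ?_, ?_⟩
  · have hf : ∀ t, HasDerivAt (fun t => (D 0 *ᵥ v) ⬝ᵥ ((Φ 0 t * Φ' t 0) *ᵥ v))
        (((Φ 0 t)ᵀ *ᵥ (D 0 *ᵥ v)) ⬝ᵥ (G t *ᵥ ((Φ 0 t)ᵀ *ᵥ (D 0 *ᵥ v)))) t := by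
      intro t
      refine (hasDerivAt_dotProduct (hasDerivAt_const t _) ((hH t).mulVec_const v)).congr_deriv ?_
      rw [zero_dotProduct, zero_add, ← mulVec_mulVec, ← mulVec_mulVec, ← mulVec_mulVec,
        dot_mulVec_comm (Φ 0 t)]
    have hmono : Monotone fun t => (D 0 *ᵥ v) ⬝ᵥ ((Φ 0 t * Φ' t 0) *ᵥ v) :=
      monotone_of_hasDerivAt_nonneg hf fun t => hG t _
    have h0 : Filter.Tendsto (fun t => (D 0 *ᵥ v) ⬝ᵥ ((Φ 0 t * Φ' t 0) *ᵥ v))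
        Filter.atBot (nhds 0) := by
      have h1 : Continuous fun w : ι → ℝ => (D 0 *ᵥ v) ⬝ᵥ w := continuous_const.dotProduct continuous_id
      have h2 := (h1.tendsto 0).comp (hlimv v)
      rwa [dotProduct_zero] at h2
    have h2 := hmono.le_of_tendsto h0 0
    simp only [hH0, one_mulVec] at h2
    rwa [dotProduct_comm] at h2
  · refine Matrix.mulVec_injective_iff_isUnit.1 fun v w hvw => sub_eq_zero.1 ?_
    set z := v - w with hz
    have hDz : D 0 *ᵥ z = 0 := by rw [hz, mulVec_sub]; exact sub_eq_zero.2 hvw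
    have hc : ∀ t, (Φ 0 t * Φ' t 0) *ᵥ z = z := by
      intro t
      have h1 : ∀ t, HasDerivAt (fun t => (Φ 0 t * Φ' t 0) *ᵥ z) 0 t := fun t =>
        ((hH t).mulVec_const z).congr_deriv (by rw [← mulVec_mulVec, hDz, mulVec_zero])
      have h2 := is_const_of_deriv_eq_zero (fun t => (h1 t).differentiableAt)
        (fun t => (h1 t).deriv) t 0
      rwa [hH0, one_mulVec] at h2
    have h1 := hlimv z
    simp only [hc] at h1
    exact tendsto_nhds_unique tendsto_const_nhds h1

end Duality

/-! ### Block decomposition of the inputs -/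

section InputFrame

variable {ι κ : Type*} [Fintype ι] [Fintype κ] [DecidableEq κ]

theorem isUnit_transpose_mul_self {B : Matrix ι κ ℝ}
    (hB : Function.Injective fun v : κ → ℝ => B *ᵥ v) : IsUnit (Bᵀ * B) := by
  refine Matrix.mulVec_injective_iff_isUnit.1 fun v w hvw => hB (sub_eq_zero.1 ?_)
  have h1 : (Bᵀ * B) *ᵥ (v - w) = 0 := by rw [mulVec_sub]; exact sub_eq_zero.2 hvw
  have h2 : (B *ᵥ (v - w)) ⬝ᵥ (B *ᵥ (v - w)) = 0 := by
    rw [dot_mulVec_comm, mulVec_mulVec, h1, zero_dotProduct]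
  rw [dotProduct_self_eq_zero, mulVec_sub] at h2
  exact h2

/-- A projection commuting with `B R⁻¹ Bᵀ` restricts to a projection of the inputs. -/
theorem exists_input_projection {B : ℝ → Matrix ι κ ℝ} {R : ℝ → Matrix κ κ ℝ} {E : Matrix ι ι ℝ}
    (hB : SmoothMap B) (hBi : ∀ t, Function.Injective fun v : κ → ℝ => B t *ᵥ v)
    (hRs : ∀ t, (R t).IsSymm) (hRu : ∀ t, IsUnit (R t)) (hE : E * E = E) (hEs : Eᵀ = E)
    (hEG : ∀ t, E * (B t * (R t)⁻¹ * (B t)ᵀ) = B t * (R t)⁻¹ * (B t)ᵀ * E) :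
    ∃ Θ : ℝ → Matrix κ κ ℝ, SmoothMap Θ ∧
      ∀ t, Θ t * Θ t = Θ t ∧ E * B t = B t * Θ t ∧ (Θ t)ᵀ * R t = R t * Θ t := by
  have hu := fun t => isUnit_transpose_mul_self (hBi t)
  -- The smooth left inverse (BᵀB)⁻¹Bᵀ. As E preserves the range of B, the induced input map is Θ =
  -- J E B.
  obtain ⟨J, hJ, hJB⟩ : ∃ J : ℝ → Matrix κ ι ℝ, SmoothMap J ∧ ∀ t, J t * B t = 1 :=
    ⟨fun t => ((B t)ᵀ * B t)⁻¹ * (B t)ᵀ, ((hB.transpose.mul hB).inv hu).mul hB.transpose,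
      fun t => by rw [Matrix.mul_assoc, inv_mul_self_of_isUnit (hu t)]⟩
  have hBJ : ∀ t, (B t)ᵀ * (J t)ᵀ = 1 := fun t => by rw [← transpose_mul, hJB, transpose_one]
  refine ⟨fun t => J t * E * B t, (hJ.mul_const E).mul hB, fun t => ?_⟩
  have hR1 := mul_inv_self_of_isUnit (hRu t)
  have hR2 := inv_mul_self_of_isUnit (hRu t)
  set T := (R t)⁻¹ with hT
  have hTs : Tᵀ = T := by rw [hT, transpose_nonsing_inv, (hRs t).eq]
  have hEGt : E * (B t * T * (B t)ᵀ) = B t * T * (B t)ᵀ * E := hEG t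
  have h1 : E * B t = B t * (T * (B t)ᵀ * E * (J t)ᵀ * R t) := by
    calc _ = E * B t * (T * ((B t)ᵀ * (J t)ᵀ) * R t) := by
          rw [hBJ, Matrix.mul_one, hR2, Matrix.mul_one]
      _ = E * (B t * T * (B t)ᵀ) * (J t)ᵀ * R t := by simp only [Matrix.mul_assoc]
      _ = _ := by rw [hEGt]; simp only [Matrix.mul_assoc]
  have h2 : E * B t = B t * (J t * E * B t) := by
    rw [Matrix.mul_assoc (J t), h1, ← Matrix.mul_assoc (J t), hJB, Matrix.one_mul]
  refine ⟨?_, h2, ?_⟩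
  · calc _ = J t * E * (B t * (J t * E * B t)) := by simp only [Matrix.mul_assoc]
      _ = J t * (E * E) * B t := by rw [← h2]; simp only [Matrix.mul_assoc]
      _ = _ := by rw [hE]
  · have h3 : J t * E * B t * T = T * (J t * E * B t)ᵀ := by
      calc _ = J t * E * B t * T * ((B t)ᵀ * (J t)ᵀ) := by rw [hBJ, Matrix.mul_one]
        _ = J t * (E * (B t * T * (B t)ᵀ)) * (J t)ᵀ := by simp only [Matrix.mul_assoc]
        _ = J t * B t * T * ((B t)ᵀ * E * (J t)ᵀ) := by
          rw [hEGt]; simp only [Matrix.mul_assoc]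
        _ = _ := by
          rw [hJB, Matrix.one_mul]; simp only [transpose_mul, hEs, Matrix.mul_assoc]
    calc _ = R t * T * (J t * E * B t)ᵀ * R t := by rw [hR1, Matrix.one_mul]
      _ = R t * (J t * E * B t) * (T * R t) := by
        rw [Matrix.mul_assoc (R t) T, ← h3]; simp only [Matrix.mul_assoc]
      _ = _ := by rw [hR2, Matrix.mul_one]

/-- Invertibility comes from the solution V of the adjoint equation, for which VᵀU is constantly 1.
-/
theorem exists_smooth_frame {N : ℝ → Matrix κ κ ℝ} (hN : SmoothMap N) {X : Matrix κ κ ℝ}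
    (hX : IsUnit X) : ∃ U : ℝ → Matrix κ κ ℝ, SmoothMap U ∧ (∀ t, IsUnit (U t)) ∧ U 0 = X ∧
      ∀ t, HasMatDerivAt U (N t * U t) t := by
  obtain ⟨U, hU0, hU⟩ := exists_linear_solution_matrix hN.continuous X
  obtain ⟨V, hV0, hV⟩ := exists_linear_solution_matrix hN.continuous.matrix_transpose.neg (X⁻¹)ᵀ
  have hVU : ∀ t, (V t)ᵀ * U t = 1 := by
    intro t
    have h1 : ∀ t, HasMatDerivAt (fun t => (V t)ᵀ * U t) 0 t := fun t => by
      refine ((hV t).transpose.mul (hU t)).congr_deriv ?_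
      simp only [transpose_mul, Pi.neg_apply, transpose_neg, transpose_transpose,
        Matrix.neg_mul, Matrix.mul_assoc]
      abel
    rw [eq_of_hasMatDerivAt_zero h1 t 0, hU0, hV0, transpose_transpose, inv_mul_self_of_isUnit hX]
  exact ⟨U, smoothMap_of_linear hN hU, fun t => IsUnit.of_mul_eq_one_right _ (hVU t), hU0, hU⟩

/-- A smooth family of projections is diagonalized by a smooth family of coordinates. -/
theorem exists_diagonalizing_frame {Θ : ℝ → Matrix κ κ ℝ} (hΘ : SmoothMap Θ)
    (hΘ2 : ∀ t, Θ t * Θ t = Θ t) {X : Matrix κ κ ℝ} (hX : IsUnit X) {d : κ → ℝ}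
    (hd : Θ 0 * X = X * diagonal d) :
    ∃ U : ℝ → Matrix κ κ ℝ, SmoothMap U ∧ (∀ t, IsUnit (U t)) ∧
      ∀ t, Θ t * U t = U t * diagonal d := by
  -- Kato's parallel transport: the generator [Θ̇, Θ] satisfies [[Θ̇, Θ], Θ] = Θ̇ because ΘΘ̇Θ = 0,
  -- so its flow carries Θ(0) to Θ(t).
  have hN : SmoothMap fun t => matDeriv Θ t * Θ t - Θ t * matDeriv Θ t :=
    (hΘ.matDeriv.mul hΘ).sub (hΘ.mul hΘ.matDeriv)
  obtain ⟨U, hUs, hUu, hU0, hU⟩ := exists_smooth_frame hN hX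
  refine ⟨U, hUs, hUu, fun t => ?_⟩
  refine linear_unique_matrix (X := fun t => Θ t * U t) (Y := fun t => U t * diagonal d)
    hN.continuous (fun s => ?_) (fun s => ?_) 0 ?_ t
  · refine ((hΘ.hasMatDerivAt s).mul (hU s)).congr_deriv ?_
    have h1 : matDeriv Θ s * Θ s + Θ s * matDeriv Θ s = matDeriv Θ s := by
      refine HasMatDerivAt.unique ?_ (hΘ.hasMatDerivAt s)
      exact ((hΘ.hasMatDerivAt s).mul (hΘ.hasMatDerivAt s)).congr_fun fun s => (hΘ2 s).symm
    have h2 : Θ s * matDeriv Θ s * Θ s = 0 := by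
      have h3 := congrArg (fun Y => Θ s * Y) h1
      simp only [Matrix.mul_add] at h3
      rw [← Matrix.mul_assoc, ← Matrix.mul_assoc, hΘ2] at h3
      exact left_eq_add.1 (by rw [add_comm]; exact h3.symm)
    set D := matDeriv Θ s
    calc _ = (D * Θ s + Θ s * D) * U s + (Θ s * D * Θ s - Θ s * Θ s * D) * U s := by
          rw [h1]; simp only [Matrix.mul_sub, Matrix.sub_mul, Matrix.mul_assoc]
      _ = (D * (Θ s * Θ s) - Θ s * D * Θ s) * U s := by
          rw [h2, hΘ2]; simp only [Matrix.add_mul, Matrix.sub_mul, Matrix.zero_mul]; abel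
      _ = _ := by simp only [Matrix.sub_mul, Matrix.mul_assoc]
  · refine ((hU s).mul_const _).congr_deriv ?_
    rw [Matrix.mul_assoc]
  · simp only [hU0, hd]

/-- The transported frame may degenerate at infinity, which would spoil uniform positivity of UᵀRU.
A scalar factor dominating the entries of U⁻¹ repairs this without moving the eigenspaces. -/
theorem exists_rescaling {U : ℝ → Matrix κ κ ℝ} (hU : SmoothMap U) (hUu : ∀ t, IsUnit (U t)) :
    ∃ s : ℝ → ℝ, ContDiff ℝ ∞ s ∧ (∀ t, 0 < s t) ∧ ∃ c > 0, ∀ t x,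
      c * (x ⬝ᵥ x) ≤ ((s t • U t) *ᵥ x) ⬝ᵥ ((s t • U t) *ᵥ x) := by
  have hV := hU.inv hUu
  have hpos : ∀ t, 0 < 1 + ∑ i, ∑ j, (U t)⁻¹ i j ^ 2 := fun t => by positivity
  refine ⟨fun t => 1 + ∑ i, ∑ j, (U t)⁻¹ i j ^ 2,
    contDiff_const.add (ContDiff.sum fun i _ => ContDiff.sum fun j _ => (hV i j).pow 2), hpos,
    (Fintype.card κ * Fintype.card κ + 1 : ℝ)⁻¹, by positivity, fun t x => ?_⟩
  set s := 1 + ∑ i, ∑ j, (U t)⁻¹ i j ^ 2 with hs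
  have h1 : ∀ i j, |(U t)⁻¹ i j| ≤ s := by
    intro i j
    have h2 : (U t)⁻¹ i j ^ 2 ≤ ∑ i, ∑ j, (U t)⁻¹ i j ^ 2 :=
      (Finset.single_le_sum (f := fun j => (U t)⁻¹ i j ^ 2) (fun j _ => sq_nonneg _)
        (Finset.mem_univ j)).trans
        (Finset.single_le_sum (f := fun i => ∑ j, (U t)⁻¹ i j ^ 2)
          (fun i _ => Finset.sum_nonneg fun j _ => sq_nonneg _) (Finset.mem_univ i))
    rw [← sq_abs] at h2
    nlinarith [sq_nonneg (|(U t)⁻¹ i j| - 1)]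
  have h3 := mulVec_dot_le_of_abs_le h1 (U t *ᵥ x)
  rw [mulVec_mulVec, inv_mul_self_of_isUnit (hUu t), one_mulVec] at h3
  rw [smul_mulVec, smul_dotProduct, dotProduct_smul, smul_eq_mul, smul_eq_mul,
    inv_mul_le_iff₀ (by positivity)]
  have h4 := mul_nonneg (sq_nonneg s) (dot_self_nonneg (U t *ᵥ x))
  nlinarith

/-- The induced input projection is self-adjoint for R. It is diagonalized at time 0 together with
R(0), transported to all times and rescaled; self-adjointness makes UᵀRU commute with the same
diagonal matrix. -/
theorem exists_input_frame {B : ℝ → Matrix ι κ ℝ} {R : ℝ → Matrix κ κ ℝ} {E : Matrix ι ι ℝ}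
    (hB : SmoothMap B) (hBi : ∀ t, Function.Injective fun v : κ → ℝ => B t *ᵥ v)
    (hRs : ∀ t, (R t).IsSymm) (hR : UniformlyPosDef R) (hE : E * E = E) (hEs : Eᵀ = E)
    (hEG : ∀ t, E * (B t * (R t)⁻¹ * (B t)ᵀ) = B t * (R t)⁻¹ * (B t)ᵀ * E) :
    ∃ (U : ℝ → Matrix κ κ ℝ) (d : κ → ℝ), SmoothMap U ∧ (∀ t, IsUnit (U t)) ∧
      UniformlyPosDef (fun t => (U t)ᵀ * R t * U t) ∧
      ∀ t, E * (B t * U t) = B t * U t * diagonal d ∧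
        (U t)ᵀ * R t * U t * diagonal d = diagonal d * ((U t)ᵀ * R t * U t) := by
  obtain ⟨ρ, hρ, hRd⟩ := hR.exists_dot_le
  obtain ⟨Θ, hΘ, h⟩ := exists_input_projection hB hBi hRs hR.isUnit hE hEs hEG
  have hX : (R 0 * Θ 0).IsSymm := by
    rw [Matrix.IsSymm, transpose_mul, (hRs 0).eq, (h 0).2.2]
  obtain ⟨X, d, hXu, hXR, hXd⟩ := exists_simultaneous_diagonal (hRs 0)
    (fun v => (mul_nonneg hρ.le (dot_self_nonneg v)).trans (hRd 0 v)) (hR.isUnit 0) hX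
  have hd : Θ 0 * X = X * diagonal d := by
    rw [← hXd, ← Matrix.mul_assoc Xᵀ, ← inv_eq_left_inv hXR, ← Matrix.mul_assoc,
      ← Matrix.mul_assoc, mul_inv_self_of_isUnit hXu, Matrix.one_mul]
  obtain ⟨U, hU, hUu, hUd⟩ := exists_diagonalizing_frame hΘ (fun t => (h t).1) hXu hd
  obtain ⟨s, hs, hs0, c, hc, hsc⟩ := exists_rescaling hU hUu
  have hVd : ∀ t, Θ t * (s t • U t) = s t • U t * diagonal d := fun t => by
    rw [Matrix.mul_smul, hUd, Matrix.smul_mul]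
  have hsu : ∀ t, IsUnit (s t • U t) := fun t => by
    have := (hUu t).smul (Units.mk0 (s t) (hs0 t).ne')
    simpa using this
  refine ⟨fun t => s t • U t, d, SmoothMap.smul hs hU, hsu,
    uniformlyPosDef_of_dot_le (c := ρ * c) (by positivity) (fun t => ?_) (fun t x => ?_),
    fun t => ?_⟩
  · rw [Matrix.IsSymm, transpose_mul, transpose_mul, transpose_transpose, (hRs t).eq,
      Matrix.mul_assoc]
  · rw [← mulVec_mulVec, ← mulVec_mulVec, dot_mulVec_comm, transpose_transpose]
    refine le_trans ?_ (hRd t _)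
    rw [mul_assoc]
    exact mul_le_mul_of_nonneg_left (hsc t x) hρ.le
  · have h1 := hVd t
    set V := s t • U t with hV
    change _ ∧ Vᵀ * R t * V * diagonal d = diagonal d * (Vᵀ * R t * V)
    refine ⟨?_, ?_⟩
    · rw [← Matrix.mul_assoc, (h t).2.1, Matrix.mul_assoc, h1, Matrix.mul_assoc]
    · have h2 : diagonal d * Vᵀ = Vᵀ * (Θ t)ᵀ := by
        rw [← transpose_mul, h1, transpose_mul, diagonal_transpose]
      calc _ = Vᵀ * R t * (V * diagonal d) := by simp only [Matrix.mul_assoc]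
        _ = Vᵀ * (R t * Θ t) * V := by rw [← h1]; simp only [Matrix.mul_assoc]
        _ = Vᵀ * (Θ t)ᵀ * R t * V := by rw [← (h t).2.2]; simp only [Matrix.mul_assoc]
        _ = _ := by rw [← h2]; simp only [Matrix.mul_assoc]

end InputFrame

/-! ### Invariance of the Kalman condition -/

section Kalman

variable {ι κ : Type*} [Fintype ι]
  {A : ℝ → Matrix ι ι ℝ} {B : ℝ → Matrix ι κ ℝ}

theorem smoothMap_kalmanSeq (hA : SmoothMap A) (hB : SmoothMap B) (i : ℕ) :
    SmoothMap (kalmanSeq A B i) := by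
  induction i with
  | zero => exact hB
  | succ i ih => exact ih.matDeriv.sub (hA.mul ih)

variable [Fintype κ]

/-- The mappings `∑ B_j C_j` with smooth coefficients `C_j`. -/
inductive KalmanSpan (A : ℝ → Matrix ι ι ℝ) (B : ℝ → Matrix ι κ ℝ) : (ℝ → Matrix ι κ ℝ) → Prop
  | mul (j : ℕ) (C : ℝ → Matrix κ κ ℝ) (hC : SmoothMap C) :
      KalmanSpan A B fun t => kalmanSeq A B j t * C t
  | add (X Y : ℝ → Matrix ι κ ℝ) : KalmanSpan A B X → KalmanSpan A B Y →
      KalmanSpan A B fun t => X t + Y t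

namespace KalmanSpan

variable {X : ℝ → Matrix ι κ ℝ}

theorem smooth (h : KalmanSpan A B X) (hA : SmoothMap A) (hB : SmoothMap B) : SmoothMap X := by
  induction h with
  | mul j C hC => exact (smoothMap_kalmanSeq hA hB j).mul hC
  | add X Y _ _ hX hY => exact hX.add hY

theorem mulVec_mem (h : KalmanSpan A B X) (t : ℝ) (v : κ → ℝ) :
    X t *ᵥ v ∈ Submodule.span ℝ
      {w : ι → ℝ | ∃ (i : ℕ) (v : κ → ℝ), w = kalmanSeq A B i t *ᵥ v} := by
  induction h with
  | mul j C hC => exact Submodule.subset_span ⟨j, C t *ᵥ v, (mulVec_mulVec _ _ _).symm⟩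
  | add X Y _ _ hX hY =>
    rw [add_mulVec]
    exact Submodule.add_mem _ hX hY

theorem deriv (h : KalmanSpan A B X) (hA : SmoothMap A) (hB : SmoothMap B) :
    KalmanSpan A B fun t => matDeriv X t - A t * X t := by
  induction h with
  | mul j C hC =>
    have h1 := KalmanSpan.add (A := A) (B := B) _ _ (.mul (j + 1) C hC) (.mul j _ hC.matDeriv)
    convert h1 using 2 with t
    rw [(((smoothMap_kalmanSeq hA hB j).hasMatDerivAt t).mul (hC.hasMatDerivAt t)).matDeriv_eq]
    simp only [kalmanSeq, Matrix.sub_mul, Matrix.mul_assoc]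
    abel
  | add X Y hX hY hX' hY' =>
    convert KalmanSpan.add _ _ hX' hY' using 2 with t
    rw [(((hX.smooth hA hB).hasMatDerivAt t).add ((hY.smooth hA hB).hasMatDerivAt t)).matDeriv_eq,
      Matrix.mul_add]
    abel

end KalmanSpan

variable [DecidableEq ι] [DecidableEq κ]

/-- The Kalman condition is invariant under feedback and under changes of coordinates. -/
theorem KalmanCondition.changeCoord (h : KalmanCondition A B) (hA : SmoothMap A)
    (hB : SmoothMap B) {K : ℝ → Matrix κ ι ℝ} (hK : SmoothMap K) {M : ℝ → Matrix ι ι ℝ}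
    (hM : SmoothMap M) (hMu : ∀ t, IsUnit (M t)) {U : ℝ → Matrix κ κ ℝ} (hU : SmoothMap U)
    (hUu : ∀ t, IsUnit (U t)) :
    KalmanCondition (changeCoord M fun t => A t - B t * K t) (fun t => (M t)⁻¹ * B t * U t) := by
  set A' := LQ.changeCoord M fun t => A t - B t * K t with hA'
  set B' := fun t => (M t)⁻¹ * B t * U t with hB'
  have hM1 : ∀ t, M t * (M t)⁻¹ = 1 := fun t => mul_inv_self_of_isUnit (hMu t)
  have hA's : SmoothMap A' :=
    (hM.inv hMu).mul (hM.matDeriv.neg.add ((hA.sub (hB.mul hK)).mul hM))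
  have hB's : SmoothMap B' := ((hM.inv hMu).mul hB).mul hU
  have hUi := hU.inv hUu
  -- Induction based on (MY)' - AMY = M(Y' - A'Y) - BKMY, whose last term is M B' times a smooth
  -- coefficient. Smooth coefficients are needed because the recursion differentiates them.
  have key : ∀ i, ∃ Y, KalmanSpan A' B' Y ∧ ∀ t, kalmanSeq A B i t = M t * Y t := by
    intro i
    induction i with
    | zero =>
      refine ⟨_, .mul 0 _ hUi, fun t => ?_⟩
      calc B t = M t * (M t)⁻¹ * B t * (U t * (U t)⁻¹) := by
            rw [hM1, mul_inv_self_of_isUnit (hUu t), Matrix.one_mul, Matrix.mul_one]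
        _ = _ := by simp only [kalmanSeq, hB', Matrix.mul_assoc]
    | succ i ih =>
      obtain ⟨Y, hY, hYe⟩ := ih
      have hYs := hY.smooth hA's hB's
      refine ⟨_, .add _ _ (hY.deriv hA's hB's) (.mul 0 _ ((hUi.mul (hK.mul (hM.mul hYs))).neg)),
        fun t => ?_⟩
      have h1 : matDeriv (kalmanSeq A B i) t = matDeriv M t * Y t + M t * matDeriv Y t := by
        rw [show kalmanSeq A B i = fun t => M t * Y t from funext hYe]
        exact ((hM.hasMatDerivAt t).mul (hYs.hasMatDerivAt t)).matDeriv_eq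
      have h2 : M t * (A' t * Y t) =
          -(matDeriv M t * Y t) + (A t - B t * K t) * (M t * Y t) := by
        calc _ = M t * (M t)⁻¹ * (-(matDeriv M t * Y t) + (A t - B t * K t) * (M t * Y t)) := by
              simp only [hA', LQ.changeCoord, Matrix.mul_assoc, Matrix.add_mul, Matrix.neg_mul]
          _ = _ := by rw [hM1, Matrix.one_mul]
      have h3 : M t * (B' t * -((U t)⁻¹ * (K t * (M t * Y t)))) =
          -(B t * K t * (M t * Y t)) := by
        calc _ = -(M t * (M t)⁻¹ * B t * (U t * (U t)⁻¹) * K t * (M t * Y t)) := by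
              simp only [hB', Matrix.mul_neg, Matrix.mul_assoc]
          _ = _ := by
            rw [hM1, mul_inv_self_of_isUnit (hUu t), Matrix.one_mul, Matrix.mul_one]
      simp only [kalmanSeq]
      rw [h1, hYe, Matrix.mul_add, Matrix.mul_sub, h2, h3]
      simp only [Matrix.sub_mul]
      abel
  intro t
  rw [eq_top_iff]
  rintro w -
  have h1 : ∀ x ∈ Submodule.span ℝ {w : ι → ℝ | ∃ (i : ℕ) (v : κ → ℝ), w = kalmanSeq A B i t *ᵥ v},
      (M t)⁻¹ *ᵥ x ∈ Submodule.span ℝ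
        {w : ι → ℝ | ∃ (i : ℕ) (v : κ → ℝ), w = kalmanSeq A' B' i t *ᵥ v} := by
    intro x hx
    induction hx using Submodule.span_induction with
    | mem x hx =>
      obtain ⟨i, v, rfl⟩ := hx
      obtain ⟨Y, hY, hYe⟩ := key i
      rw [hYe, mulVec_mulVec, ← Matrix.mul_assoc, inv_mul_self_of_isUnit (hMu t), Matrix.one_mul]
      exact hY.mulVec_mem t v
    | zero => rw [mulVec_zero]; exact Submodule.zero_mem _
    | add x y _ _ hx hy => rw [mulVec_add]; exact Submodule.add_mem _ hx hy
    | smul a x _ hx => rw [mulVec_smul]; exact Submodule.smul_mem _ a hx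
  have h2 := h1 (M t *ᵥ w) (h t ▸ Submodule.mem_top)
  rwa [mulVec_mulVec, inv_mul_self_of_isUnit (hMu t), one_mulVec] at h2

end Kalman

/-! ### Restriction to the blocks -/

section Blocks

variable {N p' q' : ℕ} {p q : Fin N → ℕ}

theorem blockDiag_apply_ne (hp : ∑ i, p i = p') (hq : ∑ i, q i = q')
    (D : ∀ i, Matrix (Fin (p i)) (Fin (q i)) ℝ) {i j : Fin N} (hij : i ≠ j) (a : Fin (p i))
    (b : Fin (q j)) :
    blockDiag hp hq D (blockEquiv hp ⟨i, a⟩) (blockEquiv hq ⟨j, b⟩) = 0 := by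
  simp [blockDiag_eq_submatrix, blockDiagonal'_apply_ne _ _ _ hij]

theorem eq_blockDiag_iff (hp : ∑ i, p i = p') (hq : ∑ i, q i = q')
    (D : ∀ i, Matrix (Fin (p i)) (Fin (q i)) ℝ) (X : Matrix (Fin p') (Fin q') ℝ) :
    X = blockDiag hp hq D ↔
      (∀ i a b, X (blockEquiv hp ⟨i, a⟩) (blockEquiv hq ⟨i, b⟩) = D i a b) ∧
      ∀ i j a b, i ≠ j → X (blockEquiv hp ⟨i, a⟩) (blockEquiv hq ⟨j, b⟩) = 0 := by
  refine ⟨fun h => ?_, fun h => ?_⟩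
  · subst h
    exact ⟨fun i a b => blockDiag_apply hp hq D i a b,
      fun i j a b hij => blockDiag_apply_ne hp hq D hij a b⟩
  · ext x y
    obtain ⟨⟨i, a⟩, rfl⟩ := (blockEquiv hp).surjective x
    obtain ⟨⟨j, b⟩, rfl⟩ := (blockEquiv hq).surjective y
    by_cases hij : i = j
    · subst hij
      rw [h.1, blockDiag_apply]
    · rw [h.2 i j a b hij, blockDiag_apply_ne hp hq D hij]

theorem matDeriv_blockDiag (hp : ∑ i, p i = p') (hq : ∑ i, q i = q')
    (D : ∀ i, ℝ → Matrix (Fin (p i)) (Fin (q i)) ℝ) (t : ℝ) :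
    matDeriv (fun t => blockDiag hp hq fun i => D i t) t =
      blockDiag hp hq fun i => matDeriv (D i) t := by
  refine (eq_blockDiag_iff hp hq _ _).2 ⟨fun i a b => ?_, fun i j a b hij => ?_⟩
  · simp only [matDeriv, of_apply, blockDiag_apply]
  · simp only [matDeriv, of_apply, blockDiag_apply_ne hp hq _ hij, deriv_const]

theorem blockDiag_sub (hp : ∑ i, p i = p') (hq : ∑ i, q i = q')
    (D E : ∀ i, Matrix (Fin (p i)) (Fin (q i)) ℝ) :
    blockDiag hp hq D - blockDiag hp hq E = blockDiag hp hq fun i => D i - E i := by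
  refine (eq_blockDiag_iff hp hq _ _).2 ⟨fun i a b => ?_, fun i j a b hij => ?_⟩
  · simp only [Matrix.sub_apply, blockDiag_apply]
  · simp only [Matrix.sub_apply, blockDiag_apply_ne hp hq _ hij, sub_zero]

theorem kalmanSeq_blockDiag (hp : ∑ i, p i = p') (hq : ∑ i, q i = q')
    (A : ∀ i, ℝ → Matrix (Fin (p i)) (Fin (p i)) ℝ)
    (B : ∀ i, ℝ → Matrix (Fin (p i)) (Fin (q i)) ℝ) (j : ℕ) :
    kalmanSeq (fun t => blockDiag hp hp fun i => A i t) (fun t => blockDiag hp hq fun i => B i t) j =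
      fun t => blockDiag hp hq fun i => kalmanSeq (A i) (B i) j t := by
  induction j with
  | zero => rfl
  | succ j ih =>
    funext t
    simp only [kalmanSeq]
    rw [ih, matDeriv_blockDiag, blockDiag_mul, blockDiag_sub]

theorem blockDiag_mulVec_apply (hp : ∑ i, p i = p') (hq : ∑ i, q i = q')
    (D : ∀ i, Matrix (Fin (p i)) (Fin (q i)) ℝ) (v : Fin q' → ℝ) (i : Fin N) (a : Fin (p i)) :
    (blockDiag hp hq D *ᵥ v) (blockEquiv hp ⟨i, a⟩) =
      (D i *ᵥ fun b => v (blockEquiv hq ⟨i, b⟩)) a := by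
  simp only [mulVec, dotProduct]
  rw [← (blockEquiv hq).sum_comp, Fintype.sum_sigma, Finset.sum_eq_single i]
  · simp only [blockDiag_apply]
  · intro j _ hj
    simp only [blockDiag_apply_ne hp hq D hj.symm, zero_mul, Finset.sum_const_zero]
  · simp

/-- The surjective coordinate map onto a block sends the Kalman vectors of the whole system to those
of the block. -/
theorem KalmanCondition.block {hp : ∑ i, p i = p'} {hq : ∑ i, q i = q'}
    {A : ∀ i, ℝ → Matrix (Fin (p i)) (Fin (p i)) ℝ}
    {B : ∀ i, ℝ → Matrix (Fin (p i)) (Fin (q i)) ℝ}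
    (h : KalmanCondition (fun t => blockDiag hp hp fun i => A i t)
      (fun t => blockDiag hp hq fun i => B i t)) (i : Fin N) : KalmanCondition (A i) (B i) := by
  intro t
  let π : (Fin p' → ℝ) →ₗ[ℝ] (Fin (p i) → ℝ) :=
    LinearMap.funLeft ℝ ℝ fun a => blockEquiv hp ⟨i, a⟩
  have hπ : Function.Surjective π := LinearMap.funLeft_surjective_of_injective ℝ ℝ _
    fun a b hab => by simpa using hab
  rw [eq_top_iff, ← LinearMap.range_eq_top.2 hπ, ← Submodule.map_top, ← h t, Submodule.map_span]
  refine Submodule.span_mono ?_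
  rintro _ ⟨_, ⟨j, v, rfl⟩, rfl⟩
  refine ⟨j, fun b => v (blockEquiv hq ⟨i, b⟩), ?_⟩
  rw [kalmanSeq_blockDiag]
  funext a
  exact blockDiag_mulVec_apply hp hq _ v i a

theorem KalmanCondition.pos {d k : ℕ} {A : ℝ → Matrix (Fin d) (Fin d) ℝ}
    {B : ℝ → Matrix (Fin d) (Fin k) ℝ} (h : KalmanCondition A B) (hd : 0 < d) : 0 < k := by
  rcases Nat.eq_zero_or_pos k with rfl | hk
  · have h1 := h 0
    have : Nonempty (Fin d) := ⟨⟨0, hd⟩⟩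
    have h2 : {w : Fin d → ℝ | ∃ (i : ℕ) (v : Fin 0 → ℝ), w = kalmanSeq A B i 0 *ᵥ v} ⊆ {0} := by
      rintro _ ⟨i, v, rfl⟩
      simp
    have h3 := Submodule.span_mono (R := ℝ) h2
    rw [h1, Submodule.span_zero_singleton, top_le_iff] at h3
    exact absurd h3 bot_ne_top
  · exact hk

/-- The vector with the given block and zeros elsewhere. -/
def blockVec (hq : ∑ i, q i = q') (i : Fin N) (v : Fin (q i) → ℝ) (x : Fin q') : ℝ :=
  (Pi.single i v : ∀ i, Fin (q i) → ℝ) ((blockEquiv hq).symm x).1 ((blockEquiv hq).symm x).2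

theorem blockVec_apply (hq : ∑ i, q i = q') (i : Fin N) (v : Fin (q i) → ℝ) (a : Fin (q i)) :
    blockVec hq i v (blockEquiv hq ⟨i, a⟩) = v a := by
  rw [blockVec, Equiv.symm_apply_apply, Pi.single_eq_same]

theorem blockVec_apply_ne (hq : ∑ i, q i = q') {i j : Fin N} (hij : j ≠ i) (v : Fin (q i) → ℝ)
    (a : Fin (q j)) : blockVec hq i v (blockEquiv hq ⟨j, a⟩) = 0 := by
  rw [blockVec, Equiv.symm_apply_apply, Pi.single_eq_of_ne hij, Pi.zero_apply]

theorem blockDiag_mulVec_blockVec (hp : ∑ i, p i = p') (hq : ∑ i, q i = q')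
    (D : ∀ i, Matrix (Fin (p i)) (Fin (q i)) ℝ) (i : Fin N) (v : Fin (q i) → ℝ) :
    blockDiag hp hq D *ᵥ blockVec hq i v = blockVec hp i (D i *ᵥ v) := by
  funext x
  obtain ⟨⟨j, a⟩, rfl⟩ := (blockEquiv hp).surjective x
  rw [blockDiag_mulVec_apply]
  by_cases hij : j = i
  · subst hij
    simp only [blockVec_apply]
  · simp only [blockVec_apply_ne hp hij, blockVec_apply_ne hq hij]
    exact congrFun (mulVec_zero (D j)) a

theorem blockVec_dot (hq : ∑ i, q i = q') (i : Fin N) (v w : Fin (q i) → ℝ) :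
    blockVec hq i v ⬝ᵥ blockVec hq i w = v ⬝ᵥ w := by
  simp only [dotProduct]
  rw [← (blockEquiv hq).sum_comp, Fintype.sum_sigma, Finset.sum_eq_single i]
  · simp only [blockVec_apply]
  · intro j _ hj
    simp only [blockVec_apply_ne hq hj, zero_mul, Finset.sum_const_zero]
  · simp

theorem block_le_of_injective {hp : ∑ i, p i = p'} {hq : ∑ i, q i = q'}
    {D : ∀ i, Matrix (Fin (p i)) (Fin (q i)) ℝ}
    (h : Function.Injective fun v => blockDiag hp hq D *ᵥ v) (i : Fin N) : q i ≤ p i := by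
  have h1 : Function.Injective (toLin' (D i)) := by
    rw [injective_iff_map_eq_zero]
    intro v hv
    have h2 : blockDiag hp hq D *ᵥ blockVec hq i v = 0 := by
      rw [blockDiag_mulVec_blockVec, show D i *ᵥ v = 0 from hv]
      funext x
      simp [blockVec]
    have h3 : blockVec hq i v = 0 := h (by simp only [h2, mulVec_zero])
    rw [← dotProduct_self_eq_zero, ← blockVec_dot hq, h3, zero_dotProduct]
  simpa using LinearMap.finrank_le_finrank_of_injective h1

theorem UniformlyPosDef.block {hq : ∑ i, q i = q'} {D : ∀ i, ℝ → Matrix (Fin (q i)) (Fin (q i)) ℝ}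
    (h : UniformlyPosDef fun t => blockDiag hq hq fun i => D i t)
    (hs : ∀ i t, (D i t).IsSymm) (i : Fin N) : UniformlyPosDef (D i) := by
  obtain ⟨c, hc, hcd⟩ := h.exists_dot_le
  refine uniformlyPosDef_of_dot_le hc (hs i) fun t x => ?_
  have h1 := hcd t (blockVec hq i x)
  rwa [blockDiag_mulVec_blockVec, blockVec_dot, blockVec_dot] at h1

end Blocks

/-! ### Sorting the coordinates into blocks -/

section Sorting

/-- `blockDiag` requires consecutive blocks, so the classes have to be brought together by a
permutation. -/
theorem exists_sorting {n N : ℕ} (c : Fin n → Fin N) :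
    ∃ (d : Fin N → ℕ) (hd : ∑ i, d i = n) (p : Fin n ≃ Fin n),
      ∀ i a, c (p (blockEquiv hd ⟨i, a⟩)) = i := by
  have hd : ∑ i, Fintype.card {x // c x = i} = n := by
    rw [← Fintype.card_sigma, Fintype.card_congr (Equiv.sigmaFiberEquiv c), Fintype.card_fin]
  refine ⟨fun i => Fintype.card {x // c x = i}, hd, (blockEquiv hd).symm.trans
    ((Equiv.sigmaCongrRight fun i => (Fintype.equivFin _).symm).trans (Equiv.sigmaFiberEquiv c)),
    fun i a => ?_⟩
  rw [Equiv.trans_apply, Equiv.symm_apply_apply]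
  exact ((Fintype.equivFin {x // c x = i}).symm a).2

/-- A constant permutation of the frames turns classes of coordinates into blocks. State blocks are
nonempty because c is surjective; input blocks are then nonempty by the Kalman condition, and no
larger than the state blocks by injectivity of B. -/
theorem admitsProductStructure_of_classes {n m : ℕ}
    {A : ℝ → Matrix (Fin n) (Fin n) ℝ} {B : ℝ → Matrix (Fin n) (Fin m) ℝ}
    (hAB : DynamicsAssumption A B) {K : ℝ → Matrix (Fin m) (Fin n) ℝ} (hK : SmoothMap K)
    {R : ℝ → Matrix (Fin m) (Fin m) ℝ} (hR : SmoothMap R) (hRs : ∀ t, (R t).IsSymm)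
    {M : ℝ → Matrix (Fin n) (Fin n) ℝ} (hM : SmoothMap M) (hMu : ∀ t, IsUnit (M t))
    {U : ℝ → Matrix (Fin m) (Fin m) ℝ} (hU : SmoothMap U) (hUu : ∀ t, IsUnit (U t))
    (hUR : UniformlyPosDef fun t => (U t)ᵀ * R t * U t)
    {c : Fin n → Fin 2} (hc : Function.Surjective c) {c' : Fin m → Fin 2}
    (hcA : ∀ t i j, c i ≠ c j → changeCoord M (fun t => A t - B t * K t) t i j = 0)
    (hcB : ∀ t i j, c i ≠ c' j → ((M t)⁻¹ * B t * U t) i j = 0)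
    (hcR : ∀ t i j, c' i ≠ c' j → ((U t)ᵀ * R t * U t) i j = 0) :
    AdmitsProductStructure A B K R := by
  obtain ⟨d, hd, p, hp⟩ := exists_sorting c
  obtain ⟨k, hk, q, hq⟩ := exists_sorting c'
  have hd0 : ∀ i, 0 < d i := fun i => by
    obtain ⟨x, rfl⟩ := hc i
    obtain ⟨⟨j, a⟩, hx⟩ := ((blockEquiv hd).trans p).surjective x
    rw [← hx, Equiv.trans_apply, hp]
    exact a.pos
  set M' : ℝ → Matrix (Fin n) (Fin n) ℝ := fun t => (M t).submatrix (Equiv.refl _) p with hM'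
  set U' : ℝ → Matrix (Fin m) (Fin m) ℝ := fun t => (U t).submatrix (Equiv.refl _) q with hU'
  have hM's : SmoothMap M' := fun i j => hM i (p j)
  have hU's : SmoothMap U' := fun i j => hU i (q j)
  have hM'u : ∀ t, IsUnit (M' t) := fun t => (isUnit_submatrix_equiv (Equiv.refl _) p).2 (hMu t)
  have hU'u : ∀ t, IsUnit (U' t) := fun t => (isUnit_submatrix_equiv (Equiv.refl _) q).2 (hUu t)
  set X := changeCoord M (fun t => A t - B t * K t) with hX
  set Y : ℝ → Matrix (Fin n) (Fin m) ℝ := fun t => (M t)⁻¹ * B t * U t with hY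
  set V : ℝ → Matrix (Fin m) (Fin m) ℝ := fun t => (U t)ᵀ * R t * U t with hV
  have hXs : SmoothMap X := (hM.inv hMu).mul (hM.matDeriv.neg.add
    ((hAB.smooth_A.sub (hAB.smooth_B.mul hK)).mul hM))
  have hYs : SmoothMap Y := ((hM.inv hMu).mul hAB.smooth_B).mul hU
  have hVs : SmoothMap V := (hU.transpose.mul hR).mul hU
  let A' : ∀ i, ℝ → Matrix (Fin (d i)) (Fin (d i)) ℝ := fun i t =>
    Matrix.of fun a b => X t (p (blockEquiv hd ⟨i, a⟩)) (p (blockEquiv hd ⟨i, b⟩))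
  let B' : ∀ i, ℝ → Matrix (Fin (d i)) (Fin (k i)) ℝ := fun i t =>
    Matrix.of fun a b => Y t (p (blockEquiv hd ⟨i, a⟩)) (q (blockEquiv hk ⟨i, b⟩))
  let R' : ∀ i, ℝ → Matrix (Fin (k i)) (Fin (k i)) ℝ := fun i t =>
    Matrix.of fun a b => V t (q (blockEquiv hk ⟨i, a⟩)) (q (blockEquiv hk ⟨i, b⟩))
  have hA' : changeCoord M' (fun t => A t - B t * K t) =
      fun t => blockDiag hd hd fun i => A' i t := by
    funext t
    refine Eq.trans (b := (X t).submatrix p p) ?_ ((eq_blockDiag_iff hd hd _ _).2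
      ⟨fun i a b => rfl, fun i j a b hij => hcA t _ _ (by rwa [hp, hp])⟩)
    simp only [changeCoord, hM', inv_submatrix_equiv]
    rfl
  have hB' : (fun t => (M' t)⁻¹ * B t * U' t) = fun t => blockDiag hd hk fun i => B' i t := by
    funext t
    refine Eq.trans (b := (Y t).submatrix p q) ?_ ((eq_blockDiag_iff hd hk _ _).2
      ⟨fun i a b => rfl, fun i j a b hij => hcB t _ _ (by rwa [hp, hq])⟩)
    simp only [hM', inv_submatrix_equiv]
    rfl
  have hR' : (fun t => (U' t)ᵀ * R t * U' t) = fun t => blockDiag hk hk fun i => R' i t := by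
    funext t
    exact Eq.trans (b := (V t).submatrix q q) rfl ((eq_blockDiag_iff hk hk _ _).2
      ⟨fun i a b => rfl, fun i j a b hij => hcR t _ _ (by rwa [hq, hq])⟩)
  have hkal := hAB.kalman.changeCoord hAB.smooth_A hAB.smooth_B hK hM's hM'u hU's hU'u
  rw [hA', hB'] at hkal
  have hVsymm : ∀ t, (V t).IsSymm := fun t => by
    simp only [hV, Matrix.IsSymm, transpose_mul, transpose_transpose, (hRs t).eq, Matrix.mul_assoc]
  have hR's : ∀ i t, (R' i t).IsSymm := fun i t => by
    ext a b
    exact congrFun (congrFun (hVsymm t) _) _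
  have hU'R : UniformlyPosDef fun t => (U' t)ᵀ * R t * U' t := by
    obtain ⟨α, hα, h⟩ := hUR
    refine ⟨α, hα, fun t => ?_⟩
    have h1 := (h t).submatrix q.injective
    rw [submatrix_sub, Pi.sub_apply, Pi.sub_apply, submatrix_smul, Pi.smul_apply, Pi.smul_apply,
      submatrix_one_equiv] at h1
    exact h1
  rw [hR'] at hU'R
  refine ⟨M', U', hM's, hM'u, hU's, hU'u, 2, one_lt_two, d, k, hd, hk,
    fun i => ⟨(hkal.block i).pos (hd0 i), ?_⟩, A', B', R',
    fun i => ⟨fun a b => hXs _ _, fun a b => hYs _ _, hkal.block i, hR's i, fun a b => hVs _ _,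
      hU'R.block hR's i⟩,
    fun t => ⟨congrFun hA' t, congrFun hB' t, congrFun hR' t⟩⟩
  refine block_le_of_injective (hp := hd) (hq := hk) (D := fun i => B' i 0) ?_ i
  rw [← congrFun hB' 0]
  have h1 := (Matrix.mulVec_injective_iff_isUnit.2
    ((isUnit_nonsing_inv_iff).2 (hM'u 0))).comp ((hAB.injective_B 0).comp
      (Matrix.mulVec_injective_iff_isUnit.2 (hU'u 0)))
  simpa only [Function.comp_def, mulVec_mulVec, Matrix.mul_assoc] using h1

end Sorting

/-! ### A product form yields a product structure -/

section Structure

variable {ι κ : Type*} [Fintype ι] [Fintype κ]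

theorem tendsto_zero_of_abs_le_exp {f : ℝ → ℝ} {α β : ℝ} (hβ : 0 < β)
    (h : ∀ t ≤ 0, |f t| ≤ α * Real.exp (β * t)) : Filter.Tendsto f Filter.atBot (nhds 0) := by
  refine squeeze_zero_norm' ((Filter.eventually_le_atBot 0).mono h) ?_
  rw [← mul_zero α]
  exact (Real.tendsto_exp_atBot.comp (Filter.tendsto_id.const_mul_atBot hβ)).const_mul α

variable [DecidableEq ι] [DecidableEq κ]

theorem exists_projection_of_isCompl {E₁ E₂ : Submodule ℝ (ι → ℝ)} (h : IsCompl E₁ E₂)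
    (h1 : E₁ ≠ ⊥) (h2 : E₂ ≠ ⊥) :
    ∃ E : Matrix ι ι ℝ, E * E = E ∧ E ≠ 0 ∧ E ≠ 1 ∧
      ∀ X : Matrix ι ι ℝ, (∀ v ∈ E₁, X *ᵥ v ∈ E₁) → (∀ v ∈ E₂, X *ᵥ v ∈ E₂) → E * X = X * E := by
  set π := E₁.projection E₂ h with hπ
  have hE : ∀ v, LinearMap.toMatrix' π *ᵥ v = π v := fun v => by
    rw [← toLin'_apply, toLin'_toMatrix']
  have hπ1 : ∀ v ∈ E₁, π v = v := fun v hv => (E₁.projection_eq_self_iff h v).2 hv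
  have hπ2 : ∀ v ∈ E₂, π v = 0 := fun v hv => E₁.projection_apply_of_mem_right h hv
  refine ⟨LinearMap.toMatrix' π, ?_, fun h0 => h1 ?_, fun h0 => h2 ?_, fun X hX1 hX2 => ?_⟩
  · rw [← LinearMap.toMatrix'_comp]
    exact congrArg _ (E₁.isIdempotentElem_projection h)
  · rw [Submodule.eq_bot_iff]
    intro v hv
    rw [← hπ1 v hv, ← hE, h0, zero_mulVec]
  · rw [Submodule.eq_bot_iff]
    intro v hv
    rw [← hπ2 v hv, ← hE, h0, one_mulVec]
  · refine toLin'.injective (LinearMap.ext fun v => ?_)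
    simp only [toLin'_apply, ← mulVec_mulVec, hE]
    obtain ⟨v₁, hv1, v₂, hv2, rfl⟩ := Submodule.mem_sup.1 (h.sup_eq_top ▸ Submodule.mem_top (x := v))
    rw [mulVec_add, map_add, map_add, hπ1 _ (hX1 v₁ hv1), hπ2 _ (hX2 v₂ hv2), hπ1 v₁ hv1,
      hπ2 v₂ hv2, add_zero, add_zero]

theorem diagonal_comm_of_apply_eq_zero {X : Matrix ι ι ℝ} {N : ℕ} {c : ι → Fin N} (e : Fin N → ℝ)
    (h : ∀ i j, c i ≠ c j → X i j = 0) :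
    (diagonal fun i => e (c i)) * X = X * diagonal fun i => e (c i) := by
  ext i j
  rw [diagonal_mul, mul_diagonal]
  by_cases hij : c i = c j
  · rw [hij, mul_comm]
  · rw [h i j hij, mul_zero, zero_mul]

theorem smul_inv_of_pos {R : Matrix κ κ ℝ} {μ : ℝ} (hμ : 0 < μ) (hR : IsUnit R) :
    (μ • R)⁻¹ = μ⁻¹ • R⁻¹ := by
  refine inv_eq_right_inv ?_
  rw [Matrix.smul_mul, Matrix.mul_smul, smul_smul, mul_inv_cancel₀ hμ.ne', one_smul,
    mul_inv_self_of_isUnit hR]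

theorem UniformlyPosDef.smul {R : ℝ → Matrix κ κ ℝ} (hR : UniformlyPosDef R)
    (hs : ∀ t, (R t).IsSymm) {μ : ℝ} (hμ : 0 < μ) : UniformlyPosDef fun t => μ • R t := by
  obtain ⟨c, hc, h⟩ := hR.exists_dot_le
  refine uniformlyPosDef_of_dot_le (c := μ * c) (by positivity) (fun t => ?_) fun t x => ?_
  · rw [Matrix.IsSymm, transpose_smul, (hs t).eq]
  · rw [smul_mulVec, dotProduct_smul, smul_eq_mul, mul_assoc]
    exact mul_le_mul_of_nonneg_left (h t x) hμ.le

theorem UniformlyPosDef.det_pos {R : ℝ → Matrix κ κ ℝ} (hR : UniformlyPosDef R) (t : ℝ) :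
    0 < (R t).det := by
  obtain ⟨α, hα, h⟩ := hR
  have h1 : (R t - α • 1 + α • 1).PosDef := (h t).add (PosDef.one.smul hα)
  rw [sub_add_cancel] at h1
  exact h1.det_pos

/-- The determinant scales by μ to the power `card κ`, so a root of its inverse normalizes it. -/
theorem exists_pos_det_smul_eq_one [Nonempty κ] {R : Matrix κ κ ℝ} (hR : 0 < R.det) :
    ∃ μ > (0 : ℝ), (μ • R).det = 1 := by
  refine ⟨(R.det⁻¹) ^ ((Fintype.card κ : ℝ)⁻¹), Real.rpow_pos_of_pos (by positivity) _, ?_⟩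
  rw [det_smul, Real.rpow_inv_natCast_pow (by positivity) Fintype.card_ne_zero,
    inv_mul_cancel₀ hR.ne']

theorem optimalSynthesis_feedbackCost_smul {A : ℝ → Matrix ι ι ℝ} {B : ℝ → Matrix ι κ ℝ}
    (hAB : DynamicsAssumption A B) {Q : ℝ → Matrix ι ι ℝ} {S : ℝ → Matrix ι κ ℝ}
    {R : ℝ → Matrix κ κ ℝ} (hc : CostAssumption Q S R) {P : ℝ → Matrix ι ι ℝ}
    (hP : IsRiccatiSolution A B Q S R P) {μ : ℝ} (hμ : 0 < μ) :
    optimalSynthesis A B (feedbackCost (riccatiGain B S R P) fun t => μ • R t) =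
      optimalSynthesis A B (quadCost Q S R) := by
  refine optimalSynthesis_eq (inv_pos.2 hμ) (fun t x => x ⬝ᵥ (P t *ᵥ x)) fun t₀ t₁ x u h01 h => ?_
  rw [hP.integral_quadCost hAB.smooth_A hAB.smooth_B hc.smooth_Q hc.smooth_S hc.smooth_R
    hc.posDef_R.isUnit hc.symm_R h01 h, ← intervalIntegral.integral_const_mul]
  congr 2
  funext t
  rw [feedbackCost, feedbackCost, smul_mulVec, dotProduct_smul, smul_eq_mul,
    inv_mul_cancel_left₀ hμ.ne']

/-- The square completed with the stabilizing solution, up to scale, is the canonical cost.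
Boundedness of the gain rests on the automatic boundedness of Riccati solutions on the whole line.
-/
theorem isCanonicalCost_riccatiGain {A : ℝ → Matrix ι ι ℝ} {B : ℝ → Matrix ι κ ℝ}
    (hAB : DynamicsAssumption A B) {Q : ℝ → Matrix ι ι ℝ} {S : ℝ → Matrix ι κ ℝ}
    {R : ℝ → Matrix κ κ ℝ} (hc : CostAssumption Q S R) {P : ℝ → Matrix ι ι ℝ}
    (hP : IsRiccatiSolution A B Q S R P) (hst : ExpStable (closedLoop A B S R P)) {μ : ℝ}
    (hμ : 0 < μ) (hdet : (μ • R 0).det = 1) :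
    IsCanonicalCost A B (riccatiGain B S R P) (fun t => μ • R t) where
  symm_R t := by rw [Matrix.IsSymm, transpose_smul, (hc.symm_R t).eq]
  smooth_R := SmoothMap.smul contDiff_const hc.smooth_R
  bounded_R := by
    obtain ⟨C, hC⟩ := hc.bounded_R
    refine ⟨μ * C, fun t i j => ?_⟩
    change |μ * R t i j| ≤ μ * C
    rw [abs_mul, abs_of_pos hμ]
    exact mul_le_mul_of_nonneg_left (hC t i j) hμ.le
  posDef_R := hc.posDef_R.smul hc.symm_R hμ
  det_R := hdet
  smooth_K := (hc.smooth_R.inv hc.posDef_R.isUnit).mul (hc.smooth_S.transpose.add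
    (hAB.smooth_B.transpose.mul (hP.smooth hAB.smooth_A hAB.smooth_B hc.smooth_Q hc.smooth_S
      hc.smooth_R hc.posDef_R.isUnit)))
  bounded_K := hc.posDef_R.boundedMap_inv.mul (hc.bounded_S.transpose.add
    (hAB.bounded_B.transpose.mul (hP.boundedMap hAB hc)))
  stable := by
    rwa [← show closedLoop A B S R P = _ from funext fun t => closedLoop_eq P t]

/-- The coordinates in which the synthesis mappings vanish, respectively are block diagonal. -/
theorem exists_block_coordinates_of_synthesis {F F' G D : ℝ → Matrix ι ι ℝ}
    (hF : Continuous F) (hF' : Continuous F') (hG : ∀ t, (G t)ᵀ = G t)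
    (hG0 : ∀ t v, 0 ≤ v ⬝ᵥ (G t *ᵥ v)) (hDs : (D 0).IsSymm)
    (hFF' : ∀ t, F' t = F t + G t * D t)
    (hD : ∀ t, HasMatDerivAt D (-((F t)ᵀ * D t) - D t * F' t) t)
    {Φ : ℝ → ℝ → Matrix ι ι ℝ} (hΦ : IsTransitionMatrix F Φ) (hst : ExpStable F)
    (hst' : ExpAntiStable F') {E : Matrix ι ι ℝ} (hE : E * E = E) (hE0 : E ≠ 0) (hE1 : E ≠ 1)
    {M : ℝ → Matrix ι ι ℝ} (hM : SmoothMap M) (hMu : ∀ t, IsUnit (M t))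
    (hcF : ∀ t, E * changeCoord M F t = changeCoord M F t * E)
    (hcF' : ∀ t, E * changeCoord M F' t = changeCoord M F' t * E) :
    ∃ (N : Matrix ι ι ℝ) (c : ι → Fin 2), IsUnit N ∧ Function.Surjective c ∧
      ∀ t i j, c i ≠ c j →
        ((Φ t 0 * N)⁻¹ * G t * ((Φ t 0 * N)⁻¹)ᵀ) i j = 0 := by
  obtain ⟨Ψ, hΨ, α, hα, β, hβ, hdec⟩ := hst
  obtain rfl : Ψ = Φ := by
    funext t τ
    exact linear_unique_matrix hF (fun s => hΨ.hasMatDerivAt s τ) (fun s => hΦ.hasMatDerivAt s τ) τ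
      (by rw [hΦ.self, hΨ.self]) t
  obtain ⟨Φ', hΦ', α', hα', β', hβ', hdec'⟩ := hst'
  have hlim : ∀ i j, Filter.Tendsto (fun t => (Ψ 0 t * Φ' t 0) i j) Filter.atBot (nhds 0) := by
    intro i j
    have h1 : ∀ i j, Filter.Tendsto (fun t => Ψ 0 t i j) Filter.atBot (nhds 0) := fun i j =>
      tendsto_zero_of_abs_le_exp hβ fun t ht => (hdec t 0 ht i j).trans (le_of_eq (by ring_nf))
    have h2 : ∀ i j, Filter.Tendsto (fun t => Φ' t 0 i j) Filter.atBot (nhds 0) := fun i j =>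
      tendsto_zero_of_abs_le_exp hβ' fun t ht => by simpa using hdec' 0 t ht i j
    simp only [Matrix.mul_apply]
    rw [← Finset.sum_const_zero (s := Finset.univ) (ι := ι)]
    exact tendsto_finsetSum _ fun k _ => by simpa using (h1 i k).mul (h2 k j)
  obtain ⟨hD0, hDu⟩ := dot_nonneg_of_tendsto hΨ hF hΦ' hFF' hD hG0 hlim
  have hH := hasMatDerivAt_scattering hΨ hF hΦ' hFF' hD
  set Z := M 0 * E * (M 0)⁻¹ with hZ
  have hM1 := mul_inv_self_of_isUnit (hMu 0)
  have hM2 := inv_mul_self_of_isUnit (hMu 0)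
  have hEZ : E = (M 0)⁻¹ * Z * M 0 := by
    calc E = (M 0)⁻¹ * M 0 * E * ((M 0)⁻¹ * M 0) := by rw [hM2, Matrix.one_mul, Matrix.mul_one]
      _ = _ := by simp only [hZ, Matrix.mul_assoc]
  have hZ2 : Z * Z = Z := by
    calc Z * Z = M 0 * (E * ((M 0)⁻¹ * M 0) * E) * (M 0)⁻¹ := by simp only [hZ, Matrix.mul_assoc]
      _ = Z := by rw [hM2, Matrix.mul_one, hE]
  have hZ0 : Z ≠ 0 := fun h => hE0 (by rw [hEZ, h, Matrix.mul_zero, Matrix.zero_mul])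
  have hZ1 : Z ≠ 1 := fun h => hE1 (by rw [hEZ, h, Matrix.mul_one, hM2])
  -- Each flow intertwines the conjugates M E M⁻¹ at its two times; going from 0 to t and back
  -- returns to Z. Differentiating this relation makes Z commute with Γ(t) D(0).
  have hZH : ∀ t, Z * (Ψ 0 t * Φ' t 0) = Ψ 0 t * Φ' t 0 * Z := fun t => by
    rw [← Matrix.mul_assoc, conj_comm_transition hM hMu hF hΨ hcF, Matrix.mul_assoc,
      conj_comm_transition hM hMu hF' hΦ' hcF', ← Matrix.mul_assoc]
  obtain ⟨N, c, hN, hc, hNc⟩ := exists_block_coordinates hDs hD0 hDu hZ2 hZ0 hZ1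
  refine ⟨N, c, hN, hc, fun t i j hij => ?_⟩
  have h1 := hNc (Ψ 0 t * G t * (Ψ 0 t)ᵀ)
    (by simp only [transpose_mul, transpose_transpose, hG, Matrix.mul_assoc])
    (((hH t).const_mul Z).unique (((hH t).mul_const Z).congr_fun hZH)) i j hij
  rw [Matrix.mul_inv_rev, hΨ.inv_eq hF, transpose_mul]
  simpa only [Matrix.mul_assoc] using h1

end Structure

/-- The given frame M only serves to find the classes of coordinates. The frame of the product
structure is Φ(t,0)N, in which the state matrix vanishes and B R⁻¹ Bᵀ is block diagonal. -/
theorem exists_productStructure_of_productForm {n m : ℕ}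
    {A : ℝ → Matrix (Fin n) (Fin n) ℝ} {B : ℝ → Matrix (Fin n) (Fin m) ℝ}
    (hAB : DynamicsAssumption A B)
    {Q : ℝ → Matrix (Fin n) (Fin n) ℝ} {S : ℝ → Matrix (Fin n) (Fin m) ℝ}
    {R : ℝ → Matrix (Fin m) (Fin m) ℝ} (hc : CostAssumption Q S R)
    (h : AdmitsProductForm A B Q S R) :
    ∃ (K : ℝ → Matrix (Fin m) (Fin n) ℝ) (R' : ℝ → Matrix (Fin m) (Fin m) ℝ),
      IsCanonicalCost A B K R' ∧ AdmitsProductStructure A B K R' ∧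
        optimalSynthesis A B (feedbackCost K R') = optimalSynthesis A B (quadCost Q S R) := by
  obtain ⟨_, _, ⟨⟨P, hP, rfl, hst⟩, ⟨P', hP', rfl, hst'⟩⟩, E₁, E₂, hE12, hE1, hE2, M, hM, hMu,
    hinv⟩ := h
  have hRu := hc.posDef_R.isUnit
  have hn : 0 < n := by
    rcases Nat.eq_zero_or_pos n with rfl | hn
    · exact absurd (Subsingleton.elim _ _) hE1
    · exact hn
  -- Without inputs, the determinant could not be normalized by scaling; the Kalman condition
  -- excludes this case since E₁ ≠ 0 gives n > 0.
  have : Nonempty (Fin m) := ⟨⟨0, hAB.kalman.pos hn⟩⟩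
  obtain ⟨μ, hμ, hdet⟩ := exists_pos_det_smul_eq_one (hc.posDef_R.det_pos 0)
  have hcan := isCanonicalCost_riccatiGain hAB hc hP hst hμ hdet
  refine ⟨_, _, hcan, ?_, optimalSynthesis_feedbackCost_smul hAB hc hP hμ⟩
  have hcl : ∀ {P}, IsRiccatiSolution A B Q S R P → SmoothMap (closedLoop A B S R P) :=
    fun {P} hP => hAB.smooth_A.sub ((hAB.smooth_B.mul (hc.smooth_R.inv hRu)).mul
      (hc.smooth_S.transpose.add (hAB.smooth_B.transpose.mul (hP.smooth hAB.smooth_A hAB.smooth_B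
        hc.smooth_Q hc.smooth_S hc.smooth_R hRu))))
  set F := closedLoop A B S R P with hF
  obtain ⟨Φ, hΦ, -⟩ := id hst
  have hRis : ∀ t, ((R t)⁻¹)ᵀ = (R t)⁻¹ := fun t => by
    rw [transpose_nonsing_inv, (hc.symm_R t).eq]
  have hRi0 : ∀ t v, 0 ≤ v ⬝ᵥ ((R t)⁻¹ *ᵥ v) := by
    obtain ⟨ρ, hρ, h1⟩ := hc.posDef_R.exists_dot_le
    intro t v
    have h2 := h1 t ((R t)⁻¹ *ᵥ v)
    rw [mulVec_mulVec, mul_inv_self_of_isUnit (hRu t), one_mulVec, dotProduct_comm _ v] at h2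
    exact (mul_nonneg hρ.le (dot_self_nonneg _)).trans h2
  obtain ⟨E, hE, hE0, hE1, hEc⟩ := exists_projection_of_isCompl hE12 hE1 hE2
  obtain ⟨N, c, hN, hcs, hNc⟩ := exists_block_coordinates_of_synthesis
    (G := fun t => B t * (R t)⁻¹ * (B t)ᵀ) (D := fun t => P t - P' t)
    (hcl hP).continuous (hcl hP').continuous
    (fun t => by simp only [transpose_mul, transpose_transpose, hRis, Matrix.mul_assoc])
    (fun t v => by
      rw [← mulVec_mulVec, ← mulVec_mulVec, dot_mulVec_comm]
      exact hRi0 t _)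
    (by rw [Matrix.IsSymm, transpose_sub, (hP.1 0).eq, (hP'.1 0).eq])
    (fun t => closedLoop_sub P P' t) (fun t => hP.hasMatDerivAt_sub hP' hc.symm_R t) hΦ hst hst'
    hE hE0 hE1 hM hMu
    (fun t => hEc _ (fun v hv => ((hinv t).1 v hv).1) fun v hv => ((hinv t).2 v hv).1)
    (fun t => hEc _ (fun v hv => ((hinv t).1 v hv).2) fun v hv => ((hinv t).2 v hv).2)
  set L : ℝ → Matrix (Fin n) (Fin n) ℝ := fun t => Φ t 0 * N with hL
  have hLd : ∀ t, HasMatDerivAt L (F t * L t) t := fun t =>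
    ((hΦ.hasMatDerivAt t 0).mul_const N).congr_deriv (Matrix.mul_assoc _ _ _)
  have hLs : SmoothMap L := smoothMap_of_linear (hcl hP) hLd
  have hLu : ∀ t, IsUnit (L t) := fun t => (hΦ.isUnit (hcl hP).continuous t 0).mul hN
  let e : Fin 2 → ℝ := ![0, 1]
  -- The coordinate projection onto the class 1.
  set I : Matrix (Fin n) (Fin n) ℝ := diagonal fun i => e (c i) with hI
  have he : ∀ b, e b * e b = e b := fun b => by fin_cases b <;> simp [e]
  have hX : ∀ t, (L t)⁻¹ * B t * (μ • R t)⁻¹ * ((L t)⁻¹ * B t)ᵀ =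
      μ⁻¹ • ((L t)⁻¹ * (B t * (R t)⁻¹ * (B t)ᵀ) * ((L t)⁻¹)ᵀ) := fun t => by
    rw [smul_inv_of_pos hμ (hRu t)]
    simp only [transpose_mul, Matrix.mul_assoc, Matrix.smul_mul, Matrix.mul_smul]
  obtain ⟨U, d, hU, hUu, hUR, hUc⟩ := exists_input_frame (B := fun t => (L t)⁻¹ * B t) (E := I)
    ((hLs.inv hLu).mul hAB.smooth_B)
    (fun t => by
      have h1 := (Matrix.mulVec_injective_iff_isUnit.2 ((isUnit_nonsing_inv_iff).2 (hLu t))).comp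
        (hAB.injective_B t)
      simpa only [Function.comp_def, mulVec_mulVec] using h1)
    hcan.symm_R hcan.posDef_R
    (by rw [hI, diagonal_mul_diagonal]; congr 1; funext i; exact he _)
    (diagonal_transpose _)
    (fun t => by
      rw [hX]
      exact diagonal_comm_of_apply_eq_zero e fun i j hij => by
        rw [Matrix.smul_apply, hNc t i j hij, smul_zero])
  refine admitsProductStructure_of_classes hAB hcan.smooth_K hcan.smooth_R hcan.symm_R hLs hLu hU
    hUu hUR hcs (c' := fun j => if d j = 0 then 0 else 1) (fun t i j _ => ?_) (fun t i j hij => ?_)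
    (fun t i j hij => ?_)
  · have h1 : changeCoord L (fun t => A t - B t * riccatiGain B S R P t) t = 0 := by
      rw [changeCoord, (hLd t).matDeriv_eq, hF, closedLoop_eq, neg_add_cancel, Matrix.mul_zero]
    rw [h1, Matrix.zero_apply]
  -- Entrywise, e (c i) b = b d j. If the state and input classes differ, exactly one of e (c i) and
  -- d j vanishes, so b = 0.
  · have h1 := congrFun (congrFun (hUc t).1 i) j
    rw [hI, diagonal_mul, mul_diagonal] at h1
    by_cases hj : d j = 0
    · have h2 : c i = 1 := by
        simp only [hj, if_true] at hij
        omega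
      rw [h2, hj, mul_zero] at h1
      simpa [e] using h1
    · have h2 : c i = 0 := by
        simp only [hj, if_false] at hij
        omega
      rw [h2] at h1
      simpa [e, hj] using h1.symm
  · exact apply_eq_zero_of_comm_diagonal (hUc t).2 fun h => hij (by simp only [h])

end LQ

theorem mainTheorem8 (n m : ℕ)
    (A : ℝ → Matrix (Fin n) (Fin n) ℝ) (B : ℝ → Matrix (Fin n) (Fin m) ℝ)
    (hAB : LQ.DynamicsAssumption A B)
    (Q : ℝ → Matrix (Fin n) (Fin n) ℝ) (S : ℝ → Matrix (Fin n) (Fin m) ℝ)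
    (R : ℝ → Matrix (Fin m) (Fin m) ℝ) (hc : LQ.CostAssumption Q S R) :
    LQ.AdmitsProductForm A B Q S R ↔
      ∃ (K : ℝ → Matrix (Fin m) (Fin n) ℝ) (R' : ℝ → Matrix (Fin m) (Fin m) ℝ),
        LQ.IsCanonicalCost A B K R' ∧
        LQ.AdmitsProductStructure A B K R' ∧
        LQ.optimalSynthesis A B (LQ.feedbackCost K R') =
          LQ.optimalSynthesis A B (LQ.quadCost Q S R) :=
  ⟨fun h => LQ.exists_productStructure_of_productForm hAB hc h,
    fun ⟨_, _, hcan, hprod, hsyn⟩ =>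
      LQ.admitsProductForm_of_productStructure hAB hc hcan hprod hsyn⟩
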